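/- Let $k$ be a field, $V$ a $k$-vector space with basis $v_1,v_2$, and identify the basis of $V^{\otimes N}$ with the words of length $N$ in the letters $1,2$. For $q\in k^\times$ let $\mathcal U^q$ be the operator on $V\otimes V$ with $11,22\mapsto 0$, $12\mapsto q\,12+21$, $21\mapsto 12+q^{-1}\,21$, and let $\mu^q(U_p)$ be the operator on $V^{\otimes N}$ acting as $\mathcal U^q$ on the tensor factors $p,p+1$ and trivially on the others. **Algebras.** $T_n=T_n(q)$ is the unital $k$-algebra with generators $U_1,\dots,U_{n-1}$ and relations $U_i^2=(q+q^{-1})U_i$, $U_iU_{i\pm1}U_i=U_i$, $U_iU_j=U_jU_i$ for $|i-j|\ne1$. For $\gamma,\delta\in k$ the blob algebra is the $k$-algebra with generators $e,U_1,\dots,U_{n-1}$ (no $e$ if $n=0$), the same relations among the $U_i$, and $U_1eU_1=\gamma U_1$, $e^2=\delta e$, $U_ie=eU_i$ for $i\neq1$. $T_n$ acts on $V^{\otimes n}$ by $U_i\mapsto\mu^q(U_i)$. If $a,x,Q\in k^\times$ with $a^4=-1$, let $q=x^2$, $\gamma=Qq^{-1}-Q^{-1}q$, $\delta=Q-Q^{-1}$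 (so $\gamma=q^{m-1}-q^{1-m}$, $\delta=q^m-q^{-m}$ when $Q=q^m$ with $m\in\mathbb Z$), and let $b_n$ be the corresponding blob algebra. It acts on $V^{\otimes 2n}$ by $e\mapsto a^{-2}\mu^{r}(U_n)$ and $U_i\mapsto\mu^{s}(U_{n-i})\,\mu^{t}(U_{n+i})$, where $r=a^2Q$, $s=a^5x$, $t=a^3x$. For each $r$ the span of the words with exactly $r$ letters $1$ is a submodule of $V^{\otimes n}$ (resp. $V^{\otimes 2n}$), called a permutation module. **Functors.** Let $A_n$ be $T_n$ or $b_n$, and assume $q+q^{-1}\ne0$, and in the case of $b_n$ also $\delta\neq0$. For $n\ge2$ put $\epsilon=(q+q^{-1})^{-1}U_{n-1}\in A_n$, an idempotent commuting with the image of $A_{n-2}$. Let $F(M)=\epsilon M$ and $G(N)=A_n\epsilon\otimes_{A_{n-2}}N$; $G$ is left adjoint to $F$. Let $\varphi_n$ be the adjunction map (counit) $G F(V^{\otimes n})\to V^{\otimes n}$ for $T_n$, resp. $G F(V^{\otimes 2n})\to V^{\otimes 2n}$ for $b_n$; explicitly, $\varphi_n(y\otimes v)=yv$. **Tilting modules.**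 Let $e_0=1$, $e_i=(q+q^{-1})^{-i}U_{n-1}U_{n-3}\cdots U_{n-2i+1}$ for $2\leq 2i\le n$, and $e_i=0$ for $2i>n$. The ideals $A_ne_iA_n$ give the quasi-hereditary structure of $A_n$. For $l\in\{n,n-2,\dots,0\text{ or }1\}$ with $l=n-2i$, the standard module of $T_n$ is $\Delta_n(l)=(T_n/T_ne_{i+1}T_n)e_i$. For $l\in\{-n,-n+2,\dots,n\}$ with $|l|=n-2i$, the standard module of $b_n$ is $\Delta_n(l)=(b_n/b_ne_{i+1}b_n)e_if$, where $f=\delta^{-1}e$, $1-\delta^{-1}e$, $1$ according as $l>0$, $l<0$, $l=0$. The costandard modules $\nabla_n(l)$ are the $k$-duals of the corresponding right modules $e_i(T_n/T_ne_{i+1}T_n)$, resp. $e_if(b_n/b_ne_{i+1}b_n)$. A module is tilting if it has a finite filtration with subquotients isomorphic to standard modules and also one with subquotients isomorphic to costandard modules. **Proposition.** 1. Suppose $q\in k^\times$ and $q+q^{-1}\neq0$. If the maps $\varphi_n:GF(V^{\otimes n})\to V^{\otimes n}$ for the Temperley–Lieb algebras are injective for all $n\ge2$, then for all $n\geq 0$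 the $T_n$-module $V^{\otimes n}$ and all its permutation submodules are tilting modules. 2. Suppose $a,x,Q\in k^\times$, $a^4=-1$, $q=x^2$, $q+q^{-1}\ne0$ and $Q\neq Q^{-1}$. If the maps $\varphi_n:GF(V^{\otimes 2n})\to V^{\otimes 2n}$ for the blob algebras are injective for all $n\ge2$, then for all $n\geq 0$ the $b_n$-module $V^{\otimes 2n}$ and all its permutation submodules are tilting modules. -/

import Mathlib

open scoped TensorProduct

namespace BlobTilting

/-! ## Localisation and globalisation functors, and the adjunction map -/

section Localisation

universe u v

/-- An idempotent `ε` of `A` together with an algebra map `B → A` whose image commutes with `ε`. -/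
structure LocData (k : Type u) (A B : Type u) [CommRing k] [Ring A] [Ring B]
    [Algebra k A] [Algebra k B] where
  incl : B →ₐ[k] A
  ε : A
  idem : ε * ε = ε
  comm : ∀ b : B, incl b * ε = ε * incl b

variable {k A B : Type u} [CommRing k] [Ring A] [Ring B] [Algebra k A] [Algebra k B]

namespace LocData

section F

variable (D : LocData k A B) (M : Type u) [AddCommGroup M] [Module k M] [Module A M]
  [IsScalarTower k A M]

/-- The localisation functor on objects, `F M = ε M`. -/
def F : Type u := ↥(LinearMap.range (Algebra.lsmul k k M D.ε))

instance : AddCommGroup (D.F M) :=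
  inferInstanceAs (AddCommGroup ↥(LinearMap.range (Algebra.lsmul k k M D.ε)))

instance : Module k (D.F M) :=
  inferInstanceAs (Module k ↥(LinearMap.range (Algebra.lsmul k k M D.ε)))

variable {M} in
/-- The underlying vector in `M` of an element of `F M = ε M`. -/
def F.val (y : D.F M) : M := Subtype.val y

variable {M} in
theorem F.ext {y z : D.F M} (h : F.val D y = F.val D z) : y = z := Subtype.ext h

variable {M} in
theorem F.eps_val (y : D.F M) : D.ε • F.val D y = F.val D y := by
  obtain ⟨_, m, rfl⟩ := y
  change D.ε • (D.ε • m) = D.ε • m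
  rw [smul_smul, D.idem]

/-- `B` acts on `ε M` through the map `B → A`. -/
instance : SMul B (D.F M) where
  smul b y := ⟨D.incl b • F.val D y, by
    refine ⟨D.incl b • F.val D y, ?_⟩
    change D.ε • (D.incl b • F.val D y) = _
    rw [smul_smul, ← D.comm, ← smul_smul, F.eps_val]⟩

variable {M} in
theorem F.val_smul (b : B) (y : D.F M) : F.val D (b • y) = D.incl b • F.val D y := rfl

variable {M} in
theorem F.val_add (y z : D.F M) : F.val D (y + z) = F.val D y + F.val D z := rfl

variable {M} in
theorem F.val_zero : F.val D (0 : D.F M) = 0 := rfl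

variable {M} in
theorem F.val_ksmul (c : k) (y : D.F M) : F.val D (c • y) = c • F.val D y := rfl

instance : Module B (D.F M) where
  one_smul y := F.ext D (by simp [F.val_smul])
  mul_smul b c y := F.ext D (by simp [F.val_smul, mul_smul])
  smul_zero b := F.ext D (by simp [F.val_smul, F.val_zero])
  smul_add b y z := F.ext D (by simp [F.val_smul, F.val_add])
  add_smul b c y := F.ext D (by simp [F.val_smul, F.val_add, add_smul])
  zero_smul y := F.ext D (by simp [F.val_smul, F.val_zero])

instance : IsScalarTower k B (D.F M) where
  smul_assoc c b y := F.ext D (by simp [F.val_smul, F.val_ksmul])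

end F

/-- Right multiplication by (the image of) `b : B` on the left ideal `A ε`. -/
def rightMul (D : LocData k A B) (x : Ideal.span {D.ε}) (b : B) : Ideal.span {D.ε} :=
  ⟨x.1 * D.incl b, by
    obtain ⟨y, hy⟩ := Ideal.mem_span_singleton'.1 x.2
    refine Ideal.mem_span_singleton'.2 ⟨y * D.incl b, ?_⟩
    rw [← hy, mul_assoc, D.comm, mul_assoc]⟩

section G

variable (D : LocData k A B) (N : Type u) [AddCommGroup N] [Module k N] [Module B N]

/-- The submodule of `A ε ⊗[k] N` by which one divides to obtain `A ε ⊗[B] N`. -/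
def balancing : Submodule A (↥(Ideal.span {D.ε}) ⊗[k] N) :=
  Submodule.span A {z | ∃ (x : Ideal.span {D.ε}) (b : B) (n : N),
    z = D.rightMul x b ⊗ₜ[k] n - x ⊗ₜ[k] (b • n)}

/-- The globalisation functor on objects, `G N = A ε ⊗[B] N`, as a left `A`-module. -/
def G : Type u := (↥(Ideal.span {D.ε}) ⊗[k] N) ⧸ D.balancing N

instance : AddCommGroup (D.G N) :=
  inferInstanceAs (AddCommGroup ((↥(Ideal.span {D.ε}) ⊗[k] N) ⧸ D.balancing N))

instance : Module A (D.G N) :=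
  inferInstanceAs (Module A ((↥(Ideal.span {D.ε}) ⊗[k] N) ⧸ D.balancing N))

variable {N} in
/-- The pure tensor `x ⊗ n` in `G N = A ε ⊗[B] N`. -/
def G.tmul (x : Ideal.span {D.ε}) (n : N) : D.G N :=
  Submodule.Quotient.mk (x ⊗ₜ[k] n)

end G

section Adjunction

variable (D : LocData k A B)
  (N : Type u) [AddCommGroup N] [Module k N] [Module B N]
  (M : Type u) [AddCommGroup M] [Module k M] [Module A M] [IsScalarTower k A M]

/-- The element `ε` of `A ε`. -/
def epsElt : Ideal.span {D.ε} := ⟨D.ε, Ideal.mem_span_singleton_self D.ε⟩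

variable {N} in
theorem G.tmul_smul (x : Ideal.span {D.ε}) (b : B) (n : N) :
    G.tmul D x (b • n) = G.tmul D (D.rightMul x b) n := by
  refine ((Submodule.Quotient.eq _).2 ?_).symm
  exact Submodule.subset_span ⟨x, b, n, rfl⟩

variable {N M} in
/-- One direction of the adjunction: `f ↦ (n ↦ f (ε ⊗ n))`. -/
def toF (f : D.G N →ₗ[A] M) : N →ₗ[B] D.F M where
  toFun n := ⟨f (G.tmul D D.epsElt n), f (G.tmul D D.epsElt n), by
    change D.ε • f _ = f _
    rw [← map_smul]
    congr 1
    change Submodule.Quotient.mk ((D.ε • D.epsElt) ⊗ₜ[k] n) = _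
    congr 2
    exact Subtype.ext D.idem⟩
  map_add' n n' := F.ext D (by
    change f _ = f _ + f _
    rw [← map_add]
    congr 1
    change Submodule.Quotient.mk _ = _
    rw [TensorProduct.tmul_add]
    rfl)
  map_smul' b n := F.ext D (by
    change f _ = D.incl b • f _
    rw [← map_smul, G.tmul_smul]
    congr 1
    change _ = Submodule.Quotient.mk ((D.incl b • D.epsElt) ⊗ₜ[k] n)
    change Submodule.Quotient.mk _ = _
    congr 2
    exact Subtype.ext (D.comm b).symm)

variable [IsScalarTower k B N]

variable {N M} in
theorem map_ksmul (g : N →ₗ[B] D.F M) (c : k) (n : N) : g (c • n) = c • g n := by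
  rw [← algebraMap_smul B c n, map_smul, algebraMap_smul]

variable {N M} in
/-- The `A`-linear map `A ε ⊗[k] N → M`, `x ⊗ n ↦ x • g n`. -/
def preOfF (g : N →ₗ[B] D.F M) : (↥(Ideal.span {D.ε}) ⊗[k] N) →ₗ[A] M :=
  TensorProduct.AlgebraTensorModule.lift
    { toFun := fun x =>
        { toFun := fun n => x.1 • F.val D (g n)
          map_add' := fun n n' => by rw [map_add, F.val_add, smul_add]
          map_smul' := fun c n => by
            rw [map_ksmul, F.val_ksmul, smul_comm]; rfl }
      map_add' := fun x y => by ext n; exact add_smul _ _ _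
      map_smul' := fun a x => by ext n; exact mul_smul _ _ _ }

variable {N M} in
/-- The other direction of the adjunction: `g ↦ (x ⊗ n ↦ x • g n)`. -/
def ofF (g : N →ₗ[B] D.F M) : D.G N →ₗ[A] M :=
  (D.balancing N).liftQ (D.preOfF g) (by
    refine Submodule.span_le.2 ?_
    rintro _ ⟨x, b, n, rfl⟩
    change D.preOfF g _ = 0
    rw [map_sub, sub_eq_zero]
    change (x.1 * D.incl b) • F.val D (g n) = x.1 • F.val D (g (b • n))
    rw [map_smul, F.val_smul, mul_smul])

variable {N M} in
theorem ofF_tmul (g : N →ₗ[B] D.F M) (x : Ideal.span {D.ε}) (n : N) :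
    D.ofF g (G.tmul D x n) = x.1 • F.val D (g n) := rfl

/-- The adjunction `Hom_A (G N, M) ≃ Hom_B (N, F M)`. -/
def homEquiv : (D.G N →ₗ[A] M) ≃ (N →ₗ[B] D.F M) where
  toFun := D.toF
  invFun := D.ofF
  left_inv f := by
    refine LinearMap.ext fun z => ?_
    obtain ⟨z, rfl⟩ := Submodule.Quotient.mk_surjective _ z
    induction z using TensorProduct.induction_on with
    | zero => exact (map_zero (D.ofF (D.toF f))).trans (map_zero f).symm
    | add y z hy hz =>
      rw [Submodule.Quotient.mk_add]
      exact (map_add (D.ofF (D.toF f)) _ _).trans ((congrArg₂ _ hy hz).trans (map_add f _ _).symm)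
    | tmul x n =>
      change x.1 • f (G.tmul D D.epsElt n) = f (G.tmul D x n)
      rw [← map_smul]
      congr 1
      change Submodule.Quotient.mk ((x.1 • D.epsElt) ⊗ₜ[k] n) = Submodule.Quotient.mk _
      congr 2
      refine Subtype.ext ?_
      obtain ⟨y, hy⟩ := Ideal.mem_span_singleton'.1 x.2
      change x.1 * D.ε = x.1
      rw [← hy, mul_assoc, D.idem]
  right_inv g := by
    refine LinearMap.ext fun n => F.ext D ?_
    change D.ε • F.val D (g n) = F.val D (g n)
    exact F.eps_val D _

/-- The adjunction map (counit) `φ_M : G (F M) → M`. -/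
def adjMap : D.G (D.F M) →ₗ[A] M := (D.homEquiv (D.F M) M).symm LinearMap.id

/-- The adjunction map is multiplication: `φ_M (x ⊗ y) = x • y`. -/
theorem adjMap_tmul (x : Ideal.span {D.ε}) (y : D.F M) :
    D.adjMap M (G.tmul D x y) = x.1 • F.val D y := rfl

end Adjunction

end LocData

end Localisation

/-! ## Standard and costandard modules, filtrations, tilting modules -/

section Standard

universe u

/-- The left `A`-module `(A / A e A) f`. Suppose that `A e A` is a term of a heredity chain of `A`
and that `f` is an idempotent whose image in `A / A e A` is primitive and lies in the heredity ideal
of `A / A e A` that comes next in the chain. Then this is the standard module of the corresponding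
weight `λ`: the largest quotient of the projective cover of `L(λ)` all of whose composition factors
`L(μ)` are annihilated by `A e A`, i.e. are not above the layer of `λ` in the heredity order. -/
def StandardModule (A : Type u) [Ring A] (e f : A) : Type u :=
  ↥(Submodule.span A {(Submodule.Quotient.mk f : A ⧸ (TwoSidedIdeal.span {e}).asIdeal)})

variable (k A : Type u) [Field k] [Ring A] [Algebra k A] (e f : A)

instance : AddCommGroup (StandardModule A e f) :=
  inferInstanceAs (AddCommGroup ↥(Submodule.span A
    {(Submodule.Quotient.mk f : A ⧸ (TwoSidedIdeal.span {e}).asIdeal)}))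

instance : Module A (StandardModule A e f) :=
  inferInstanceAs (Module A ↥(Submodule.span A
    {(Submodule.Quotient.mk f : A ⧸ (TwoSidedIdeal.span {e}).asIdeal)}))

instance : Module k (StandardModule A e f) :=
  inferInstanceAs (Module k ↥(Submodule.span A
    {(Submodule.Quotient.mk f : A ⧸ (TwoSidedIdeal.span {e}).asIdeal)}))

instance : SMulCommClass A k (StandardModule A e f) :=
  inferInstanceAs (SMulCommClass A k ↥(Submodule.span A
    {(Submodule.Quotient.mk f : A ⧸ (TwoSidedIdeal.span {e}).asIdeal)}))

/-- The costandard module `∇(f)`: the `k`-linear dual of the standard module of the opposite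
algebra (that is, of the right `A`-module `f (A / A e A)`), with `(a • φ) y = φ (y a)`. -/
def CostandardModule : Type u :=
  Module.Dual k (StandardModule Aᵐᵒᵖ (MulOpposite.op e) (MulOpposite.op f))

instance : AddCommGroup (CostandardModule k A e f) :=
  inferInstanceAs (AddCommGroup
    (Module.Dual k (StandardModule Aᵐᵒᵖ (MulOpposite.op e) (MulOpposite.op f))))

variable {k A e f} in
/-- The action `(a • φ) y = φ (y a)` on the dual of a right module. -/
def CostandardModule.act (a : A)
    (φ : Module.Dual k (StandardModule Aᵐᵒᵖ (MulOpposite.op e) (MulOpposite.op f))) :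
    Module.Dual k (StandardModule Aᵐᵒᵖ (MulOpposite.op e) (MulOpposite.op f)) where
  toFun y := φ (MulOpposite.op a • y)
  map_add' y z := by rw [smul_add, map_add]
  map_smul' c y := by rw [smul_comm, map_smul]; rfl

instance : Module A (CostandardModule k A e f) where
  smul a φ := CostandardModule.act a φ
  one_smul φ := LinearMap.ext fun y => congrArg φ.toFun (one_smul _ y)
  mul_smul a b φ := LinearMap.ext fun y =>
    congrArg φ.toFun (mul_smul (MulOpposite.op b) (MulOpposite.op a) y)
  smul_zero _ := rfl
  smul_add _ _ _ := rfl
  add_smul a b φ := LinearMap.ext fun y =>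
    (congrArg φ.toFun (add_smul (MulOpposite.op a) (MulOpposite.op b) y)).trans (φ.map_add' _ _)
  zero_smul φ := LinearMap.ext fun y =>
    (congrArg φ.toFun (zero_smul Aᵐᵒᵖ y)).trans (LinearMap.map_zero φ)

/-- `M` has a finite filtration by `A`-submodules whose successive quotients are isomorphic to
members of the family `X`. -/
def HasFiltration (A : Type u) [Ring A] {ι : Type} (X : ι → Type u)
    [∀ i, AddCommGroup (X i)] [∀ i, Module A (X i)]
    (M : Type u) [AddCommGroup M] [Module A M] : Prop :=
  ∃ (l : ℕ) (S : ℕ → Submodule A M), Monotone S ∧ S 0 = ⊥ ∧ S l = ⊤ ∧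
    ∀ j < l, ∃ i : ι, Nonempty ((↥(S (j + 1)) ⧸ (S j).submoduleOf (S (j + 1))) ≃ₗ[A] X i)

end Standard

/-! ## Operators on tensor space

`V` has basis `v₁, v₂`; the letters `1, 2` are the elements `0, 1` of `Fin 2`. A vector of
`V^{⊗ N}` is given by its coordinates with respect to the basis of words of length `N`. -/

section Tensor

universe u

variable {k : Type u} [Field k]

/-- Coordinates on `V^{⊗ N}` in the basis of words of length `N` in the two letters. -/
abbrev TensorSpace (k : Type u) (N : ℕ) : Type u := (Fin N → Fin 2) → k

/-- The operator which acts as the matrix `X` in the tensor factors `i, j` and trivially in the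
other tensor factors. -/
def twoSite {N : ℕ} (X : Matrix (Fin 2 × Fin 2) (Fin 2 × Fin 2) k) (i j : Fin N) :
    Module.End k (TensorSpace k N) where
  toFun f := fun w => ∑ a : Fin 2, ∑ b : Fin 2,
    X (w i, w j) (a, b) * f (Function.update (Function.update w i a) j b)
  map_add' f g := by
    ext w
    simp only [Pi.add_apply, mul_add, Finset.sum_add_distrib]
  map_smul' c f := by
    ext w
    simp only [Pi.smul_apply, smul_eq_mul, RingHom.id_apply, Finset.mul_sum]
    exact Finset.sum_congr rfl fun a _ => Finset.sum_congr rfl fun b _ => by ring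

/-- The matrix `𝒰^q` on `V ⊗ V`, in the basis `11, 12, 21, 22`. -/
def matU (q : kˣ) : Matrix (Fin 2 × Fin 2) (Fin 2 × Fin 2) k :=
  Matrix.of fun p p' =>
    (!![0, 0, 0, 0;
        0, (q : k), 1, 0;
        0, 1, ((q⁻¹ : kˣ) : k), 0;
        0, 0, 0, 0] : Matrix (Fin 4) (Fin 4) k) (finProdFinEquiv p) (finProdFinEquiv p')

/-- The number of letters `1` in a word. -/
def numOnes {N : ℕ} (w : Fin N → Fin 2) : ℕ := (Finset.univ.filter fun i => w i = 0).card


theorem twoSite_apply {N : ℕ} (X : Matrix (Fin 2 × Fin 2) (Fin 2 × Fin 2) k) (i j : Fin N)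
    (f : TensorSpace k N) (w : Fin N → Fin 2) :
    twoSite X i j f w = ∑ a : Fin 2, ∑ b : Fin 2,
      X (w i, w j) (a, b) * f (Function.update (Function.update w i a) j b) := rfl

/-- A word with prescribed letters in four positions. -/
def word4 {N : ℕ} (w : Fin N → Fin 2) (i j l m : Fin N) (a b c d : Fin 2) : Fin N → Fin 2 :=
  fun p => if p = i then a else if p = j then b else if p = l then c else if p = m then d else w p

/-- A word with prescribed letters in three positions. -/
def word3 {N : ℕ} (w : Fin N → Fin 2) (i j l : Fin N) (a b c : Fin 2) : Fin N → Fin 2 :=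
  fun p => if p = i then a else if p = j then b else if p = l then c else w p

theorem word4_self {N : ℕ} (w : Fin N → Fin 2) (i j l m : Fin N) :
    word4 w i j l m (w i) (w j) (w l) (w m) = w := by
  ext p; simp only [word4]; split_ifs <;> simp_all

theorem word3_self {N : ℕ} (w : Fin N → Fin 2) (i j l : Fin N) :
    word3 w i j l (w i) (w j) (w l) = w := by
  ext p; simp only [word3]; split_ifs <;> simp_all

variable {N : ℕ} (X Y : Matrix (Fin 2 × Fin 2) (Fin 2 × Fin 2) k) {i j l m : Fin N}

theorem twoSite_word3_12 (h : i ≠ j) (f : TensorSpace k N) (w : Fin N → Fin 2) (a b c : Fin 2) :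
    twoSite X i j f (word3 w i j l a b c)
      = ∑ a' : Fin 2, ∑ b' : Fin 2, X (a, b) (a', b') * f (word3 w i j l a' b' c) := by
  rw [twoSite_apply]
  refine Finset.sum_congr rfl fun a' _ => Finset.sum_congr rfl fun b' _ => ?_
  congr 2
  · simp [word3, h.symm]
  · ext p; simp only [word3, Function.update_apply]; split_ifs <;> simp_all

theorem twoSite_word3_23 (h : i ≠ j) (h' : i ≠ l) (h2 : j ≠ l) (f : TensorSpace k N)
    (w : Fin N → Fin 2) (a b c : Fin 2) :
    twoSite X j l f (word3 w i j l a b c)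
      = ∑ b' : Fin 2, ∑ c' : Fin 2, X (b, c) (b', c') * f (word3 w i j l a b' c') := by
  rw [twoSite_apply]
  refine Finset.sum_congr rfl fun a' _ => Finset.sum_congr rfl fun b' _ => ?_
  congr 2
  · simp [word3, h.symm, h'.symm, h2.symm]
  · ext p; simp only [word3, Function.update_apply]; split_ifs <;> simp_all

theorem twoSite_word4_12 (h : i ≠ j) (f : TensorSpace k N) (w : Fin N → Fin 2)
    (a b c d : Fin 2) :
    twoSite X i j f (word4 w i j l m a b c d)
      = ∑ a' : Fin 2, ∑ b' : Fin 2, X (a, b) (a', b') * f (word4 w i j l m a' b' c d) := by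
  rw [twoSite_apply]
  refine Finset.sum_congr rfl fun a' _ => Finset.sum_congr rfl fun b' _ => ?_
  congr 2
  · simp [word4, h.symm]
  · ext p; simp only [word4, Function.update_apply]; split_ifs <;> simp_all

theorem twoSite_word4_23 (h : i ≠ j) (h' : i ≠ l) (h2 : j ≠ l) (f : TensorSpace k N)
    (w : Fin N → Fin 2) (a b c d : Fin 2) :
    twoSite X j l f (word4 w i j l m a b c d)
      = ∑ b' : Fin 2, ∑ c' : Fin 2, X (b, c) (b', c') * f (word4 w i j l m a b' c' d) := by
  rw [twoSite_apply]
  refine Finset.sum_congr rfl fun a' _ => Finset.sum_congr rfl fun b' _ => ?_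
  congr 2
  · simp [word4, h.symm, h'.symm, h2.symm]
  · ext p; simp only [word4, Function.update_apply]; split_ifs <;> simp_all

theorem twoSite_word4_34 (h1 : i ≠ l) (h2 : i ≠ m) (h3 : j ≠ l) (h4 : j ≠ m) (h5 : l ≠ m)
    (f : TensorSpace k N) (w : Fin N → Fin 2) (a b c d : Fin 2) :
    twoSite X l m f (word4 w i j l m a b c d)
      = ∑ c' : Fin 2, ∑ d' : Fin 2, X (c, d) (c', d') * f (word4 w i j l m a b c' d') := by
  rw [twoSite_apply]
  refine Finset.sum_congr rfl fun a' _ => Finset.sum_congr rfl fun b' _ => ?_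
  congr 2
  · simp [word4, h1.symm, h2.symm, h3.symm, h4.symm, h5.symm]
  · ext p; simp only [word4, Function.update_apply]; split_ifs <;> simp_all

theorem twoSite_comm (h0 : i ≠ j) (h1 : i ≠ l) (h2 : i ≠ m) (h3 : j ≠ l) (h4 : j ≠ m)
    (h5 : l ≠ m) : twoSite X i j * twoSite Y l m = twoSite Y l m * twoSite X i j := by
  refine LinearMap.ext fun f => funext fun w => ?_
  rw [← word4_self w i j l m, Module.End.mul_apply, Module.End.mul_apply]
  simp only [twoSite_word4_12 X h0, twoSite_word4_34 Y h1 h2 h3 h4 h5, Fin.sum_univ_two]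
  ring

theorem matU_apply (q : kˣ) (a b c d : Fin 2) : matU q (a, b) (c, d)
    = if a = b ∨ c = d then 0 else if a = c then (if a = 0 then (q : k) else ((q⁻¹ : kˣ) : k))
      else 1 := by
  fin_cases a <;> fin_cases b <;> fin_cases c <;> fin_cases d <;> rfl

theorem matU_sq (q : kˣ) (h : i ≠ j) :
    twoSite (matU q) i j * twoSite (matU q) i j
      = ((q : k) + ((q⁻¹ : kˣ) : k)) • twoSite (matU q) i j := by
  refine LinearMap.ext fun f => funext fun w => ?_
  have hq : (q : k) * ((q⁻¹ : kˣ) : k) = 1 := by simp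
  rw [← word3_self w i j j, Module.End.mul_apply, LinearMap.smul_apply, Pi.smul_apply]
  simp only [twoSite_word3_12 _ h, Fin.sum_univ_two, matU_apply]
  generalize w i = a, w j = b
  fin_cases a <;> fin_cases b <;> simp <;> grind

theorem matU_braid (q : kˣ) (h : i ≠ j) (h' : i ≠ l) (h2 : j ≠ l) :
    twoSite (matU q) i j * twoSite (matU q) j l * twoSite (matU q) i j = twoSite (matU q) i j := by
  refine LinearMap.ext fun f => funext fun w => ?_
  have hq : (q : k) * ((q⁻¹ : kˣ) : k) = 1 := by simp
  rw [← word3_self w i j l, Module.End.mul_apply, Module.End.mul_apply]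
  simp only [twoSite_word3_12 _ h, twoSite_word3_23 _ h h' h2, Fin.sum_univ_two, matU_apply]
  generalize w i = a, w j = b, w l = c
  fin_cases a <;> fin_cases b <;> fin_cases c <;> simp <;> grind

theorem matU_braid' (q : kˣ) (h : i ≠ j) (h' : i ≠ l) (h2 : j ≠ l) :
    twoSite (matU q) j l * twoSite (matU q) i j * twoSite (matU q) j l = twoSite (matU q) j l := by
  refine LinearMap.ext fun f => funext fun w => ?_
  have hq : (q : k) * ((q⁻¹ : kˣ) : k) = 1 := by simp
  rw [← word3_self w i j l, Module.End.mul_apply, Module.End.mul_apply]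
  simp only [twoSite_word3_12 _ h, twoSite_word3_23 _ h h' h2, Fin.sum_univ_two, matU_apply]
  generalize w i = a, w j = b, w l = c
  fin_cases a <;> fin_cases b <;> fin_cases c <;> simp <;> grind

theorem matU_blob (r s t : kˣ) (h0 : i ≠ j) (h1 : i ≠ l) (h2 : i ≠ m) (h3 : j ≠ l) (h4 : j ≠ m)
    (h5 : l ≠ m) :
    (twoSite (matU s) i j * twoSite (matU t) l m) * twoSite (matU r) j l *
      (twoSite (matU s) i j * twoSite (matU t) l m)
      = (((r * s⁻¹ * t⁻¹ : kˣ) : k) + ((s * t * r⁻¹ : kˣ) : k)) •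
        (twoSite (matU s) i j * twoSite (matU t) l m) := by
  refine LinearMap.ext fun f => funext fun w => ?_
  have hr : (r : k) ≠ 0 := r.ne_zero
  have hs : (s : k) ≠ 0 := s.ne_zero
  have ht : (t : k) ≠ 0 := t.ne_zero
  rw [← word4_self w i j l m, Module.End.mul_apply, Module.End.mul_apply, Module.End.mul_apply,
    Module.End.mul_apply, LinearMap.smul_apply, Pi.smul_apply, Module.End.mul_apply]
  simp only [twoSite_word4_12 _ h0, twoSite_word4_23 _ h0 h1 h3, twoSite_word4_34 _ h1 h2 h3 h4 h5,
    Fin.sum_univ_two, matU_apply, Units.val_mul]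
  generalize w i = a, w j = b, w l = c, w m = d
  generalize word4 w i j l m = g
  fin_cases a <;> fin_cases b <;> fin_cases c <;> fin_cases d <;> simp <;>
    field_simp <;> ring
/-- The vectors of `V^{⊗ N}` in the span of the words with exactly `r` letters `1`. -/
def weightSpace (k : Type u) [Field k] (N r : ℕ) : Submodule k (TensorSpace k N) where
  carrier := {f | ∀ w, numOnes w ≠ r → f w = 0}
  add_mem' hf hg w hw := by rw [Pi.add_apply, hf w hw, hg w hw, add_zero]
  zero_mem' _ _ := rfl
  smul_mem' c f hf w hw := by rw [Pi.smul_apply, hf w hw, smul_zero]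

theorem numOnes_comp_swap (w : Fin N → Fin 2) (i j : Fin N) :
    numOnes (w ∘ Equiv.swap i j) = numOnes w := by
  unfold numOnes
  refine Finset.card_equiv (Equiv.swap i j) fun p => ?_
  simp

theorem matU_weightSpace (q : kˣ) (h : i ≠ j) (r : ℕ) (f : TensorSpace k N)
    (hf : f ∈ weightSpace k N r) : twoSite (matU q) i j f ∈ weightSpace k N r := by
  intro w hw
  rw [twoSite_apply]
  refine Finset.sum_eq_zero fun a _ => Finset.sum_eq_zero fun b _ => ?_
  rw [matU_apply]
  by_cases h1 : w i = w j ∨ a = b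
  · rw [if_pos h1, zero_mul]
  · push Not at h1
    have key : numOnes (Function.update (Function.update w i a) j b) = numOnes w := by
      by_cases h2 : a = w i
      · have h3 : b = w j := by
          have := h1.1; have := h1.2; omega
        rw [h2, h3]; simp
      · rw [← numOnes_comp_swap w i j]
        congr 1
        have h3 : a = w j := by have := h1.1; omega
        have h4 : b = w i := by have := h1.1; have := h1.2; omega
        subst h3 h4
        ext p
        by_cases hp : p = j
        · subst hp; simp
        · by_cases hp' : p = i
          · subst hp'; simp [h]
          · simp [hp, hp', Equiv.swap_apply_of_ne_of_ne hp' hp]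
    rw [hf _ (by rw [key]; exact hw), mul_zero]

end Tensor

/-! ## The Temperley–Lieb algebra and its tensor space -/

section TemperleyLieb

universe u

/-- The generators `U₁, …, U_{n-1}`. -/
inductive TLGen (n : ℕ) : Type
  | U (i : ℕ) (h₁ : 1 ≤ i) (h₂ : i < n)

variable {k : Type u} [Field k]

/-- The defining relations of the Temperley–Lieb algebra. -/
inductive TLRel (q : kˣ) (n : ℕ) : FreeAlgebra k (TLGen n) → FreeAlgebra k (TLGen n) → Prop
  | sq (i : ℕ) (h₁ : 1 ≤ i) (h₂ : i < n) : TLRel q n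
      (FreeAlgebra.ι k (.U i h₁ h₂) * FreeAlgebra.ι k (.U i h₁ h₂))
      (((q : k) + ((q⁻¹ : kˣ) : k)) • FreeAlgebra.ι k (.U i h₁ h₂))
  | up (i : ℕ) (h₁ : 1 ≤ i) (h₂ : i < n) (h₃ : 1 ≤ i + 1) (h₄ : i + 1 < n) : TLRel q n
      (FreeAlgebra.ι k (.U i h₁ h₂) * FreeAlgebra.ι k (.U (i + 1) h₃ h₄)
        * FreeAlgebra.ι k (.U i h₁ h₂))
      (FreeAlgebra.ι k (.U i h₁ h₂))
  | down (i : ℕ) (h₁ : 1 ≤ i) (h₂ : i < n) (h₃ : 1 ≤ i + 1) (h₄ : i + 1 < n) : TLRel q n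
      (FreeAlgebra.ι k (.U (i + 1) h₃ h₄) * FreeAlgebra.ι k (.U i h₁ h₂)
        * FreeAlgebra.ι k (.U (i + 1) h₃ h₄))
      (FreeAlgebra.ι k (.U (i + 1) h₃ h₄))
  | comm (i j : ℕ) (h₁ : 1 ≤ i) (h₂ : i < n) (h₃ : 1 ≤ j) (h₄ : j < n)
      (hij : i + 1 ≠ j) (hji : j + 1 ≠ i) : TLRel q n
      (FreeAlgebra.ι k (.U i h₁ h₂) * FreeAlgebra.ι k (.U j h₃ h₄))
      (FreeAlgebra.ι k (.U j h₃ h₄) * FreeAlgebra.ι k (.U i h₁ h₂))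

/-- The Temperley–Lieb algebra `T_n(q)` over `k`. -/
def TLAlg (q : kˣ) (n : ℕ) : Type u := RingQuot (TLRel q n)

instance (q : kˣ) (n : ℕ) : Ring (TLAlg q n) := inferInstanceAs (Ring (RingQuot (TLRel q n)))

instance (q : kˣ) (n : ℕ) : Algebra k (TLAlg q n) :=
  inferInstanceAs (Algebra k (RingQuot (TLRel q n)))

namespace TLAlg

variable (q : kˣ)

/-- The quotient map from the free algebra. -/
def mk (n : ℕ) : FreeAlgebra k (TLGen n) →ₐ[k] TLAlg q n := RingQuot.mkAlgHom k (TLRel q n)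

/-- The generator `U_i` of `T_n(q)`. -/
def U {n : ℕ} (i : ℕ) (h₁ : 1 ≤ i) (h₂ : i < n) : TLAlg q n := mk q n (FreeAlgebra.ι k (.U i h₁ h₂))

variable {q} in
theorem mk_eq {n : ℕ} {x y : FreeAlgebra k (TLGen n)} (h : TLRel q n x y) : mk q n x = mk q n y :=
  RingQuot.mkAlgHom_rel k h

variable {q} in
/-- The universal property of `T_n(q)`. -/
def lift {n : ℕ} {R : Type u} [Ring R] [Algebra k R] (g : TLGen n → R)
    (hg : ∀ ⦃x y⦄, TLRel q n x y → FreeAlgebra.lift k g x = FreeAlgebra.lift k g y) :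
    TLAlg q n →ₐ[k] R :=
  RingQuot.liftAlgHom k ⟨FreeAlgebra.lift k g, hg⟩

theorem lift_mk {n : ℕ} {R : Type u} [Ring R] [Algebra k R] (g : TLGen n → R)
    (hg : ∀ ⦃x y⦄, TLRel q n x y → FreeAlgebra.lift k g x = FreeAlgebra.lift k g y)
    (x : FreeAlgebra k (TLGen n)) : lift g hg (mk q n x) = FreeAlgebra.lift k g x :=
  RingQuot.liftAlgHom_mkAlgHom_apply k _ _ x

theorem mk_surjective (n : ℕ) : Function.Surjective (mk q n) :=
  RingQuot.mkAlgHom_surjective k _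

/-- The natural map `T_n → T_{n+2}`, `U_i ↦ U_i`. -/
def incl (n : ℕ) : TLAlg q n →ₐ[k] TLAlg q (n + 2) :=
  lift (fun | .U i h₁ h₂ => U q i h₁ (by omega)) (by
    intro x y h
    induction h with
    | sq i h₁ h₂ =>
      simpa [U] using mk_eq (TLRel.sq (q := q) (n := n + 2) i h₁ (by omega))
    | up i h₁ h₂ h₃ h₄ =>
      simpa [U] using mk_eq (TLRel.up (q := q) (n := n + 2) i h₁ (by omega) h₃ (by omega))
    | down i h₁ h₂ h₃ h₄ =>
      simpa [U] using mk_eq (TLRel.down (q := q) (n := n + 2) i h₁ (by omega) h₃ (by omega))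
    | comm i j h₁ h₂ h₃ h₄ hij hji =>
      simpa [U] using
        mk_eq (TLRel.comm (q := q) (n := n + 2) i j h₁ (by omega) h₃ (by omega) hij hji))

/-- The element `ε = [2]⁻¹ U_{n+1}` of `T_{n+2}`. -/
def eps (n : ℕ) : TLAlg q (n + 2) :=
  ((q : k) + ((q⁻¹ : kˣ) : k))⁻¹ • U q (n + 1) (by omega) (by omega)

/-- The localisation data: `T_n → T_{n+2}` and the idempotent `ε = [2]⁻¹ U_{n+1}`. -/
def locData (h : (q : k) + ((q⁻¹ : kˣ) : k) ≠ 0) (n : ℕ) :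
    LocData k (TLAlg q (n + 2)) (TLAlg q n) where
  incl := incl q n
  ε := eps q n
  idem := by
    have := mk_eq (TLRel.sq (q := q) (n := n + 2) (n + 1) (by omega) (by omega))
    rw [map_mul, map_smul] at this
    rw [eps, smul_mul_smul_comm, U, this, smul_smul]
    congr 1
    field_simp
  comm := by
    intro b
    obtain ⟨b, rfl⟩ := mk_surjective q n b
    induction b using FreeAlgebra.induction with
    | grade0 r => rw [AlgHom.commutes, AlgHom.commutes]; exact Algebra.commutes _ _
    | grade1 x =>
      obtain ⟨i, h₁, h₂⟩ := x
      rw [incl, lift_mk, FreeAlgebra.lift_ι_apply, eps, mul_smul_comm, smul_mul_assoc]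
      congr 1
      have := mk_eq (TLRel.comm (q := q) (n := n + 2) i (n + 1) h₁ (by omega) (by omega)
        (by omega) (by omega) (by omega))
      simpa [U] using this
    | mul x y hx hy => rw [map_mul, map_mul, mul_assoc, hy, ← mul_assoc, hx, mul_assoc]
    | add x y hx hy => rw [map_add, map_add, add_mul, mul_add, hx, hy]

/-- The idempotents `1, ε, …` of `T_n` that generate its heredity chain of ideals, continued by `0`:
the `(i+1)`-st idempotent of `T_{n+2}` is `ε` times the image of the `i`-th idempotent of `T_n`, so
that the `i`-th idempotent of `T_n` is `[2]^{-i} U_{n-1} U_{n-3} ⋯ U_{n-2i+1}` if `2i ≤ n`. -/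
def chain : (n i : ℕ) → TLAlg q n
  | _, 0 => 1
  | 0, _ + 1 => 0
  | 1, _ + 1 => 0
  | n + 2, i + 1 => eps q n * incl q n (chain n i)

/-- The weights `Λ_n = {n, n-2, …, 0 or 1}`. -/
abbrev Weight (n : ℕ) : Type := {l : ℕ // l ≤ n ∧ l % 2 = n % 2}

/-- The standard module `Δ_n(l)`: with `l = n - 2i` and `e_i = chain n i`, this is
`(T_n / T_n e_{i+1} T_n) e_i`. -/
abbrev Delta (n : ℕ) (l : Weight n) : Type u :=
  StandardModule (TLAlg q n) (chain q n ((n - l.1) / 2 + 1)) (chain q n ((n - l.1) / 2))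

/-- The costandard module `∇_n(l)`. -/
abbrev Nabla (n : ℕ) (l : Weight n) : Type u :=
  CostandardModule k (TLAlg q n) (chain q n ((n - l.1) / 2 + 1)) (chain q n ((n - l.1) / 2))

/-- A `T_n`-module is tilting if it has a standard and a costandard filtration. -/
def IsTilting (n : ℕ) (M : Type u) [AddCommGroup M] [Module (TLAlg q n) M] : Prop :=
  HasFiltration (TLAlg q n) (Delta q n) M ∧ HasFiltration (TLAlg q n) (Nabla q n) M

/-- The tensor space representation `μ^q` of `T_n` on `V^{⊗ n}`: `U_i` acts as `𝒰^q` on the tensor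
factors `i` and `i + 1` (which have the indices `i - 1` and `i` in `Fin n`). -/
def tensorRep (n : ℕ) : TLAlg q n →ₐ[k] Module.End k (TensorSpace k n) :=
  lift (fun | .U i h₁ h₂ => twoSite (matU q) ⟨i - 1, by omega⟩ ⟨i, h₂⟩) (by
    intro x y h
    induction h with
    | sq i h₁ h₂ =>
      simp only [map_mul, map_smul, FreeAlgebra.lift_ι_apply]
      exact matU_sq q (Fin.ne_of_val_ne (by simp; omega))
    | up i h₁ h₂ h₃ h₄ =>
      simp only [map_mul, FreeAlgebra.lift_ι_apply]
      exact matU_braid q (Fin.ne_of_val_ne (by simp; omega)) (Fin.ne_of_val_ne (by simp))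
        (Fin.ne_of_val_ne (by simp))
    | down i h₁ h₂ h₃ h₄ =>
      simp only [map_mul, FreeAlgebra.lift_ι_apply]
      exact matU_braid' q (Fin.ne_of_val_ne (by simp; omega)) (Fin.ne_of_val_ne (by simp))
        (Fin.ne_of_val_ne (by simp))
    | comm i j h₁ h₂ h₃ h₄ hij hji =>
      simp only [map_mul, FreeAlgebra.lift_ι_apply]
      by_cases h : i = j
      · subst h; rfl
      · refine twoSite_comm _ _ ?_ ?_ ?_ ?_ ?_ ?_ <;>
          exact Fin.ne_of_val_ne (by simp; omega))

/-- The space `V^{⊗ n}` regarded as a `T_n`-module. -/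
def Tensor (_ : kˣ) (n : ℕ) : Type u := TensorSpace k n

instance (n : ℕ) : AddCommGroup (Tensor q n) := inferInstanceAs (AddCommGroup (TensorSpace k n))

instance (n : ℕ) : Module k (Tensor q n) := inferInstanceAs (Module k (TensorSpace k n))

instance (n : ℕ) : Module (TLAlg q n) (Tensor q n) :=
  Module.compHom (TensorSpace k n) (tensorRep q n).toRingHom

theorem smul_def (n : ℕ) (x : TLAlg q n) (f : Tensor q n) :
    x • f = (tensorRep q n x (f : TensorSpace k n) : TensorSpace k n) := rfl

instance (n : ℕ) : IsScalarTower k (TLAlg q n) (Tensor q n) where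
  smul_assoc c x f := by
    rw [smul_def, smul_def, map_smul]; rfl

/-- The permutation module `M_n(2r - n)`: the submodule of `V^{⊗ n}` with basis the words with
exactly `r` letters `1`. -/
def permModule (n r : ℕ) : Submodule (TLAlg q n) (Tensor q n) where
  carrier := (weightSpace k n r : Set (TensorSpace k n))
  add_mem' hf hg := (weightSpace k n r).add_mem hf hg
  zero_mem' := (weightSpace k n r).zero_mem
  smul_mem' x := by
    obtain ⟨x, rfl⟩ := mk_surjective q n x
    induction x using FreeAlgebra.induction with
    | grade0 c =>
      intro f hf
      rw [AlgHom.commutes, algebraMap_smul]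
      exact (weightSpace k n r).smul_mem c hf
    | grade1 g =>
      intro f hf
      obtain ⟨i, h₁, h₂⟩ := g
      rw [smul_def, tensorRep, lift_mk, FreeAlgebra.lift_ι_apply]
      exact matU_weightSpace q (i := ⟨i - 1, by omega⟩) (j := ⟨i, h₂⟩)
        (Fin.ne_of_val_ne (by simp; omega)) r f hf
    | mul x y hx hy =>
      intro f hf
      rw [map_mul, mul_smul]
      exact hx (hy hf)
    | add x y hx hy =>
      intro f hf
      rw [map_add, add_smul]
      exact (weightSpace k n r).add_mem (hx hf) (hy hf)

/-- The adjunction map `φ_{n+2} : G (F (V^{⊗ (n+2)})) → V^{⊗ (n+2)}` of `T_{n+2}`-modules. -/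
def phi (h : (q : k) + ((q⁻¹ : kˣ) : k) ≠ 0) (n : ℕ) :
    (locData q h n).G ((locData q h n).F (Tensor q (n + 2))) →ₗ[TLAlg q (n + 2)]
      Tensor q (n + 2) :=
  (locData q h n).adjMap (Tensor q (n + 2))

end TLAlg

end TemperleyLieb

/-! ## The blob algebra and its tensor space -/

section Blob

universe u

/-- The generators `e, U₁, …, U_{n-1}` (there is no generator `e` for `n = 0`). -/
inductive BlobGen (n : ℕ) : Type
  | e (h : 1 ≤ n)
  | U (i : ℕ) (h₁ : 1 ≤ i) (h₂ : i < n)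

variable {k : Type u} [Field k]

/-- The defining relations of the blob algebra. -/
inductive BlobRel (q : kˣ) (γ δ : k) (n : ℕ) :
    FreeAlgebra k (BlobGen n) → FreeAlgebra k (BlobGen n) → Prop
  | sq (i : ℕ) (h₁ : 1 ≤ i) (h₂ : i < n) : BlobRel q γ δ n
      (FreeAlgebra.ι k (.U i h₁ h₂) * FreeAlgebra.ι k (.U i h₁ h₂))
      (((q : k) + ((q⁻¹ : kˣ) : k)) • FreeAlgebra.ι k (.U i h₁ h₂))
  | up (i : ℕ) (h₁ : 1 ≤ i) (h₂ : i < n) (h₃ : 1 ≤ i + 1) (h₄ : i + 1 < n) : BlobRel q γ δ n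
      (FreeAlgebra.ι k (.U i h₁ h₂) * FreeAlgebra.ι k (.U (i + 1) h₃ h₄)
        * FreeAlgebra.ι k (.U i h₁ h₂))
      (FreeAlgebra.ι k (.U i h₁ h₂))
  | down (i : ℕ) (h₁ : 1 ≤ i) (h₂ : i < n) (h₃ : 1 ≤ i + 1) (h₄ : i + 1 < n) : BlobRel q γ δ n
      (FreeAlgebra.ι k (.U (i + 1) h₃ h₄) * FreeAlgebra.ι k (.U i h₁ h₂)
        * FreeAlgebra.ι k (.U (i + 1) h₃ h₄))
      (FreeAlgebra.ι k (.U (i + 1) h₃ h₄))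
  | comm (i j : ℕ) (h₁ : 1 ≤ i) (h₂ : i < n) (h₃ : 1 ≤ j) (h₄ : j < n)
      (hij : i + 1 ≠ j) (hji : j + 1 ≠ i) : BlobRel q γ δ n
      (FreeAlgebra.ι k (.U i h₁ h₂) * FreeAlgebra.ι k (.U j h₃ h₄))
      (FreeAlgebra.ι k (.U j h₃ h₄) * FreeAlgebra.ι k (.U i h₁ h₂))
  | blob (h₀ : 1 ≤ n) (h₁ : 1 ≤ 1) (h₂ : 1 < n) : BlobRel q γ δ n
      (FreeAlgebra.ι k (.U 1 h₁ h₂) * FreeAlgebra.ι k (.e h₀) * FreeAlgebra.ι k (.U 1 h₁ h₂))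
      (γ • FreeAlgebra.ι k (.U 1 h₁ h₂))
  | esq (h₀ : 1 ≤ n) : BlobRel q γ δ n
      (FreeAlgebra.ι k (.e h₀) * FreeAlgebra.ι k (.e h₀)) (δ • FreeAlgebra.ι k (.e h₀))
  | ecomm (h₀ : 1 ≤ n) (i : ℕ) (h₁ : 1 ≤ i) (h₂ : i < n) (hi : i ≠ 1) : BlobRel q γ δ n
      (FreeAlgebra.ι k (.U i h₁ h₂) * FreeAlgebra.ι k (.e h₀))
      (FreeAlgebra.ι k (.e h₀) * FreeAlgebra.ι k (.U i h₁ h₂))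

/-- The blob algebra over `k` with parameters `q, γ, δ`. -/
def BlobAlg (q : kˣ) (γ δ : k) (n : ℕ) : Type u := RingQuot (BlobRel q γ δ n)

instance (q : kˣ) (γ δ : k) (n : ℕ) : Ring (BlobAlg q γ δ n) :=
  inferInstanceAs (Ring (RingQuot (BlobRel q γ δ n)))

instance (q : kˣ) (γ δ : k) (n : ℕ) : Algebra k (BlobAlg q γ δ n) :=
  inferInstanceAs (Algebra k (RingQuot (BlobRel q γ δ n)))

namespace BlobAlg

section General

variable (q : kˣ) (γ δ : k)

/-- The quotient map from the free algebra. -/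
def mk (n : ℕ) : FreeAlgebra k (BlobGen n) →ₐ[k] BlobAlg q γ δ n :=
  RingQuot.mkAlgHom k (BlobRel q γ δ n)

/-- The generator `U_i` of `b_n`. -/
def U {n : ℕ} (i : ℕ) (h₁ : 1 ≤ i) (h₂ : i < n) : BlobAlg q γ δ n :=
  mk q γ δ n (FreeAlgebra.ι k (.U i h₁ h₂))

/-- The generator `e` of `b_n`, for `n ≥ 1` (and `0` in `b_0`, where there is no such generator). -/
def e (n : ℕ) : BlobAlg q γ δ n :=
  if h : 1 ≤ n then mk q γ δ n (FreeAlgebra.ι k (.e h)) else 0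

variable {q γ δ} in
theorem mk_eq {n : ℕ} {x y : FreeAlgebra k (BlobGen n)} (h : BlobRel q γ δ n x y) :
    mk q γ δ n x = mk q γ δ n y :=
  RingQuot.mkAlgHom_rel k h

variable {q γ δ} in
/-- The universal property of `b_n`. -/
def lift {n : ℕ} {R : Type u} [Ring R] [Algebra k R] (g : BlobGen n → R)
    (hg : ∀ ⦃x y⦄, BlobRel q γ δ n x y → FreeAlgebra.lift k g x = FreeAlgebra.lift k g y) :
    BlobAlg q γ δ n →ₐ[k] R :=
  RingQuot.liftAlgHom k ⟨FreeAlgebra.lift k g, hg⟩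

theorem lift_mk {n : ℕ} {R : Type u} [Ring R] [Algebra k R] (g : BlobGen n → R)
    (hg : ∀ ⦃x y⦄, BlobRel q γ δ n x y → FreeAlgebra.lift k g x = FreeAlgebra.lift k g y)
    (x : FreeAlgebra k (BlobGen n)) : lift g hg (mk q γ δ n x) = FreeAlgebra.lift k g x :=
  RingQuot.liftAlgHom_mkAlgHom_apply k _ _ x

theorem mk_surjective (n : ℕ) : Function.Surjective (mk q γ δ n) :=
  RingQuot.mkAlgHom_surjective k _

/-- The natural map `b_n → b_{n+2}`, `e ↦ e`, `U_i ↦ U_i`. -/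
def incl (n : ℕ) : BlobAlg q γ δ n →ₐ[k] BlobAlg q γ δ (n + 2) :=
  lift (fun
      | .e _ => mk q γ δ (n + 2) (FreeAlgebra.ι k (.e (by omega)))
      | .U i h₁ h₂ => U q γ δ i h₁ (by omega)) (by
    intro x y h
    induction h with
    | sq i h₁ h₂ =>
      simpa [U] using mk_eq (BlobRel.sq (q := q) (γ := γ) (δ := δ) (n := n + 2) i h₁ (by omega))
    | up i h₁ h₂ h₃ h₄ =>
      simpa [U] using
        mk_eq (BlobRel.up (q := q) (γ := γ) (δ := δ) (n := n + 2) i h₁ (by omega) h₃ (by omega))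
    | down i h₁ h₂ h₃ h₄ =>
      simpa [U] using
        mk_eq (BlobRel.down (q := q) (γ := γ) (δ := δ) (n := n + 2) i h₁ (by omega) h₃ (by omega))
    | comm i j h₁ h₂ h₃ h₄ hij hji =>
      simpa [U] using mk_eq (BlobRel.comm (q := q) (γ := γ) (δ := δ) (n := n + 2) i j h₁ (by omega)
        h₃ (by omega) hij hji)
    | blob h₀ h₁ h₂ =>
      simpa [U] using
        mk_eq (BlobRel.blob (q := q) (γ := γ) (δ := δ) (n := n + 2) (by omega) h₁ (by omega))
    | esq h₀ =>
      simpa [U] using mk_eq (BlobRel.esq (q := q) (γ := γ) (δ := δ) (n := n + 2) (by omega))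
    | ecomm h₀ i h₁ h₂ hi =>
      simpa [U] using mk_eq (BlobRel.ecomm (q := q) (γ := γ) (δ := δ) (n := n + 2) (by omega)
        i h₁ (by omega) hi))

/-- The element `ε = [2]⁻¹ U_{n+1}` of `b_{n+2}`. -/
def eps (n : ℕ) : BlobAlg q γ δ (n + 2) :=
  ((q : k) + ((q⁻¹ : kˣ) : k))⁻¹ • U q γ δ (n + 1) (by omega) (by omega)

/-- The localisation data: `b_n → b_{n+2}` and the idempotent `ε = [2]⁻¹ U_{n+1}`. -/
def locData (h : (q : k) + ((q⁻¹ : kˣ) : k) ≠ 0) (n : ℕ) :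
    LocData k (BlobAlg q γ δ (n + 2)) (BlobAlg q γ δ n) where
  incl := incl q γ δ n
  ε := eps q γ δ n
  idem := by
    have := mk_eq (BlobRel.sq (q := q) (γ := γ) (δ := δ) (n := n + 2) (n + 1) (by omega) (by omega))
    rw [map_mul, map_smul] at this
    rw [eps, smul_mul_smul_comm, U, this, smul_smul]
    congr 1
    field_simp
  comm := by
    intro b
    obtain ⟨b, rfl⟩ := mk_surjective q γ δ n b
    induction b using FreeAlgebra.induction with
    | grade0 r => rw [AlgHom.commutes, AlgHom.commutes]; exact Algebra.commutes _ _
    | grade1 x =>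
      rw [incl, lift_mk, FreeAlgebra.lift_ι_apply, eps, mul_smul_comm, smul_mul_assoc]
      congr 1
      obtain h₀ | ⟨i, h₁, h₂⟩ := x
      · have := mk_eq (BlobRel.ecomm (q := q) (γ := γ) (δ := δ) (n := n + 2) (by omega) (n + 1)
          (by omega) (by omega) (by omega))
        simpa [U] using this.symm
      · have := mk_eq (BlobRel.comm (q := q) (γ := γ) (δ := δ) (n := n + 2) i (n + 1) h₁ (by omega)
          (by omega) (by omega) (by omega) (by omega))
        simpa [U] using this
    | mul x y hx hy => rw [map_mul, map_mul, mul_assoc, hy, ← mul_assoc, hx, mul_assoc]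
    | add x y hx hy => rw [map_add, map_add, add_mul, mul_add, hx, hy]

/-- The idempotents `1, ε, …` of `b_n`, continued by `0`: the `(i+1)`-st idempotent of `b_{n+2}` is
`ε` times the image of the `i`-th idempotent of `b_n`, so that the `i`-th idempotent of `b_n` is
`[2]^{-i} U_{n-1} U_{n-3} ⋯ U_{n-2i+1}` if `2i ≤ n`. -/
def chain : (n i : ℕ) → BlobAlg q γ δ n
  | _, 0 => 1
  | 0, _ + 1 => 0
  | 1, _ + 1 => 0
  | n + 2, i + 1 => eps q γ δ n * incl q γ δ n (chain n i)

/-- The weights `Γ_n = {-n, -n+2, …, n-2, n}`. -/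
abbrev Weight (n : ℕ) : Type := {l : ℤ // l.natAbs ≤ n ∧ l.natAbs % 2 = n % 2}

/-- The idempotent `δ⁻¹ e`, `1 - δ⁻¹ e` or `1` according to the sign of the weight. The two
idempotents `δ⁻¹ e` and `1 - δ⁻¹ e` are the primitive idempotents of `b_m / b_m ε b_m ≅ k × k`
for `m ≥ 1`. -/
def signIdem (n : ℕ) (l : ℤ) : BlobAlg q γ δ n :=
  if 0 < l then δ⁻¹ • e q γ δ n else if l < 0 then 1 - δ⁻¹ • e q γ δ n else 1

/-- The standard module `Δ_n(l)`: with `|l| = n - 2i`, `e_i = chain n i` and `f = signIdem n l`,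
this is `(b_n / b_n e_{i+1} b_n) e_i f`. -/
abbrev Delta (n : ℕ) (l : Weight n) : Type u :=
  StandardModule (BlobAlg q γ δ n) (chain q γ δ n ((n - l.1.natAbs) / 2 + 1))
    (chain q γ δ n ((n - l.1.natAbs) / 2) * signIdem q γ δ n l.1)

/-- The costandard module `∇_n(l)`. -/
abbrev Nabla (n : ℕ) (l : Weight n) : Type u :=
  CostandardModule k (BlobAlg q γ δ n) (chain q γ δ n ((n - l.1.natAbs) / 2 + 1))
    (chain q γ δ n ((n - l.1.natAbs) / 2) * signIdem q γ δ n l.1)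

/-- A `b_n`-module is tilting if it has a standard and a costandard filtration. -/
def IsTilting (n : ℕ) (M : Type u) [AddCommGroup M] [Module (BlobAlg q γ δ n) M] : Prop :=
  HasFiltration (BlobAlg q γ δ n) (Delta q γ δ n) M ∧
    HasFiltration (BlobAlg q γ δ n) (Nabla q γ δ n) M

end General

section Crypto

variable (a x Q : kˣ)

/-- The blob algebra `b_n(q, m)` with `q = x²`, `γ = q^{m-1} - q^{-m+1}` and `δ = q^m - q^{-m}`,
where `Q` stands for `q^m`. -/
abbrev Alg (n : ℕ) : Type u :=
  BlobAlg (x ^ 2) (((Q * (x ^ 2)⁻¹ : kˣ) : k) - ((Q⁻¹ * x ^ 2 : kˣ) : k))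
    ((Q : k) - ((Q⁻¹ : kˣ) : k)) n

theorem comm_sq {R : Type u} [Ring R] [Algebra k R] {S T : R} {c d : k} (h : Commute S T)
    (hS : S * S = c • S) (hT : T * T = d • T) : S * T * (S * T) = (c * d) • (S * T) := by
  rw [h.symm.mul_mul_mul_comm, hS, hT, smul_mul_smul_comm]

theorem comm_braid {R : Type u} [Ring R] {S T S' T' : R} (h : Commute S T) (h₁ : Commute S T')
    (h₂ : Commute S' T) (hS : S * S' * S = S) (hT : T * T' * T = T) :
    S * T * (S' * T') * (S * T) = S * T := by
  rw [h₂.symm.mul_mul_mul_comm, (h.mul_right h₁).symm.mul_mul_mul_comm, hS, hT]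

theorem two_mul_two (ha : (a : k) ^ 4 = -1) :
    (((a ^ 5 * x : kˣ) : k) + (((a ^ 5 * x)⁻¹ : kˣ) : k)) *
      (((a ^ 3 * x : kˣ) : k) + (((a ^ 3 * x)⁻¹ : kˣ) : k))
      = ((x ^ 2 : kˣ) : k) + (((x ^ 2)⁻¹ : kˣ) : k) := by
  have h0 : (a : k) ≠ 0 := a.ne_zero
  have hx : (x : k) ≠ 0 := x.ne_zero
  simp only [Units.val_inv_eq_inv_val, Units.val_mul, Units.val_pow_eq_pow_val]
  field_simp
  grind

theorem delta_eq (ha : (a : k) ^ 4 = -1) :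
    ((a⁻¹ : kˣ) : k) ^ 2 * (((a ^ 2 * Q : kˣ) : k) + (((a ^ 2 * Q)⁻¹ : kˣ) : k))
      = (Q : k) - ((Q⁻¹ : kˣ) : k) := by
  have h0 : (a : k) ≠ 0 := a.ne_zero
  have hQ : (Q : k) ≠ 0 := Q.ne_zero
  simp only [Units.val_inv_eq_inv_val, Units.val_mul, Units.val_pow_eq_pow_val]
  field_simp
  grind

theorem gamma_eq (ha : (a : k) ^ 4 = -1) :
    ((a⁻¹ : kˣ) : k) ^ 2 * ((((a ^ 2 * Q) * (a ^ 5 * x)⁻¹ * (a ^ 3 * x)⁻¹ : kˣ) : k) +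
        (((a ^ 5 * x) * (a ^ 3 * x) * (a ^ 2 * Q)⁻¹ : kˣ) : k))
      = ((Q * (x ^ 2)⁻¹ : kˣ) : k) - ((Q⁻¹ * x ^ 2 : kˣ) : k) := by
  have h0 : (a : k) ≠ 0 := a.ne_zero
  have hx : (x : k) ≠ 0 := x.ne_zero
  have hQ : (Q : k) ≠ 0 := Q.ne_zero
  simp only [Units.val_inv_eq_inv_val, Units.val_mul, Units.val_pow_eq_pow_val]
  field_simp
  grind

/-- The representation `ρ` of `b_n` on `V^{⊗ 2n}`: with `r = a² q^m`, `s = a⁵ x`, `t = a³ x`,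
`e ↦ a⁻² μ^r(U_n)` and `U_i ↦ μ^s(U_{n-i}) μ^t(U_{n+i})`, where `μ^q(U_p)` acts as `𝒰^q` on the
tensor factors `p` and `p + 1` (which have the indices `p - 1` and `p` in `Fin (2n)`). -/
def cryptoRep (ha : (a : k) ^ 4 = -1) (n : ℕ) : Alg x Q n →ₐ[k] Module.End k (TensorSpace k (2 * n)) :=
  lift (fun
      | .e h => ((a⁻¹ : kˣ) : k) ^ 2 •
          twoSite (matU (a ^ 2 * Q)) ⟨n - 1, by omega⟩ ⟨n, by omega⟩
      | .U i h₁ h₂ =>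
          twoSite (matU (a ^ 5 * x)) ⟨n - i - 1, by omega⟩ ⟨n - i, by omega⟩ *
          twoSite (matU (a ^ 3 * x)) ⟨n + i - 1, by omega⟩ ⟨n + i, by omega⟩) (by
    intro y z h
    induction h with
    | sq i h₁ h₂ =>
      simp only [map_mul, map_smul, FreeAlgebra.lift_ι_apply]
      rw [← two_mul_two a x ha]
      refine comm_sq (twoSite_comm _ _ ?_ ?_ ?_ ?_ ?_ ?_) (matU_sq _ ?_) (matU_sq _ ?_) <;>
        exact Fin.ne_of_val_ne (by simp only [ne_eq]; omega)
    | up i h₁ h₂ h₃ h₄ =>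
      simp only [map_mul, FreeAlgebra.lift_ι_apply]
      refine comm_braid (twoSite_comm _ _ ?_ ?_ ?_ ?_ ?_ ?_) (twoSite_comm _ _ ?_ ?_ ?_ ?_ ?_ ?_)
        (twoSite_comm _ _ ?_ ?_ ?_ ?_ ?_ ?_) (matU_braid' _ ?_ ?_ ?_) (matU_braid _ ?_ ?_ ?_) <;>
        exact Fin.ne_of_val_ne (by simp only [ne_eq]; omega)
    | down i h₁ h₂ h₃ h₄ =>
      simp only [map_mul, FreeAlgebra.lift_ι_apply]
      refine comm_braid (twoSite_comm _ _ ?_ ?_ ?_ ?_ ?_ ?_) (twoSite_comm _ _ ?_ ?_ ?_ ?_ ?_ ?_)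
        (twoSite_comm _ _ ?_ ?_ ?_ ?_ ?_ ?_) (matU_braid _ ?_ ?_ ?_) (matU_braid' _ ?_ ?_ ?_) <;>
        exact Fin.ne_of_val_ne (by simp only [ne_eq]; omega)
    | comm i j h₁ h₂ h₃ h₄ hij hji =>
      simp only [map_mul, FreeAlgebra.lift_ι_apply]
      by_cases h : i = j
      · subst h; rfl
      · refine Commute.mul_left (Commute.mul_right (twoSite_comm _ _ ?_ ?_ ?_ ?_ ?_ ?_)
          (twoSite_comm _ _ ?_ ?_ ?_ ?_ ?_ ?_)) (Commute.mul_right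
          (twoSite_comm _ _ ?_ ?_ ?_ ?_ ?_ ?_) (twoSite_comm _ _ ?_ ?_ ?_ ?_ ?_ ?_)) <;>
          exact Fin.ne_of_val_ne (by simp only [ne_eq]; omega)
    | blob h₀ h₁ h₂ =>
      simp only [map_mul, map_smul, FreeAlgebra.lift_ι_apply]
      rw [mul_smul_comm, smul_mul_assoc, ← gamma_eq a x Q ha, mul_smul]
      congr 1
      refine matU_blob (i := ⟨n - 1 - 1, by omega⟩) (j := ⟨n - 1, by omega⟩) (l := ⟨n, by omega⟩)
        (m := ⟨n + 1, by omega⟩) _ _ _ ?_ ?_ ?_ ?_ ?_ ?_ <;>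
        exact Fin.ne_of_val_ne (by simp only [ne_eq]; omega)
    | esq h₀ =>
      simp only [map_mul, map_smul, FreeAlgebra.lift_ι_apply]
      rw [smul_mul_smul_comm, matU_sq _ (Fin.ne_of_val_ne (by simp only [ne_eq]; omega)),
        ← delta_eq a Q ha, smul_smul, smul_smul]
      congr 1
      ring
    | ecomm h₀ i h₁ h₂ hi =>
      simp only [map_mul, FreeAlgebra.lift_ι_apply]
      rw [mul_smul_comm, smul_mul_assoc]
      congr 1
      refine Commute.mul_left (twoSite_comm _ _ ?_ ?_ ?_ ?_ ?_ ?_)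
        (twoSite_comm _ _ ?_ ?_ ?_ ?_ ?_ ?_) <;>
        exact Fin.ne_of_val_ne (by simp only [ne_eq]; omega))

/-- The space `V^{⊗ 2n}` regarded as a `b_n`-module through `ρ`. -/
def Tensor (a _x _Q : kˣ) (_ : (a : k) ^ 4 = -1) (n : ℕ) : Type u := TensorSpace k (2 * n)

variable (ha : (a : k) ^ 4 = -1)

instance (n : ℕ) : AddCommGroup (Tensor a x Q ha n) :=
  inferInstanceAs (AddCommGroup (TensorSpace k (2 * n)))

instance (n : ℕ) : Module k (Tensor a x Q ha n) :=
  inferInstanceAs (Module k (TensorSpace k (2 * n)))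

instance (n : ℕ) : Module (Alg x Q n) (Tensor a x Q ha n) :=
  Module.compHom (TensorSpace k (2 * n)) (cryptoRep a x Q ha n).toRingHom

theorem smul_def (n : ℕ) (y : Alg x Q n) (f : Tensor a x Q ha n) :
    y • f = (cryptoRep a x Q ha n y (f : TensorSpace k (2 * n)) : TensorSpace k (2 * n)) := rfl

instance (n : ℕ) : IsScalarTower k (Alg x Q n) (Tensor a x Q ha n) where
  smul_assoc c y f := by
    rw [smul_def, smul_def, map_smul]; rfl

/-- The permutation module `M_n(2r - 2n)`: the submodule of `V^{⊗ 2n}` with basis the words with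
exactly `r` letters `1`. -/
def permModule (n r : ℕ) : Submodule (Alg x Q n) (Tensor a x Q ha n) where
  carrier := (weightSpace k (2 * n) r : Set (TensorSpace k (2 * n)))
  add_mem' hf hg := (weightSpace k (2 * n) r).add_mem hf hg
  zero_mem' := (weightSpace k (2 * n) r).zero_mem
  smul_mem' y := by
    obtain ⟨y, rfl⟩ := mk_surjective _ _ _ n y
    induction y using FreeAlgebra.induction with
    | grade0 c =>
      intro f hf
      rw [AlgHom.commutes, algebraMap_smul]
      exact (weightSpace k (2 * n) r).smul_mem c hf
    | grade1 g =>
      intro f hf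
      rw [smul_def, cryptoRep, lift_mk, FreeAlgebra.lift_ι_apply]
      obtain h | ⟨i, h₁, h₂⟩ := g
      · exact (weightSpace k (2 * n) r).smul_mem _
          (matU_weightSpace _ (Fin.ne_of_val_ne (by simp; omega)) r f hf)
      · exact matU_weightSpace _ (Fin.ne_of_val_ne (by simp; omega)) r _
          (matU_weightSpace _ (Fin.ne_of_val_ne (by simp; omega)) r f hf)
    | mul y z hy hz =>
      intro f hf
      rw [map_mul, mul_smul]
      exact hy (hz hf)
    | add y z hy hz =>
      intro f hf
      rw [map_add, add_smul]
      exact (weightSpace k (2 * n) r).add_mem (hy hf) (hz hf)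

/-- The localisation data for the algebras `b_n(q, m)`. -/
abbrev algLocData (h : ((x ^ 2 : kˣ) : k) + (((x ^ 2)⁻¹ : kˣ) : k) ≠ 0) (n : ℕ) :
    LocData k (Alg x Q (n + 2)) (Alg x Q n) :=
  locData (x ^ 2) _ _ h n

/-- The adjunction map `φ_{n+2} : G (F (V^{⊗ 2(n+2)})) → V^{⊗ 2(n+2)}` of `b_{n+2}`-modules. -/
def phi (h : ((x ^ 2 : kˣ) : k) + (((x ^ 2)⁻¹ : kˣ) : k) ≠ 0) (n : ℕ) :
    (algLocData x Q h n).G ((algLocData x Q h n).F (Tensor a x Q ha (n + 2)))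
      →ₗ[Alg x Q (n + 2)] Tensor a x Q ha (n + 2) :=
  (algLocData x Q h n).adjMap (Tensor a x Q ha (n + 2))

end Crypto

end BlobAlg

end Blob

end BlobTilting

/-! The theorem rests on a dimension count. Let `A` be the algebra, `M` its tensor space, and `1 =
e_0, e_1, …` the chain of idempotents. The submodules `A e_i M` form a descending filtration of `M`.
Let `g = e_i f` be the generating element of a standard module of layer `i`. Then each vector `g m`
generates in `M / A e_{i+1} M` a quotient of that standard module. Hence `A e_i M / A e_{i+1} M` has
a filtration by quotients of standard modules, with at most as many steps as the image of `e_i M` in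
`M / A e_{i+1} M` has dimensions (`QuotientFiltered.layer`).

Two upper bounds are needed. Firstly, a standard module of layer `i` is spanned by the vectors
obtained from its generator by inserting `i` cups in normal order. Their number satisfies Pascal's
recursion, so the dimension is at most `n.choose i` for the blob algebra and at most the ballot
number for the Temperley–Lieb algebra (`IsBlobLike.finrank_standardModule_le`). Secondly, `e_i M` is
a space of functions on words of length `n - 2 i`. Modulo `A e_{i+1} M` the images of all `U_p`, and
of `e U_1`, vanish there. Each such image yields vectors with a known leading factor, so the reduced
words, which avoid these factors, span the quotient (`eq_top_of_reduced_mem`).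

The number of reduced words of length `n - 2 i`, times the bound in layer `i`, summed over `i`, is
exactly the dimension of `M` (`sum_ballot`, `sum_choose`). Therefore every inequality is an
equality, and the quotients of standard modules are the standard modules themselves. The permutation
modules are the homogeneous components of `M` for the grading by the number of letters `1`. All
components are treated at once: each satisfies its own inequality, and the sum of these is an
equality (`hasFiltration_of_layers`).

For costandard filtrations, the symmetric form that makes the words orthonormal is used. The
generators act by symmetric matrices, so the form is contravariant for the antiautomorphism fixing
the generators. Orthogonal complements then turn a standard filtration into a costandard one
(`HasFiltration.dual`).

Both algebras are treated by one argument, the Temperley–Lieb case being `e = 0`. In the blob case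
`V^{⊗ 2n}` is folded in the middle into words of length `n` in an alphabet of four pairs of letters.
Then `U_p` acts by a rank one matrix on two neighbouring sites and `e` acts on the first site. -/

open scoped TensorProduct

namespace BlobTilting

/-! ### Filtrations by quotients of given modules, and the equality case of the dimension bound -/

section QuotientFiltration

universe u

variable {k A : Type u} [Field k] [Ring A] [Algebra k A]

instance (e f : A) : IsScalarTower k A (StandardModule A e f) :=
  inferInstanceAs (IsScalarTower k A ↥(Submodule.span A
    {(Submodule.Quotient.mk f : A ⧸ (TwoSidedIdeal.span {e}).asIdeal)}))

variable {ι : Type} (X : ι → Type u) [∀ i, AddCommGroup (X i)] [∀ i, Module A (X i)]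
  [∀ i, Module k (X i)] [∀ i, IsScalarTower k A (X i)]
  {M : Type u} [AddCommGroup M] [Module k M] [Module A M] [IsScalarTower k A M]

variable (k) in
/-- `S` is reached from `0` by finitely many steps, each of which adds a quotient of some `X i`;
`d` is the sum of upper bounds for the dimensions of the `X i`. -/
inductive QuotientFiltered : Submodule A M → ℕ → Prop
  | bot (d : ℕ) : QuotientFiltered ⊥ d
  | step {S : Submodule A M} {d D : ℕ} (i : ι) (f : X i →ₗ[A] M ⧸ S)
      (h : QuotientFiltered S d) (hD : Module.finrank k (X i) ≤ D) :
      QuotientFiltered ((LinearMap.range f).comap S.mkQ) (d + D)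

variable {X}

theorem finrank_comap_mkQ [Module.Finite k M] (S : Submodule A M) (R : Submodule A (M ⧸ S)) :
    Module.finrank k (R.comap S.mkQ) = Module.finrank k S + Module.finrank k R := by
  let g : ↥(R.comap S.mkQ) →ₗ[k] R :=
    ((S.mkQ.restrict (p := R.comap S.mkQ) (q := R) fun _ h => h)).restrictScalars k
  have hg : Function.Surjective g := by
    rintro ⟨y, hy⟩
    obtain ⟨y, rfl⟩ := S.mkQ_surjective y
    exact ⟨⟨y, hy⟩, rfl⟩
  have : Module.Finite k ↥(R.comap S.mkQ) :=
    Module.Finite.of_injective ((R.comap S.mkQ).subtype.restrictScalars k) Subtype.val_injective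
  have h1 := LinearMap.finrank_range_add_finrank_ker g
  rw [LinearMap.range_eq_top.2 hg, finrank_top] at h1
  have hle : S ≤ R.comap S.mkQ := fun y hy => by
    rw [Submodule.mem_comap, Submodule.mkQ_apply, (Submodule.Quotient.mk_eq_zero S).2 hy]; exact R.zero_mem
  let e₀ : S →ₗ[k] LinearMap.ker g :=
    { toFun := fun y => ⟨⟨y.1, hle y.2⟩, Subtype.ext ((Submodule.Quotient.mk_eq_zero S).2 y.2)⟩
      map_add' := fun y z => rfl
      map_smul' := fun a y => rfl }
  let e : S ≃ₗ[k] LinearMap.ker g := LinearEquiv.ofBijective e₀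
      ⟨fun y z h => Subtype.ext (congrArg (fun t => t.1.1) h), fun ⟨⟨y, hy⟩, hy'⟩ =>
        ⟨⟨y, (Submodule.Quotient.mk_eq_zero S).1 (congrArg Subtype.val hy')⟩, rfl⟩⟩
  rw [e.finrank_eq]
  omega

theorem finrank_range_le' [Module.Finite k M] (S : Submodule A M) (i : ι) [Module.Finite k (X i)]
    (f : X i →ₗ[A] M ⧸ S) :
    Module.finrank k (LinearMap.range f) ≤ Module.finrank k (X i) :=
  LinearMap.finrank_range_le (f.restrictScalars k)

variable (X) in
/-- The section `T / S` is isomorphic to one of the modules `X i`. -/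
def IsSection (S T : Submodule A M) : Prop :=
  ∃ i : ι, Nonempty ((↥T ⧸ S.submoduleOf T) ≃ₗ[A] X i)

omit [Algebra k A] [∀ i, IsScalarTower k A (X i)] [Module k M] [IsScalarTower k A M] in
theorem QuotientFiltered.mono {S : Submodule A M} {d d' : ℕ}
    (h : QuotientFiltered k X S d) (hd : d ≤ d') : QuotientFiltered k X S d' := by
  induction h generalizing d' with
  | bot d => exact .bot d'
  | @step S d D i f h hD ih =>
    obtain ⟨c, rfl⟩ := Nat.exists_eq_add_of_le hd
    rw [add_right_comm]
    exact .step i f (ih (Nat.le_add_right d c)) hD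

variable [∀ i, Module.Finite k (X i)]

/-- Each step raises the dimension by the rank of its map, which is at most the dimension of some `X
i`. The equality case is `exists_chain`. -/
theorem QuotientFiltered.finrank_le [Module.Finite k M] {S : Submodule A M} {d : ℕ}
    (h : QuotientFiltered k X S d) : Module.finrank k S ≤ d := by
  induction h with
  | bot d => simp [Module.finrank_eq_zero_of_subsingleton]
  | @step S d D i f h hD ih =>
    rw [finrank_comap_mkQ]
    have := finrank_range_le' (k := k) S i f
    omega

/-- If the dimensions add up, then a filtration by quotients of the `X i` is a filtration by
the `X i`. -/
theorem QuotientFiltered.exists_chain [Module.Finite k M] {S : Submodule A M} {d : ℕ}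
    (h : QuotientFiltered k X S d) (hd : d ≤ Module.finrank k S) :
    ∃ (l : ℕ) (T : ℕ → Submodule A M), Monotone T ∧ T 0 = ⊥ ∧ (∀ j, l ≤ j → T j = S) ∧
      ∀ j < l, IsSection X (T j) (T (j + 1)) := by
  induction h with
  | bot d => exact ⟨0, fun _ => ⊥, fun _ _ _ => le_rfl, rfl, fun _ _ => rfl, fun j hj => by omega⟩
  | @step S d D i f h hD ih =>
    have h1 := h.finrank_le
    have h2 := finrank_range_le' (k := k) S i f
    rw [finrank_comap_mkQ] at hd
    -- By `hd`, `d + D` is at most `dim S` plus the rank of `f`, while `dim S ≤ d` and the rank is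
    -- at most `dim (X i) ≤ D`. So all of these are equalities; the one for the rank makes `f`
    -- injective below.
    obtain ⟨l, T, hT, h0, hl, hq⟩ := ih (by omega)
    have hle : S ≤ (LinearMap.range f).comap S.mkQ := fun y hy => by
      rw [Submodule.mem_comap, Submodule.mkQ_apply, (Submodule.Quotient.mk_eq_zero S).2 hy]
      exact Submodule.zero_mem _
    refine ⟨l + 1, fun j => if j ≤ l then T j else (LinearMap.range f).comap S.mkQ, ?_, ?_, ?_, ?_⟩
    · intro a b hab
      dsimp only
      split_ifs with ha hb
      · exact hT hab
      · exact ((hT ha).trans (hl l le_rfl).le).trans hle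
      · omega
      · exact le_rfl
    · simpa using h0
    · intro j hj
      exact if_neg (by omega)
    · intro j hj
      dsimp only
      rcases Nat.lt_or_ge j l with hjl | hjl
      · rw [if_pos (by omega), if_pos (by omega)]
        exact hq j hjl
      · obtain rfl : j = l := by omega
        rw [if_pos le_rfl, if_neg (by omega), hl j le_rfl]
        refine ⟨i, ?_⟩
        have hinj : Function.Injective (f.restrictScalars k) := by
          rw [← LinearMap.ker_eq_bot, ← Submodule.finrank_eq_zero (R := k)]
          have h3 := LinearMap.finrank_range_add_finrank_ker (f.restrictScalars k)
          have h4 : Module.finrank k (LinearMap.range f) =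
            Module.finrank k (LinearMap.range (f.restrictScalars k)) := rfl
          omega
        let g : ↥((LinearMap.range f).comap S.mkQ) →ₗ[A] LinearMap.range f :=
          S.mkQ.restrict fun _ h => h
        have hg : Function.Surjective g := by
          rintro ⟨y, hy⟩
          obtain ⟨y, rfl⟩ := S.mkQ_surjective y
          exact ⟨⟨y, hy⟩, rfl⟩
        have hker : LinearMap.ker g = S.submoduleOf ((LinearMap.range f).comap S.mkQ) := by
          ext ⟨y, hy⟩
          rw [LinearMap.mem_ker]
          exact Subtype.ext_iff.trans (Submodule.Quotient.mk_eq_zero S)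
        exact ⟨(Submodule.quotEquivOfEq _ _ hker.symm).trans
          ((g.quotKerEquivOfSurjective hg).trans (LinearEquiv.ofInjective f hinj).symm)⟩

theorem QuotientFiltered.hasFiltration [Module.Finite k M] {d : ℕ}
    (h : QuotientFiltered k X (⊤ : Submodule A M) d) (hd : d ≤ Module.finrank k M) :
    HasFiltration A X M := by
  obtain ⟨l, T, hT, h0, hl, hq⟩ := h.exists_chain (by
    refine hd.trans (le_of_eq ?_)
    exact (LinearEquiv.finrank_eq (Submodule.topEquiv (R := A) (M := M) |>.restrictScalars k)).symm)
  exact ⟨l, T, hT, h0, hl l le_rfl, hq⟩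

end QuotientFiltration

/-! ### Layers of the filtration by the submodules `A e_i M` -/

section Layers

universe u

variable {k A : Type u} [Field k] [Ring A] [Algebra k A]
  {M : Type u} [AddCommGroup M] [Module k M] [Module A M] [IsScalarTower k A M]

/-- The elements of `A` that map all of `M` into `A e M` form a two-sided ideal, and `e` belongs to
it. -/
theorem smul_mem_span_smul (e : A) {a : A} (ha : a ∈ TwoSidedIdeal.span {e}) (m : M) :
    a • m ∈ Submodule.span A (Set.range fun v : M => e • v) := by
  let I : TwoSidedIdeal A := TwoSidedIdeal.mk'
    {a | ∀ m : M, a • m ∈ Submodule.span A (Set.range fun v : M => e • v)}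
    (fun m => by rw [zero_smul]; exact Submodule.zero_mem _)
    (fun h h' m => by rw [add_smul]; exact Submodule.add_mem _ (h m) (h' m))
    (fun h m => by rw [neg_smul]; exact Submodule.neg_mem _ (h m))
    (fun h m => by rw [mul_smul]; exact Submodule.smul_mem _ _ (h m))
    (fun h m => by rw [mul_smul]; exact h _)
  have : TwoSidedIdeal.span {e} ≤ I := TwoSidedIdeal.span_le.2 (by
    rintro _ rfl
    refine (TwoSidedIdeal.mem_mk' _ _ _ _ _ _ _).2 fun m => ?_
    exact Submodule.subset_span ⟨m, rfl⟩)
  exact (TwoSidedIdeal.mem_mk' _ _ _ _ _ _ _).1 (this ha) m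

/-- The inclusion of a standard module into `A / A e A`. -/
def StandardModule.subtype (e f : A) :
    StandardModule A e f →ₗ[A] A ⧸ (TwoSidedIdeal.span {e}).asIdeal :=
  Submodule.subtype (Submodule.span A
    {(Submodule.Quotient.mk f : A ⧸ (TwoSidedIdeal.span {e}).asIdeal)})

theorem StandardModule.range_subtype (e f : A) :
    LinearMap.range (StandardModule.subtype e f) = Submodule.span A {Submodule.Quotient.mk f} :=
  Submodule.range_subtype _

theorem StandardModule.subtype_injective (e f : A) :
    Function.Injective (StandardModule.subtype e f) :=
  Submodule.subtype_injective _

/-- A vector `g • m` of `M / S` generates a quotient of the standard module `(A / A e A) g`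
if `A e A` maps `M` to `S`. -/
theorem exists_standardModule_map {e : A} {S : Submodule A M}
    (hS : ∀ a ∈ TwoSidedIdeal.span {e}, ∀ m : M, a • m ∈ S) (g : A) (m : M) :
    ∃ f : StandardModule A e g →ₗ[A] M ⧸ S,
      LinearMap.range f = Submodule.span A {Submodule.Quotient.mk (g • m)} := by
  let F : (A ⧸ (TwoSidedIdeal.span {e}).asIdeal) →ₗ[A] M ⧸ S :=
    Submodule.liftQ _ (LinearMap.toSpanSingleton A (M ⧸ S) (Submodule.Quotient.mk m)) (by
      intro a ha
      rw [LinearMap.mem_ker, LinearMap.toSpanSingleton_apply, ← Submodule.Quotient.mk_smul]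
      exact (Submodule.Quotient.mk_eq_zero S).2 (hS a (TwoSidedIdeal.mem_asIdeal.1 ha) m))
  refine ⟨F.comp (StandardModule.subtype e g), ?_⟩
  rw [LinearMap.range_comp, StandardModule.range_subtype, Submodule.map_span, Set.image_singleton]
  rfl

variable {ι : Type} {e' g : ι → A}

omit [Module k M] [IsScalarTower k A M] in
-- The vectors of `b` are adjoined one at a time. The ideal `A e A` maps `M` into `S`, hence into
-- every larger submodule, so each new vector `g i • m` still generates a quotient of a standard
-- module when its turn comes.
theorem QuotientFiltered.extend {e : A} {S : Submodule A M}
    (hS : ∀ a ∈ TwoSidedIdeal.span {e}, ∀ m : M, a • m ∈ S) {d D : ℕ}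
    (h : QuotientFiltered k (fun i => StandardModule A (e' i) (g i)) S d)
    (b : Finset (M ⧸ S))
    (hb : ∀ v ∈ b, ∃ (i : ι) (m : M), e' i = e ∧
      Module.finrank k (StandardModule A (e' i) (g i)) ≤ D ∧ v = Submodule.Quotient.mk (g i • m)) :
    QuotientFiltered k (fun i => StandardModule A (e' i) (g i))
      ((Submodule.span A (b : Set (M ⧸ S))).comap S.mkQ) (d + b.card * D) := by
  classical
  induction b using Finset.induction_on with
  | empty => simpa using h
  | insert v b hv ih =>
    obtain ⟨i, m, rfl, hD, rfl⟩ := hb v (Finset.mem_insert_self _ _)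
    have ih := ih fun w hw => hb w (Finset.mem_insert_of_mem hw)
    set S₁ := (Submodule.span A (b : Set (M ⧸ S))).comap S.mkQ with hS₁
    have hle : S ≤ S₁ := fun y hy => by
      rw [Submodule.mem_comap, Submodule.mkQ_apply, (Submodule.Quotient.mk_eq_zero S).2 hy]
      exact Submodule.zero_mem _
    obtain ⟨f, hf⟩ := exists_standardModule_map (S := S₁) (e := e' i)
      (fun a ha m => hle (hS a ha m)) (g i) m
    have := QuotientFiltered.step i f ih hD
    rw [Finset.card_insert_of_notMem hv, add_mul, one_mul, ← add_assoc]
    convert this using 1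
    rw [hf]
    ext y
    rw [Submodule.mem_comap, Submodule.mem_comap, Finset.coe_insert, Submodule.span_insert,
      Submodule.mem_sup, Submodule.mem_span_singleton]
    constructor
    · rintro ⟨y₁, hy₁, y₂, hy₂, hy⟩
      obtain ⟨a, rfl⟩ := Submodule.mem_span_singleton.1 hy₁
      refine ⟨a, ?_⟩
      rw [← Submodule.Quotient.mk_smul, Submodule.mkQ_apply, Submodule.Quotient.eq, hS₁,
        Submodule.mem_comap, map_sub, ← hy, map_smul, Submodule.mkQ_apply, sub_add_cancel_left]
      exact Submodule.neg_mem _ hy₂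
    · rintro ⟨a, ha⟩
      rw [← Submodule.Quotient.mk_smul, Submodule.mkQ_apply, Submodule.Quotient.eq, hS₁,
        Submodule.mem_comap, map_sub, map_smul, Submodule.mkQ_apply] at ha
      refine ⟨_, Submodule.mem_span_singleton.2 ⟨a, rfl⟩, _, Submodule.neg_mem _ ha, ?_⟩
      rw [neg_sub, add_sub_cancel]

/-- One layer of the filtration by the submodules `A e M`: it is enough to know a bound for the
dimension of the image of `e M`, and that this image is spanned by the vectors `g i • m`. -/
theorem QuotientFiltered.layer [Module.Finite k M] {e e₁ : A} {d D c : ℕ}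
    (h : QuotientFiltered k (fun i => StandardModule A (e' i) (g i))
      (Submodule.span A (Set.range fun v : M => e₁ • v)) d)
    (hle : ∀ m : M, e₁ • m ∈ Submodule.span A (Set.range fun v : M => e • v))
    (P : ι → Prop) (hP : ∀ i, P i → e' i = e₁)
    (hge : ∀ i, P i → ∀ m : M, ∃ m' : M, g i • m = e • m')
    (hg : ∀ m : M, e • m ∈ Submodule.span k {v : M | ∃ (i : ι) (m : M), P i ∧
      Module.finrank k (StandardModule A (e' i) (g i)) ≤ D ∧ v = g i • m})
    (B : Finset M) (hB : B.card ≤ c)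
    (hspan : ∀ m : M, e • m ∈ Submodule.span k (B : Set M) ⊔
      (Submodule.span A (Set.range fun v : M => e₁ • v)).restrictScalars k) :
    QuotientFiltered k (fun i => StandardModule A (e' i) (g i))
      (Submodule.span A (Set.range fun v : M => e • v)) (d + c * D) := by
  classical
  set S := Submodule.span A (Set.range fun v : M => e₁ • v) with hS
  set T := {v : M | ∃ (i : ι) (m : M), P i ∧
      Module.finrank k (StandardModule A (e' i) (g i)) ≤ D ∧ v = g i • m} with hT
  let π : M →ₗ[k] M ⧸ S := S.mkQ.restrictScalars k
  have hfin : Module.Finite k (M ⧸ S) := Module.Finite.of_surjective π S.mkQ_surjective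
  -- The basis is chosen among the images of the vectors `g i • m` themselves, so that each basis
  -- vector belongs to one standard module. In the blob algebra two idempotents may share a layer.
  obtain ⟨b, hbT, hbs, hbi⟩ := exists_linearIndependent k (π '' T)
  have hbf : b.Finite := hbi.setFinite
  obtain ⟨b, rfl⟩ := hbf.exists_finset_coe
  have hcard : b.card ≤ c := by
    have h1 : Module.finrank k (Submodule.span k (b : Set (M ⧸ S))) = b.card :=
      finrank_span_finset_eq_card hbi
    rw [← h1, hbs]
    -- Each `g i • m` lies in `e M`, whose image in `M / S` is spanned by the image of `B`.
    have h2 : Submodule.span k (π '' T) ≤ Submodule.span k ((B.image π : Finset (M ⧸ S)) : Set _) := by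
      refine Submodule.span_le.2 ?_
      rintro _ ⟨_, ⟨i, m, hi, -, rfl⟩, rfl⟩
      obtain ⟨m', hm'⟩ := hge i hi m
      obtain ⟨y, hy, z, hz, hyz⟩ := Submodule.mem_sup.1 (hspan m')
      rw [hm', ← hyz, map_add, Finset.coe_image]
      have hz' : π z = 0 := (Submodule.Quotient.mk_eq_zero S).2 hz
      rw [hz', add_zero, SetLike.mem_coe, ← Submodule.map_span]
      exact Submodule.mem_map_of_mem hy
    exact (Submodule.finrank_mono h2).trans ((finrank_span_finset_le_card _).trans
      (Finset.card_image_le.trans hB))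
  have key := h.extend (e := e₁) (D := D) (fun a ha m => smul_mem_span_smul e₁ ha m) b (by
    intro v hv
    obtain ⟨_, ⟨i, m, hi, hD, rfl⟩, rfl⟩ := hbT hv
    exact ⟨i, m, hP i hi, hD, rfl⟩)
  have heq : (Submodule.span A (b : Set (M ⧸ S))).comap S.mkQ =
      Submodule.span A (Set.range fun v : M => e • v) := by
    refine le_antisymm (fun y hy => ?_) (Submodule.span_le.2 ?_)
    · have hSle : S ≤ Submodule.span A (Set.range fun v : M => e • v) := by
        rw [hS, Submodule.span_le]
        rintro _ ⟨m, rfl⟩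
        exact hle m
      have h3 : Submodule.span A (b : Set (M ⧸ S)) ≤
          (Submodule.span A (Set.range fun v : M => e • v)).map S.mkQ := by
        refine Submodule.span_le.2 fun v hv => ?_
        obtain ⟨_, ⟨i, m, hi, hD, rfl⟩, rfl⟩ := hbT hv
        obtain ⟨m', hm'⟩ := hge i hi m
        rw [hm']
        exact Submodule.mem_map_of_mem (Submodule.subset_span ⟨m', rfl⟩)
      obtain ⟨z, hz, hzy⟩ := h3 hy
      rw [Submodule.mkQ_apply, Submodule.mkQ_apply, Submodule.Quotient.eq] at hzy
      rw [← sub_sub_cancel z y]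
      exact Submodule.sub_mem _ hz (hSle hzy)
    · rintro _ ⟨m, rfl⟩
      have h4 : π (e • m) ∈ Submodule.span k (b : Set (M ⧸ S)) := by
        rw [hbs, ← Submodule.map_span]
        exact Submodule.mem_map_of_mem (hg m)
      exact Submodule.span_le_restrictScalars k A _ h4
  rw [heq] at key
  exact key.mono (by gcongr)

variable [∀ i, Module.Finite k (StandardModule A (e' i) (g i))]

/-- A family of modules has filtrations by standard modules as soon as the layers of the filtrations
by the submodules `A e_i N` are generated by few enough vectors. -/
theorem hasFiltration_of_layers {R : Type} [Fintype R] (N : R → Type u) [∀ r, AddCommGroup (N r)]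
    [∀ r, Module k (N r)] [∀ r, Module A (N r)] [∀ r, IsScalarTower k A (N r)]
    [∀ r, Module.Finite k (N r)] (e : ℕ → A) (L : ℕ) (he₀ : e 0 = 1) (heL : e L = 0)
    (D w : ℕ → ℕ) (c : R → ℕ → ℕ)
    (hle : ∀ i < L, ∃ a, e (i + 1) = e i * a)
    (lay : ι → ℕ) (hlay : ∀ j, e' j = e (lay j + 1))
    (hge : ∀ j, ∃ a, g j = e (lay j) * a)
    (hD : ∀ j, Module.finrank k (StandardModule A (e' j) (g j)) ≤ D (lay j))
    (hg : ∀ i < L, ∃ s : Finset ι, (∀ j ∈ s, lay j = i) ∧ ∑ j ∈ s, g j = e i)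
    (hspan : ∀ r, ∀ i < L, ∃ B : Finset (N r), B.card ≤ c r i ∧
      ∀ m : N r, e i • m ∈ Submodule.span k (B : Set (N r)) ⊔
        (Submodule.span A (Set.range fun v : N r => e (i + 1) • v)).restrictScalars k)
    (hc : ∀ i < L, ∑ r, c r i ≤ w i)
    (hdim : ∑ i ∈ Finset.range L, w i * D i ≤ ∑ r, Module.finrank k (N r)) (r : R) :
    HasFiltration A (fun i => StandardModule A (e' i) (g i)) (N r) := by
  -- The filtration is built upwards from `A e_L N = 0`, so `j` is the distance from the end of the
  -- chain.
  have key : ∀ r, ∀ j ≤ L, QuotientFiltered k (fun i => StandardModule A (e' i) (g i))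
      (Submodule.span A (Set.range fun v : N r => e (L - j) • v))
      (∑ i ∈ Finset.Ico (L - j) L, c r i * D i) := by
    intro r j
    induction j with
    | zero =>
      intro _
      have : Submodule.span A (Set.range fun v : N r => e (L - 0) • v) = ⊥ := by
        rw [Submodule.span_eq_bot]
        rintro _ ⟨v, rfl⟩
        simp only [Nat.sub_zero, heL, zero_smul]
      rw [this]
      exact .bot _
    | succ j ih =>
      intro hj
      have ih := ih (by omega)
      obtain ⟨i, hi⟩ : ∃ i, L - (j + 1) = i := ⟨_, rfl⟩
      have hi' : L - j = i + 1 := by omega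
      rw [hi, Finset.sum_eq_sum_Ico_succ_bot (by omega), add_comm, ← hi']
      rw [hi'] at ih ⊢
      have hiL : i < L := by omega
      obtain ⟨B, hB, hsp⟩ := hspan r i hiL
      obtain ⟨a, ha⟩ := hle i hiL
      refine ih.layer ?_ (fun j => lay j = i) (fun j hj => hj ▸ hlay j) ?_ ?_ B hB hsp
      · intro m
        rw [ha, mul_smul]
        exact Submodule.subset_span ⟨_, rfl⟩
      · intro l hl m
        obtain ⟨a, ha⟩ := hge l
        rw [hl] at ha
        exact ⟨a • m, by rw [ha, mul_smul]⟩
      · intro m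
        obtain ⟨s, hs, hsum⟩ := hg i hiL
        rw [← hsum, Finset.sum_smul]
        refine Submodule.sum_mem _ fun a ha => ?_
        exact Submodule.subset_span ⟨a, m, hs a ha, hs a ha ▸ hD a, rfl⟩
  have top : ∀ r, QuotientFiltered k (fun i => StandardModule A (e' i) (g i))
      (⊤ : Submodule A (N r)) (∑ i ∈ Finset.range L, c r i * D i) := by
    intro r
    have := key r L le_rfl
    rw [Nat.sub_self, ← Finset.range_eq_Ico] at this
    convert this
    rw [eq_comm, Submodule.eq_top_iff']
    intro v
    exact Submodule.subset_span ⟨v, by simp only [he₀, one_smul]⟩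
  refine (top r).hasFiltration ?_
  have h1 : ∀ r, Module.finrank k (N r) ≤ ∑ i ∈ Finset.range L, c r i * D i := fun r => by
    have := (top r).finrank_le
    rwa [← LinearEquiv.finrank_eq
      ((Submodule.topEquiv (R := A) (M := N r)).symm.restrictScalars k)] at this
  have h2 : ∑ r, ∑ i ∈ Finset.range L, c r i * D i ≤ ∑ r, Module.finrank k (N r) := by
    refine le_trans ?_ hdim
    rw [Finset.sum_comm]
    refine Finset.sum_le_sum fun i hi => ?_
    rw [← Finset.sum_mul]
    exact Nat.mul_le_mul_right _ (hc i (Finset.mem_range.1 hi))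
  -- If `h1` were strict for one `r`, the sum of the dimensions would be smaller than `h2` allows.
  -- This forces equality for every `r` without counting the words of a given degree.
  by_contra hlt
  exact absurd h2 (not_le.2 (Finset.sum_lt_sum (fun r _ => h1 r)
    ⟨r, Finset.mem_univ r, not_le.1 hlt⟩))

end Layers

/-! ### Contravariant duality between standard and costandard filtrations -/

section Duality

universe u

variable {k A : Type u} [Field k] [Ring A] [Algebra k A]

theorem HasFiltration.congr {ι : Type} {X : ι → Type u} [∀ i, AddCommGroup (X i)]
    [∀ i, Module A (X i)] {M N : Type u} [AddCommGroup M] [AddCommGroup N] [Module A M] [Module A N]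
    (e : M ≃ₗ[A] N) (h : HasFiltration A X M) : HasFiltration A X N := by
  obtain ⟨l, S, hS, h0, hl, hq⟩ := h
  refine ⟨l, fun j => (S j).map e.toLinearMap, fun a b hab => Submodule.map_mono (hS hab), ?_, ?_, ?_⟩
  · simp [h0]
  · simp [hl, LinearMap.range_eq_top.2 e.surjective]
  · intro j hj
    obtain ⟨i, ⟨f⟩⟩ := hq j hj
    refine ⟨i, ⟨(Submodule.Quotient.equiv _ _ (e.submoduleMap (S (j + 1))) ?_).symm.trans f⟩⟩
    ext ⟨y, hy⟩
    obtain ⟨z, hz, rfl⟩ := hy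
    constructor
    · rintro ⟨⟨t, ht⟩, ht', hty⟩
      refine ⟨t, ht', ?_⟩
      exact congrArg Subtype.val hty
    · rintro ⟨t, ht, hty⟩
      exact ⟨⟨t, hS (Nat.le_succ j) ht⟩, ht, Subtype.ext hty⟩

/-- The orthogonal complement of a submodule with respect to a contravariant form. -/
def perp {M : Type u} [AddCommGroup M] [Module A M] [Module k M]
    (τ : A → A) (β : M →ₗ[k] M →ₗ[k] k) (hτ : ∀ a x y, β (a • x) y = β x (τ a • y))
    (S : Submodule A M) : Submodule A M where
  carrier := {x | ∀ y ∈ S, β x y = 0}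
  add_mem' hx hx' y hy := by rw [map_add, LinearMap.add_apply, hx y hy, hx' y hy, add_zero]
  zero_mem' y _ := by rw [map_zero, LinearMap.zero_apply]
  smul_mem' a x hx y hy := by rw [hτ]; exact hx _ (S.smul_mem _ hy)

/-- The section of the orthogonal complements is dual to the section `T / S`. -/
theorem exists_perp_quotient_equiv {X Y : Type u} [AddCommGroup X]
    [Module A X] [Module k X] [IsScalarTower k A X] [AddCommGroup Y] [Module A Y]
    {M : Type u} [AddCommGroup M] [Module A M] [Module k M] [IsScalarTower k A M]
    [Module.Finite k M]
    (τ : A → A) (β : M →ₗ[k] M →ₗ[k] k) (hβ : Function.Injective β)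
    (hτ : ∀ a x y, β (a • x) y = β x (τ a • y))
    (p : Y ≃+ Module.Dual k X) (hp : ∀ a y x, p (a • y) x = p y (τ a • x))
    (S T : Submodule A M) (hST : S ≤ T) (f : (↥T ⧸ S.submoduleOf T) ≃ₗ[A] X) :
    Nonempty ((↥(perp τ β hτ S) ⧸ (perp τ β hτ T).submoduleOf (perp τ β hτ S)) ≃ₗ[A] Y) := by
  let b : M → (↥T →ₗ[k] k) := fun x => (β x).comp (T.subtype.restrictScalars k : ↥T →ₗ[k] M)
  have hker : ∀ x ∈ perp τ β hτ S, (S.submoduleOf T).restrictScalars k ≤ LinearMap.ker (b x) :=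
    fun x hx y hy => hx y.1 hy
  -- If `x` is orthogonal to `S`, the restriction of `β x` to `T` factors through `T / S`, and so
  -- defines a functional on `X`.
  let Φ : perp τ β hτ S → Module.Dual k X := fun x =>
    (Submodule.liftQ ((S.submoduleOf T).restrictScalars k) (b x.1) (hker x.1 x.2)).comp
      ((Submodule.Quotient.restrictScalarsEquiv k (S.submoduleOf T)).symm.toLinearMap.comp
        (f.symm.toLinearMap.restrictScalars k))
  have hΦ : ∀ x (y : T), Φ x (f (Submodule.Quotient.mk y)) = β x.1 y.1 := fun x y => by
    change Submodule.liftQ _ (b x.1) (hker x.1 x.2)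
      ((Submodule.Quotient.restrictScalarsEquiv k (S.submoduleOf T)).symm (f.symm (f _))) = _
    rw [LinearEquiv.symm_apply_apply]
    rfl
  have hX : ∀ z : X, ∃ y : T, z = f (Submodule.Quotient.mk y) := fun z => by
    obtain ⟨y, hy⟩ := Submodule.Quotient.mk_surjective _ (f.symm z)
    exact ⟨y, by rw [hy, LinearEquiv.apply_symm_apply]⟩
  let F : perp τ β hτ S →ₗ[A] Y :=
    { toFun := fun x => p.symm (Φ x)
      map_add' := fun x x' => by
        rw [← map_add]
        congr 1
        refine LinearMap.ext fun z => ?_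
        obtain ⟨y, rfl⟩ := hX z
        rw [LinearMap.add_apply, hΦ, hΦ, hΦ]
        change β (x.1 + x'.1) y.1 = _
        rw [map_add, LinearMap.add_apply]
      map_smul' := fun a x => by
        refine p.injective (LinearMap.ext fun z => ?_)
        obtain ⟨y, rfl⟩ := hX z
        rw [RingHom.id_apply, hp, AddEquiv.apply_symm_apply, AddEquiv.apply_symm_apply, hΦ,
          ← map_smul, ← Submodule.Quotient.mk_smul, hΦ]
        exact hτ a x.1 y.1 }
  have hsurj : Function.Surjective F := by
    intro y
    -- In finite dimension `β` maps onto the dual, so the functional on `T` that corresponds to `y`,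
    -- once extended to `M`, has the form `β x`.
    have hβs : Function.Surjective β :=
      (LinearMap.injective_iff_surjective_of_finrank_eq_finrank Subspace.dual_finrank_eq.symm).1 hβ
    let ψ : (T.restrictScalars k) →ₗ[k] k :=
      (p y).comp (f.toLinearMap.restrictScalars k ∘ₗ (S.submoduleOf T).mkQ.restrictScalars k)
    obtain ⟨ψ', hψ'⟩ := LinearMap.exists_extend (p := T.restrictScalars k) ψ
    obtain ⟨x, rfl⟩ := hβs ψ'
    have hx : ∀ t : T, β x t.1 = p y (f (Submodule.Quotient.mk t)) := fun t =>
      LinearMap.congr_fun hψ' t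
    refine ⟨⟨x, fun t ht => ?_⟩, ?_⟩
    · rw [hx ⟨t, hST ht⟩, (Submodule.Quotient.mk_eq_zero (S.submoduleOf T)).2 ht, map_zero, map_zero]
    · refine p.injective (LinearMap.ext fun z => ?_)
      obtain ⟨t, rfl⟩ := hX z
      rw [← hx]
      change p (p.symm _) _ = _
      rw [AddEquiv.apply_symm_apply, hΦ]
  have hkerF : LinearMap.ker F = (perp τ β hτ T).submoduleOf (perp τ β hτ S) := by
    ext x
    rw [LinearMap.mem_ker]
    change p.symm (Φ x) = 0 ↔ ∀ y ∈ T, β x.1 y = 0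
    rw [map_eq_zero_iff _ p.symm.injective]
    constructor
    · intro h y hy
      rw [← hΦ x ⟨y, hy⟩, h, LinearMap.zero_apply]
    · intro h
      refine LinearMap.ext fun z => ?_
      obtain ⟨y, rfl⟩ := hX z
      rw [hΦ, h y.1 y.2, LinearMap.zero_apply]
  exact ⟨(Submodule.quotEquivOfEq _ _ hkerF.symm).trans (F.quotKerEquivOfSurjective hsurj)⟩

/-- If `M` carries a non-degenerate contravariant form, a filtration of `M` by the `X i` gives rise
to a filtration by modules `Y i` which are contravariantly dual to the `X i`. -/
theorem HasFiltration.dual {ι : Type} {X Y : ι → Type u} [∀ i, AddCommGroup (X i)]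
    [∀ i, Module A (X i)] [∀ i, Module k (X i)] [∀ i, IsScalarTower k A (X i)]
    [∀ i, AddCommGroup (Y i)] [∀ i, Module A (Y i)]
    {M : Type u} [AddCommGroup M] [Module A M] [Module k M] [IsScalarTower k A M]
    [Module.Finite k M]
    (τ : A → A) (β : M →ₗ[k] M →ₗ[k] k) (hβ : Function.Injective β)
    (hτ : ∀ a x y, β (a • x) y = β x (τ a • y))
    (p : ∀ i, Y i ≃+ Module.Dual k (X i)) (hp : ∀ i a y x, p i (a • y) x = p i y (τ a • x))
    (h : HasFiltration A X M) : HasFiltration A Y M := by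
  obtain ⟨l, S, hS, h0, hl, hq⟩ := h
  -- Complements reverse inclusions, whence `l - j`. The section at `j` is dual to the section of
  -- `S` at `l - (j + 1)`.
  refine ⟨l, fun j => perp τ β hτ (S (l - j)), ?_, ?_, ?_, ?_⟩
  · intro a b hab x hx y hy
    exact hx y (hS (by omega) hy)
  · dsimp only
    rw [Nat.sub_zero, hl, eq_bot_iff]
    intro x hx
    refine hβ (LinearMap.ext fun y => ?_)
    rw [map_zero, LinearMap.zero_apply]
    exact hx y trivial
  · dsimp only
    rw [Nat.sub_self, h0, Submodule.eq_top_iff']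
    intro x y hy
    rw [(Submodule.mem_bot A).1 hy, map_zero]
  · intro j hj
    obtain ⟨i, ⟨f⟩⟩ := hq (l - (j + 1)) (by omega)
    refine ⟨i, ?_⟩
    have h1 : S (l - (j + 1) + 1) = S (l - j) := by
      congr 1
      omega
    rw [h1] at f
    exact exists_perp_quotient_equiv τ β hβ hτ (p i) (hp i) _ _ (hS (by omega)) f

/-- The map on standard modules induced by a homomorphism of algebras. -/
theorem exists_standardModule_map_of_algHom {B : Type u} [Ring B] [Algebra k B] (τ : A →ₐ[k] B)
    {e f : A} {e' f' : B} (he : τ e = e') (hf : τ f = f') :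
    ∃ σ : StandardModule A e f →ₗ[k] StandardModule B e' f',
      (∀ a x, σ (a • x) = τ a • σ x) ∧ ∀ x a, StandardModule.subtype e f x =
        Submodule.Quotient.mk a →
          StandardModule.subtype e' f' (σ x) = Submodule.Quotient.mk (τ a) := by
  subst he hf
  -- Regarded as a semilinear map, `τ` can be passed to quotients of modules over two different
  -- rings.
  let t : A →ₛₗ[τ.toRingHom] B :=
    { toFun := τ
      map_add' := fun a b => map_add τ a b
      map_smul' := fun a b => map_mul τ a b }
  have ht : (TwoSidedIdeal.span {e}).asIdeal ≤
      Submodule.comap t (TwoSidedIdeal.span {τ e}).asIdeal := by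
    intro a ha
    have : TwoSidedIdeal.span {e} ≤ (TwoSidedIdeal.span {τ e}).comap τ :=
      TwoSidedIdeal.span_le.2 (by
        rintro _ rfl
        exact (TwoSidedIdeal.mem_comap τ).2 (TwoSidedIdeal.subset_span (Set.mem_singleton _)))
    exact Submodule.mem_comap.2 (TwoSidedIdeal.mem_asIdeal.2
      ((TwoSidedIdeal.mem_comap τ).1 (this (TwoSidedIdeal.mem_asIdeal.1 ha))))
  let F := Submodule.mapQ _ _ t ht
  have hF : Submodule.span A {(Submodule.Quotient.mk f : A ⧸ (TwoSidedIdeal.span {e}).asIdeal)} ≤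
      (Submodule.span B {(Submodule.Quotient.mk (τ f) :
        B ⧸ (TwoSidedIdeal.span {τ e}).asIdeal)}).comap F :=
    Submodule.span_le.2 (by
      rintro _ rfl
      exact Submodule.subset_span rfl)
  have hFs : ∀ (c : k) x, F (c • x) = c • F x := fun c x => by
    rw [← algebraMap_smul A c x, LinearMap.map_smulₛₗ, ← algebraMap_smul B c (F x)]
    congr 1
    exact τ.commutes c
  refine ⟨{ toFun := fun x => ⟨F x.1, hF x.2⟩, map_add' := ?_, map_smul' := ?_ }, ?_, ?_⟩
  · exact fun x y => Subtype.ext (map_add F x.1 y.1)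
  · exact fun c x => Subtype.ext (hFs c x.1)
  · exact fun a x => Subtype.ext (LinearMap.map_smulₛₗ F a x.1)
  · intro x a h
    exact congrArg F h

/-- An isomorphism of algebras induces an isomorphism of standard modules. -/
theorem exists_standardModule_equiv {B : Type u} [Ring B] [Algebra k B] (τ : A ≃ₐ[k] B)
    {e f : A} {e' f' : B} (he : τ e = e') (hf : τ f = f') :
    ∃ σ : StandardModule A e f ≃ₗ[k] StandardModule B e' f', ∀ a x, σ (a • x) = τ a • σ x := by
  obtain ⟨σ, hσ, hσ'⟩ := exists_standardModule_map_of_algHom (τ : A →ₐ[k] B) he hf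
  obtain ⟨ρ, -, hρ'⟩ := exists_standardModule_map_of_algHom (τ.symm : B →ₐ[k] A)
    (e := e') (f := f') (e' := e) (f' := f) (by rw [← he]; exact τ.symm_apply_apply e)
    (by rw [← hf]; exact τ.symm_apply_apply f)
  refine ⟨LinearEquiv.ofLinearMap σ ρ (LinearMap.ext fun y => ?_) (LinearMap.ext fun x => ?_), hσ⟩
  · obtain ⟨b, hb⟩ := Submodule.Quotient.mk_surjective _ (StandardModule.subtype e' f' y)
    refine StandardModule.subtype_injective e' f' ((hσ' _ _ (hρ' y b hb.symm)).trans ?_)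
    exact (congrArg Submodule.Quotient.mk (τ.apply_symm_apply b)).trans hb
  · obtain ⟨a, ha⟩ := Submodule.Quotient.mk_surjective _ (StandardModule.subtype e f x)
    refine StandardModule.subtype_injective e f ((hρ' _ _ (hσ' x a ha.symm)).trans ?_)
    exact (congrArg Submodule.Quotient.mk (τ.symm_apply_apply a)).trans ha

/-- An anti-involution `τ` that fixes `e` and `f` identifies the costandard module with the
contravariant dual of the standard module. -/
theorem exists_costandardModule_equiv (τ : A ≃ₐ[k] Aᵐᵒᵖ)
    (hτ : ∀ a, τ (τ a).unop = MulOpposite.op a)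
    (e f : A) (he : τ e = MulOpposite.op e) (hf : τ f = MulOpposite.op f) :
    ∃ p : CostandardModule k A e f ≃+ Module.Dual k (StandardModule A e f),
      ∀ a y x, p (a • y) x = p y ((τ a).unop • x) := by
  obtain ⟨σ, hσ⟩ := exists_standardModule_equiv τ he hf
  refine ⟨(σ.symm.dualMap.symm).toAddEquiv, fun a y x => ?_⟩
  have key : ∀ y : Module.Dual k (StandardModule Aᵐᵒᵖ (MulOpposite.op e) (MulOpposite.op f)),
      y (MulOpposite.op a • σ x) = y (σ ((τ a).unop • x)) := fun y => by rw [hσ, hτ]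
  exact key y

end Duality

/-! ### Inserting cups: spanning sets and dimension bounds for standard modules -/

section BlobLike

universe u

variable {k A : Type u} [Field k] [Ring A] [Algebra k A]

/-- `A` is generated by elements `e, U_1, …, U_{n-1}` which satisfy the relations of the blob
algebra. Since `e = 0` is allowed, this covers the Temperley–Lieb algebra as well. -/
structure IsBlobLike (n : ℕ) (U : ℕ → A) (e : A) (d γ δ : k) : Prop where
  sq : ∀ i, 1 ≤ i → i < n → U i * U i = d • U i
  up : ∀ i, 1 ≤ i → i + 1 < n → U i * U (i + 1) * U i = U i
  down : ∀ i, 1 ≤ i → i + 1 < n → U (i + 1) * U i * U (i + 1) = U (i + 1)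
  comm : ∀ i j, 1 ≤ i → i + 1 < j → j < n → Commute (U i) (U j)
  blob : 1 < n → U 1 * e * U 1 = γ • U 1
  esq : e * e = δ • e
  ecomm : ∀ i, 2 ≤ i → i < n → Commute (U i) e
  gen : Algebra.adjoin k (insert e (U '' {i | 1 ≤ i ∧ i < n})) = ⊤

theorem _root_.Commute.smul_smul_comm {Q : Type*} [AddCommGroup Q] [Module A Q] {a b : A}
    (h : Commute a b) (y : Q) : a • b • y = b • a • y := by
  rw [smul_smul, h.eq, mul_smul]

/-- The product `U_j U_{j+1} ⋯` with `r` factors. -/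
def run (U : ℕ → A) : ℕ → ℕ → A
  | _, 0 => 1
  | j, r + 1 => U j * run U (j + 1) r

/-- For `1 ≤ j < m` the element `U_j U_{j+1} ⋯ U_{m-2}`, which inserts a cup at `j, j + 1`; for
`j = 0` the element that inserts a decorated cup at `1, 2`. -/
def insertCup (U : ℕ → A) (e : A) (m j : ℕ) : A :=
  if j = 0 then e * run U 1 (m - 2) else if j < m then run U j (m - 1 - j) else 0

theorem insertCup_zero (U : ℕ → A) (e : A) {m : ℕ} (hm : 2 ≤ m) :
    insertCup U e m 0 = e * insertCup U e m 1 := by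
  rw [insertCup, insertCup, if_pos rfl, if_neg one_ne_zero, if_pos (by omega)]
  congr 2

theorem insertCup_of_le (U : ℕ → A) (e : A) {m j : ℕ} (hj : m ≤ j) (hm : 2 ≤ m) :
    insertCup U e m j = 0 := by
  rw [insertCup, if_neg (by omega), if_neg (by omega)]

/-- No factor is needed here. The vectors `y` into which a cup is inserted satisfy `U (m - 1) • y =
d • y`, so they already have a cup at `m - 1, m`; `insertCup` merely moves it to `j, j + 1`. -/
theorem insertCup_last (U : ℕ → A) (e : A) {m : ℕ} (hm : 2 ≤ m) :
    insertCup U e m (m - 1) = 1 := by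
  rw [insertCup, if_neg (by omega), if_pos (by omega), Nat.sub_self, run]

theorem insertCup_succ (U : ℕ → A) (e : A) {m j : ℕ} (hj : 1 ≤ j) (hm : j + 1 < m) :
    insertCup U e m j = U j * insertCup U e m (j + 1) := by
  rw [insertCup, if_neg (by omega), if_pos (by omega), insertCup, if_neg (by omega),
    if_pos (by omega), show m - 1 - j = (m - 1 - (j + 1)) + 1 by omega, run]

namespace IsBlobLike

variable {n : ℕ} {U : ℕ → A} {e : A} {d γ δ : k} (H : IsBlobLike n U e d γ δ)
include H

theorem commute_run_of_lt {l j r : ℕ} (hl : 1 ≤ l) (hj : l + 1 < j) (hr : j + r ≤ n) :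
    Commute (U l) (run U j r) := by
  induction r generalizing j with
  | zero => exact Commute.one_right _
  | succ r ih => exact (H.comm l j hl hj (by omega)).mul_right (ih (by omega) (by omega))

theorem commute_run_of_gt {l j r : ℕ} (hj : 1 ≤ j) (hl : j + r < l) (hn : l < n) :
    Commute (U l) (run U j r) := by
  induction r generalizing j with
  | zero => exact Commute.one_right _
  | succ r ih => exact (H.comm j l hj (by omega) hn).symm.mul_right (ih (by omega) (by omega))

theorem commute_e_run {j r : ℕ} (hj : 2 ≤ j) (hr : j + r ≤ n) : Commute e (run U j r) := by
  induction r generalizing j with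
  | zero => exact Commute.one_right _
  | succ r ih => exact (H.ecomm j hj (by omega)).symm.mul_right (ih (by omega) (by omega))

theorem commute_insertCup_of_lt {l j m : ℕ} (hl : 1 ≤ l) (hj : l + 1 < j) (hm : m ≤ n) :
    Commute (U l) (insertCup U e m j) := by
  rw [insertCup, if_neg (by omega)]
  split_ifs
  · exact H.commute_run_of_lt hl hj (by omega)
  · exact Commute.zero_right _

theorem commute_insertCup_of_gt {l j m : ℕ} (hl : m ≤ l) (hm : 2 ≤ m) (hn : l < n) :
    Commute (U l) (insertCup U e m j) := by
  rw [insertCup]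
  split_ifs
  · exact (H.ecomm l (by omega) hn).mul_right (H.commute_run_of_gt le_rfl (by omega) hn)
  · exact H.commute_run_of_gt (by omega) (by omega) hn
  · exact Commute.zero_right _

theorem commute_e_insertCup {j m : ℕ} (hj : 2 ≤ j) (hm : m ≤ n) :
    Commute e (insertCup U e m j) := by
  rw [insertCup, if_neg (by omega)]
  split_ifs
  · exact H.commute_e_run hj (by omega)
  · exact Commute.zero_right _

section Capped

variable {Q : Type u} [AddCommGroup Q] [Module k Q] [Module A Q] [IsScalarTower k A Q]
  {m : ℕ} (hd : d ≠ 0) (hm : 2 ≤ m) (hmn : m ≤ n)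

include hm hmn

/-- `U j` closes the cup at `j, j + 1` to a loop, which has the value `d`. -/
theorem U_insertCup_self {y : Q} (hy : U (m - 1) • y = d • y) {j : ℕ} (hj : 1 ≤ j) (hjm : j < m) :
    U j • insertCup U e m j • y = d • insertCup U e m j • y := by
  rcases Nat.lt_or_ge (j + 1) m with hj' | hj'
  · rw [insertCup_succ U e hj hj', smul_smul, ← mul_assoc, H.sq j hj (by omega), smul_mul_assoc,
      smul_assoc]
  · obtain rfl : j = m - 1 := by omega
    rw [insertCup_last U e hm, one_smul, hy]

include hd in
-- The relation `down` slides the cup one place to the right. When the cup is next to the last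
-- position, the missing third factor is supplied by `y = d⁻¹ • U (m - 1) • y`.
theorem U_succ_insertCup {y : Q} (hy : U (m - 1) • y = d • y) {j : ℕ} (hj : 1 ≤ j)
    (hjm : j + 1 < m) : U (j + 1) • insertCup U e m j • y = insertCup U e m (j + 1) • y := by
  rw [insertCup_succ U e hj hjm]
  rcases Nat.lt_or_ge (j + 2) m with hj' | hj'
  · rw [insertCup_succ U e (by omega) hj', smul_smul, ← mul_assoc, ← mul_assoc,
      H.down j hj (by omega)]
  · obtain rfl : m = j + 2 := by omega
    rw [show j + 1 = j + 2 - 1 from rfl, insertCup_last U e hm, mul_one, one_smul]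
    have hy' : y = d⁻¹ • U (j + 1) • y := by
      rw [show j + 1 = j + 2 - 1 from rfl, hy, smul_smul, inv_mul_cancel₀ hd, one_smul]
    conv_lhs => rw [hy']
    rw [smul_comm (U j) d⁻¹, smul_comm _ d⁻¹, smul_smul, smul_smul]
    have := H.down j hj (by omega)
    rw [show j + 2 - 1 = j + 1 from rfl, this]
    exact hy'.symm

include hd in
-- A cup inserted to the left pushes the strands `p, p + 1` two places to the right. For `p = j`
-- both sides reduce to `U j • insertCup U e m (j + 2) • y`: the left one by `up`, the right one by
-- `U_succ_insertCup`.
theorem insertCup_U {y : Q} (hy : U (m - 1) • y = d • y) {j p : ℕ} (hj : 1 ≤ j) (hjp : j ≤ p)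
    (hp : p + 2 < m) :
    insertCup U e m j • U p • y = U (p + 2) • insertCup U e m j • y := by
  obtain ⟨s, rfl⟩ := Nat.exists_eq_add_of_le hjp
  induction s generalizing j with
  | zero =>
    rw [add_zero] at *
    have h1 : insertCup U e m (j + 1) = U (j + 1) * insertCup U e m (j + 2) :=
      insertCup_succ U e (by omega) hp
    rw [insertCup_succ U e hj (by omega), mul_smul, mul_smul,
      ← (H.comm j (j + 2) hj (by omega) (by omega)).smul_smul_comm,
      H.U_succ_insertCup hd hm hmn hy (by omega) (by omega), h1, mul_smul,
      ← (H.commute_insertCup_of_lt hj (by omega) hmn).smul_smul_comm, smul_smul, smul_smul,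
      H.up j hj (by omega)]
  | succ s ih =>
    have h1 := ih (j := j + 1) (by omega) (by omega) (by omega)
    rw [show j + 1 + s = j + (s + 1) by omega] at h1
    rw [insertCup_succ U e hj (by omega), mul_smul, mul_smul, h1,
      (H.comm j (j + (s + 1) + 2) hj (by omega) (by omega)).smul_smul_comm]

end Capped

section TwiceCapped

variable {Q : Type u} [AddCommGroup Q] [Module k Q] [Module A Q] [IsScalarTower k A Q]
  {m : ℕ} (hd : d ≠ 0) (hm : 2 ≤ m) (hmn : m + 2 ≤ n)

include hd hm hmn

/-- A cup that is inserted into a vector with two caps does not see the second cap. -/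
theorem insertCup_eq_insertCup {z : Q} (hz : U (m - 1) • z = d • z) {j : ℕ} (hj : 1 ≤ j)
    (hjm : j < m) : insertCup U e (m + 2) j • z = insertCup U e m j • z := by
  obtain ⟨s, hs⟩ : ∃ s, m - 1 = j + s := Nat.exists_eq_add_of_le (by omega)
  induction s generalizing j with
  | zero =>
    obtain rfl : j = m - 1 := by omega
    obtain ⟨p, rfl⟩ : ∃ p, m = p + 1 := ⟨m - 1, by omega⟩
    rw [insertCup_last U e hm, insertCup_succ U e hj (by omega), insertCup_succ U e (by omega)
      (by omega), show p + 1 - 1 + 1 + 1 = p + 1 + 2 - 1 by omega, insertCup_last U e (by omega),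
      mul_one, one_smul]
    rw [Nat.add_sub_cancel] at *
    -- The vector `z` supplies the last factor of `U p * U (p + 1) * U p`.
    have hz' : z = d⁻¹ • U p • z := by
      rw [hz, smul_smul, inv_mul_cancel₀ hd, one_smul]
    conv_lhs => rw [hz']
    rw [smul_comm _ d⁻¹, smul_smul, H.up p hj (by omega)]
    exact hz'.symm
  | succ s ih =>
    rw [insertCup_succ U e hj (by omega), insertCup_succ U e hj (by omega), mul_smul, mul_smul,
      ih (by omega) (by omega) (by omega)]

/-- Cups that are not nested can be inserted in either order. -/
theorem insertCup_insertCup {z : Q} (hz : U (m - 1) • z = d • z) (hz' : U (m + 1) • z = d • z)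
    {j j' : ℕ} (hj' : 1 ≤ j') (hjj : j ≤ j') :
    insertCup U e (m + 2) j • insertCup U e m j' • z =
      insertCup U e (m + 2) (j' + 2) • insertCup U e m j • z := by
  rcases Nat.lt_or_ge j' m with hjm | hjm
  swap
  · rw [insertCup_of_le U e hjm hm, insertCup_of_le U e (m := m + 2) (j := j' + 2) (by omega)
      (by omega), zero_smul, smul_zero, zero_smul]
  -- These are the undecorated cups. The decorated cup at `0` is `e` times the one at `1`, and `e`
  -- commutes with the cup at `j' + 2`.
  have pos : ∀ j, 1 ≤ j → j ≤ j' → insertCup U e (m + 2) j • insertCup U e m j' • z =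
      insertCup U e (m + 2) (j' + 2) • insertCup U e m j • z := by
    intro j hj hjj
    obtain ⟨s, hs⟩ : ∃ s, m - 1 = j' + s := Nat.exists_eq_add_of_le (by omega)
    induction s generalizing j' with
    | zero =>
      obtain rfl : j' = m - 1 := by omega
      rw [insertCup_last U e hm, one_smul, show m - 1 + 2 = m + 2 - 1 by omega,
        insertCup_last U e (by omega), one_smul]
      exact H.insertCup_eq_insertCup hd hm hmn hz hj (by omega)
    | succ s ih =>
      have hcap : U (m + 2 - 1) • insertCup U e m (j' + 1) • z
          = d • insertCup U e m (j' + 1) • z := by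
        rw [show m + 2 - 1 = m + 1 by omega,
          (H.commute_insertCup_of_gt (by omega) hm (by omega)).smul_smul_comm, hz', smul_comm]
      rw [insertCup_succ U e hj' (by omega), mul_smul,
        H.insertCup_U hd (by omega) hmn hcap hj hjj (by omega),
        ih (by omega) (by omega) (by omega) (by omega) (by omega),
        insertCup_succ U e (j := j' + 2) (by omega) (by omega), mul_smul]
  rcases Nat.eq_zero_or_pos j with rfl | hj
  · rw [insertCup_zero U e (by omega), insertCup_zero U e hm, mul_smul, mul_smul,
      pos 1 le_rfl hj', (H.commute_e_insertCup (by omega) hmn).smul_smul_comm]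
  · exact pos j hj hjj

end TwiceCapped

section CupSpan

variable {Q : Type u} [AddCommGroup Q] [Module k Q] [Module A Q]
  [IsScalarTower k A Q]

variable (k U e) in
omit H in
/-- The span of the vectors obtained by inserting a cup at a position `j ≤ c` into a vector of
`F (j - 1)`. -/
def cupStep (F : ℕ → Submodule k Q) (m : ℕ) : ℕ → Submodule k Q
  | 0 => (F 0).map (Algebra.lsmul k k Q (insertCup U e m 0))
  | c + 1 => cupStep F m c ⊔ (F c).map (Algebra.lsmul k k Q (insertCup U e m (c + 1)))

variable (k U e) in
omit H in
/-- The span of the vectors obtained from `x` by inserting `t` cups in normal order, the last of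
them at a position `≤ c`. -/
def cupSpan (m₀ : ℕ) (x : Q) : ℕ → ℕ → Submodule k Q
  | 0 => fun _ => Submodule.span k {x}
  | t + 1 => cupStep k U e (cupSpan m₀ x t) (m₀ + 2 * t + 2)

omit H in
-- In normal order the positions increase strictly, except that the decorated position `0` may be
-- repeated; the truncated subtraction `0 - 1 = 0` expresses this.
theorem smul_mem_cupSpan {m₀ : ℕ} {x : Q} {t j c : ℕ} (hj : j ≤ c) {z : Q}
    (hz : z ∈ cupSpan k U e m₀ x t (j - 1)) :
    insertCup U e (m₀ + 2 * t + 2) j • z ∈ cupSpan k U e m₀ x (t + 1) c := by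
  induction c with
  | zero =>
    obtain rfl : j = 0 := by omega
    exact Submodule.mem_map_of_mem (f := Algebra.lsmul k k Q _) hz
  | succ c ih =>
    rcases Nat.lt_or_ge c j with h | h
    · obtain rfl : j = c + 1 := by omega
      exact Submodule.mem_sup_right (Submodule.mem_map_of_mem (f := Algebra.lsmul k k Q _) hz)
    · exact Submodule.mem_sup_left (ih h)

variable (k U e) in
omit H in
theorem cupSpan_mono (m₀ : ℕ) (x : Q) (t : ℕ) : Monotone (cupSpan k U e m₀ x t) := by
  cases t with
  | zero => exact fun _ _ _ => le_rfl
  | succ t => exact monotone_nat_of_le_succ fun c =>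
      (le_sup_left : cupSpan k U e m₀ x (t + 1) c ≤ _)

omit H in
theorem cupSpan_le {m₀ : ℕ} {x : Q} {t c : ℕ} {S : Submodule k Q}
    (h : ∀ j ≤ c, ∀ z ∈ cupSpan k U e m₀ x t (j - 1), insertCup U e (m₀ + 2 * t + 2) j • z ∈ S) :
    cupSpan k U e m₀ x (t + 1) c ≤ S := by
  induction c with
  | zero =>
    rintro _ ⟨z, hz, rfl⟩
    exact h 0 le_rfl z hz
  | succ c ih =>
    refine sup_le (ih fun j hj => h j (by omega)) ?_
    rintro _ ⟨z, hz, rfl⟩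
    exact h (c + 1) le_rfl z hz

omit H in
theorem cupSpan_le_cupSpan (m₀ : ℕ) (x : Q) (t c : ℕ) :
    cupSpan k U e m₀ x t c ≤ cupSpan k U e m₀ x t (m₀ + 2 * t - 1) := by
  cases t with
  | zero => exact le_rfl
  | succ t =>
    refine cupSpan_le fun j hj z hz => ?_
    rcases Nat.lt_or_ge (m₀ + 2 * (t + 1) - 1) j with h | h
    · rw [insertCup_of_le U e (by omega) (by omega), zero_smul]
      exact Submodule.zero_mem _
    · exact smul_mem_cupSpan h hz

variable {m₀ : ℕ} {x : Q} (hd : d ≠ 0)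
  (hcap : ∀ p, m₀ < p → p < n → p % 2 ≠ m₀ % 2 → U p • x = d • x)

include hcap in
-- The cups of `x` that have not been moved yet lie to the right of all inserted cups, so their `U
-- p` commutes with every `insertCup` used so far.
theorem smul_of_mem_cupSpan {t c : ℕ} {z : Q} (hz : z ∈ cupSpan k U e m₀ x t c) {p : ℕ}
    (hp : m₀ + 2 * t < p) (hpn : p < n) (hpp : p % 2 ≠ m₀ % 2) : U p • z = d • z := by
  suffices h : cupSpan k U e m₀ x t c ≤
      LinearMap.eqLocus (Algebra.lsmul k k Q (U p)) (d • LinearMap.id : Q →ₗ[k] Q) from h hz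
  clear hz
  induction t generalizing c with
  | zero =>
    refine Submodule.span_le.2 ?_
    rintro _ rfl
    exact hcap p (by omega) hpn hpp
  | succ t ih =>
    refine cupSpan_le fun j hj z hz => ?_
    change U p • insertCup U e (m₀ + 2 * t + 2) j • z = d • insertCup U e (m₀ + 2 * t + 2) j • z
    have h1 : U p • z = d • z := ih (by omega) hz
    rw [(H.commute_insertCup_of_gt (by omega) (by omega) hpn).smul_smul_comm, h1, smul_comm]

include hd hcap in
-- If `j` is not beyond the position `j'` of the previous cup, `insertCup_insertCup` exchanges the
-- two. The cup at `j` is then sorted into a vector with fewer cups by induction, while the other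
-- one moves to `j' + 2`; this accounts for `c + 2`.
theorem insertCup_smul_mem_cupSpan {t c j : ℕ} (ht : m₀ + 2 * t + 2 ≤ n) {z : Q}
    (hz : z ∈ cupSpan k U e m₀ x t c) :
    insertCup U e (m₀ + 2 * t + 2) j • z ∈ cupSpan k U e m₀ x (t + 1) (max j (c + 2)) := by
  suffices h : cupSpan k U e m₀ x t c ≤ (cupSpan k U e m₀ x (t + 1) (max j (c + 2))).comap
      (Algebra.lsmul k k Q (insertCup U e (m₀ + 2 * t + 2) j)) from h hz
  clear hz
  induction t generalizing c j with
  | zero => exact fun z hz => smul_mem_cupSpan (t := 0) (le_max_left _ _) hz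
  | succ t ih =>
    refine cupSpan_le fun j' hj' z hz => ?_
    change insertCup U e (m₀ + 2 * (t + 1) + 2) j • insertCup U e (m₀ + 2 * t + 2) j' • z ∈
      cupSpan k U e m₀ x (t + 1 + 1) (max j (c + 2))
    rcases Nat.lt_or_ge j' j with hlt | hge
    · exact smul_mem_cupSpan (le_max_left _ _) (smul_mem_cupSpan (by omega) hz)
    · rcases Nat.eq_zero_or_pos j' with rfl | hpos
      · obtain rfl : j = 0 := by omega
        exact smul_mem_cupSpan (Nat.zero_le _) (smul_mem_cupSpan le_rfl hz)
      · have h1 : U (m₀ + 2 * t + 2 - 1) • z = d • z :=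
          H.smul_of_mem_cupSpan hcap hz (by omega) (by omega) (by omega)
        have h2 : U (m₀ + 2 * t + 2 + 1) • z = d • z :=
          H.smul_of_mem_cupSpan hcap hz (by omega) (by omega) (by omega)
        rw [show m₀ + 2 * (t + 1) + 2 = m₀ + 2 * t + 2 + 2 by ring,
          H.insertCup_insertCup hd (by omega) (by omega) h1 h2 hpos hge,
          show m₀ + 2 * t + 2 + 2 = m₀ + 2 * (t + 1) + 2 by ring]
        refine smul_mem_cupSpan (le_max_of_le_right (by omega)) ?_
        exact cupSpan_mono k U e m₀ x (t + 1) (by omega) (ih (by omega) hz)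

include hd hcap in
theorem insertCup_smul_mem {t j : ℕ} (ht : m₀ + 2 * t + 2 ≤ n) {z : Q}
    (hz : z ∈ cupSpan k U e m₀ x t (m₀ + 2 * t - 1)) :
    insertCup U e (m₀ + 2 * t + 2) j • z ∈
      cupSpan k U e m₀ x (t + 1) (m₀ + 2 * (t + 1) - 1) :=
  cupSpan_le_cupSpan _ _ _ _ (H.insertCup_smul_mem_cupSpan hd hcap ht hz)

variable (hU : ∀ p, 1 ≤ p → p < m₀ → U p • x = 0) {κ : k} (he : 1 ≤ m₀ → e • x = κ • x)

include hd hcap hU he in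
-- A generator meets the cup inserted last. It closes the cup, slides it to a neighbouring place,
-- decorates it, or passes it and acts on a vector with one cup fewer, its index dropping by two if
-- it stands to the right. In the last case the result may be out of order, which
-- `insertCup_smul_mem` repairs.
theorem smul_mem_cupSpan_of_gen {t : ℕ} (ht : m₀ + 2 * t ≤ n) {z : Q}
    (hz : z ∈ cupSpan k U e m₀ x t (m₀ + 2 * t - 1)) :
    (∀ l, 1 ≤ l → l < m₀ + 2 * t → U l • z ∈ cupSpan k U e m₀ x t (m₀ + 2 * t - 1)) ∧
      (1 ≤ m₀ + 2 * t → e • z ∈ cupSpan k U e m₀ x t (m₀ + 2 * t - 1)) := by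
  induction t generalizing z with
  | zero =>
    obtain ⟨c, rfl⟩ := Submodule.mem_span_singleton.1 (show z ∈ Submodule.span k {x} from hz)
    refine ⟨fun l hl hlm => ?_, fun hm => ?_⟩
    · rw [smul_comm, hU l hl (by omega), smul_zero]
      exact Submodule.zero_mem _
    · rw [smul_comm, he (by omega), smul_smul]
      exact Submodule.smul_mem _ _ (Submodule.mem_span_singleton_self x)
  | succ t ih =>
    set F := cupSpan k U e m₀ x (t + 1) (m₀ + 2 * (t + 1) - 1) with hF
    set Y := cupSpan k U e m₀ x t (m₀ + 2 * t - 1) with hY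
    obtain ⟨m, hm⟩ : ∃ m, m = m₀ + 2 * t + 2 := ⟨_, rfl⟩
    have hmn : m ≤ n := by omega
    have hm2 : 2 ≤ m := by omega
    have ins : ∀ j, ∀ y ∈ Y, insertCup U e m j • y ∈ F := fun j y hy => by
      rw [hm]; exact H.insertCup_smul_mem hd hcap (by omega) hy
    have hcapY : ∀ y ∈ Y, U (m - 1) • y = d • y := fun y hy =>
      H.smul_of_mem_cupSpan hcap hy (by omega) (by omega) (by omega)
    have main : ∀ j < m, ∀ y ∈ Y, (∀ l, 1 ≤ l → l < m → U l • insertCup U e m j • y ∈ F) ∧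
        e • insertCup U e m j • y ∈ F := by
      intro j hj y hy
      have hyc := hcapY y hy
      have ihU : ∀ l, 1 ≤ l → l + 2 < m → U l • y ∈ Y := fun l hl hl' =>
        (ih (by omega) hy).1 l hl (by omega)
      have ihe : 2 < m → e • y ∈ Y := fun h => (ih (by omega) hy).2 (by omega)
      have hself : U 1 • insertCup U e m 1 • y = d • insertCup U e m 1 • y :=
        H.U_insertCup_self hm2 hmn hyc le_rfl (by omega)
      rcases Nat.eq_zero_or_pos j with rfl | hj0
      · rw [insertCup_zero U e hm2, mul_smul]
        refine ⟨fun l hl hlm => ?_, ?_⟩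
        · rcases Nat.lt_or_ge 1 l with hl1 | hl1
          · rw [(H.ecomm l hl1 (by omega)).smul_smul_comm]
            rcases Nat.lt_or_ge 2 l with hl2 | hl2
            · obtain ⟨p, rfl⟩ : ∃ p, l = p + 2 := ⟨l - 2, by omega⟩
              rw [← H.insertCup_U hd hm2 hmn hyc le_rfl (by omega) hlm, ← mul_smul,
                ← insertCup_zero U e hm2]
              exact ins 0 _ (ihU p (by omega) hlm)
            · obtain rfl : l = 1 + 1 := by omega
              rw [H.U_succ_insertCup hd hm2 hmn hyc le_rfl hlm,
                (H.commute_e_insertCup le_rfl hmn).smul_smul_comm]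
              exact ins _ _ (ihe (by omega))
          · obtain rfl : l = 1 := by omega
            -- The relation `blob` needs a factor `U 1` to the right of `e`; the cup at `1, 2`
            -- provides it.
            have h1 : insertCup U e m 1 • y = d⁻¹ • U 1 • insertCup U e m 1 • y := by
              rw [hself, smul_smul, inv_mul_cancel₀ hd, one_smul]
            rw [h1, smul_comm e, smul_comm (U 1), ← mul_smul, ← mul_smul,
              H.blob (by omega), smul_assoc, hself]
            exact F.smul_mem _ (F.smul_mem _ (F.smul_mem _ (ins 1 y hy)))
        · rw [← mul_smul e e, H.esq, smul_assoc, ← mul_smul, ← insertCup_zero U e hm2]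
          exact F.smul_mem _ (ins 0 y hy)
      · refine ⟨fun l hl hlm => ?_, ?_⟩
        · rcases lt_trichotomy l j with hlt | rfl | hgt
          · rcases Nat.lt_or_ge (l + 1) j with h | h
            · rw [(H.commute_insertCup_of_lt hl h hmn).smul_smul_comm]
              exact ins j _ (ihU l hl (by omega))
            · obtain rfl : j = l + 1 := by omega
              rw [← mul_smul, ← insertCup_succ U e hl hj]
              exact ins l y hy
          · rw [H.U_insertCup_self hm2 hmn hyc hl hlm]
            exact F.smul_mem _ (ins l y hy)
          · rcases Nat.lt_or_ge (j + 1) l with h | h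
            · obtain ⟨p, rfl⟩ : ∃ p, l = p + 2 := ⟨l - 2, by omega⟩
              rw [← H.insertCup_U hd hm2 hmn hyc hj0 (by omega) hlm]
              exact ins j _ (ihU p (by omega) hlm)
            · obtain rfl : l = j + 1 := by omega
              rw [H.U_succ_insertCup hd hm2 hmn hyc hj0 hlm]
              exact ins _ y hy
        · rcases Nat.lt_or_ge 1 j with h | h
          · rw [(H.commute_e_insertCup h hmn).smul_smul_comm]
            exact ins j _ (ihe (by omega))
          · obtain rfl : j = 1 := by omega
            rw [← mul_smul, ← insertCup_zero U e hm2]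
            exact ins 0 y hy
    have hz' : ∀ a : A, (∀ j < m, ∀ y ∈ Y, a • insertCup U e m j • y ∈ F) → a • z ∈ F := by
      intro a ha
      suffices h : F ≤ F.comap (Algebra.lsmul k k Q a) from h hz
      refine cupSpan_le fun j hj y hy => ?_
      rw [← hm]
      exact ha j (by omega) y (cupSpan_le_cupSpan _ _ _ _ hy)
    exact ⟨fun l hl hlm => hz' _ fun j hj y hy => (main j hj y hy).1 l hl (by omega),
      fun _ => hz' _ fun j hj y hy => (main j hj y hy).2⟩

variable (k U e) in
omit H in
theorem mem_cupSpan_self (m₀ : ℕ) (x : Q) (t : ℕ) :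
    x ∈ cupSpan k U e m₀ x t (m₀ + 2 * t - 1) := by
  induction t with
  | zero => exact Submodule.subset_span (Set.mem_singleton x)
  | succ t ih =>
    have h := smul_mem_cupSpan (k := k) (U := U) (e := e) (j := m₀ + 2 * t + 2 - 1)
      (c := m₀ + 2 * (t + 1) - 1) (by omega) (cupSpan_mono k U e m₀ x t (by omega) ih)
    rwa [insertCup_last U e (by omega), one_smul] at h

include hd hcap hU he in
/-- The module generated by `x` is spanned by the vectors obtained by inserting cups. -/
theorem span_le_cupSpan {t : ℕ} (ht : m₀ + 2 * t = n) (he0 : n = 0 → e = 0) :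
    (Submodule.span A {x}).restrictScalars k ≤ cupSpan k U e m₀ x t n := by
  intro y hy
  obtain ⟨a, rfl⟩ := Submodule.mem_span_singleton.1 hy
  have key : ∀ a : A, ∀ z ∈ cupSpan k U e m₀ x t (m₀ + 2 * t - 1),
      a • z ∈ cupSpan k U e m₀ x t (m₀ + 2 * t - 1) := by
    intro a
    have ha : a ∈ Algebra.adjoin k (insert e (U '' {i | 1 ≤ i ∧ i < n})) := by
      rw [H.gen]; trivial
    induction ha using Algebra.adjoin_induction with
    | mem a ha =>
      intro z hz
      have h1 := H.smul_mem_cupSpan_of_gen hd hcap hU he ht.le hz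
      rcases ha with rfl | ⟨l, ⟨hl, hln⟩, rfl⟩
      · rcases Nat.eq_zero_or_pos n with h0 | h0
        · rw [he0 h0, zero_smul]
          exact Submodule.zero_mem _
        · exact h1.2 (by omega)
      · exact h1.1 l hl (by omega)
    | algebraMap r =>
      intro z hz
      rw [algebraMap_smul]
      exact Submodule.smul_mem _ _ hz
    | add a b _ _ ha hb =>
      intro z hz
      rw [add_smul]
      exact Submodule.add_mem _ (ha z hz) (hb z hz)
    | mul a b _ _ ha hb =>
      intro z hz
      rw [mul_smul]
      exact ha _ (hb z hz)
  exact cupSpan_mono k U e m₀ x t (by omega) (key a x (mem_cupSpan_self k U e m₀ x t))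

omit H in
instance finite_cupSpan (m₀ : ℕ) (x : Q) (t c : ℕ) :
    Module.Finite k (cupSpan k U e m₀ x t c) := by
  rw [Module.Finite.iff_fg]
  induction t generalizing c with
  | zero => exact Submodule.fg_span_singleton x
  | succ t ih =>
    induction c with
    | zero => exact (ih 0).map _
    | succ c ih' => exact ih'.sup ((ih c).map _)

omit H in
-- The dimension for `(t + 1, c + 1)` is at most the sum of those for `(t + 1, c)` and `(t, c)`, so
-- any `N` that grows at least as fast is a bound. In `h₁` the decorated cup at position `0` is
-- allowed, or absent because `e = 0`. `h₃` concerns the position `m₀ + 2 * t + 2`, where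
-- `insertCup` is zero and nothing new arises.
theorem finrank_cupSpan_le (m₀ : ℕ) (x : Q) (N : ℕ → ℕ → ℤ) (h₀ : ∀ c ≤ m₀, 1 ≤ N 0 c)
    (h₁ : (∀ t, N t 0 ≤ N (t + 1) 0) ∨ (e = 0 ∧ ∀ t, 0 ≤ N (t + 1) 0))
    (h₂ : ∀ t c, c ≤ m₀ + 2 * t → N (t + 1) c + N t c ≤ N (t + 1) (c + 1))
    (h₃ : ∀ t, N (t + 1) (m₀ + 2 * t + 1) ≤ N (t + 1) (m₀ + 2 * t + 2))
    {t c : ℕ} (hc : c ≤ m₀ + 2 * t) :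
    (Module.finrank k (cupSpan k U e m₀ x t c) : ℤ) ≤ N t c := by
  have hmap : ∀ (a : A) (t c : ℕ), Module.finrank k
      ((cupSpan k U e m₀ x t c).map (Algebra.lsmul k k Q a)) ≤
        Module.finrank k (cupSpan k U e m₀ x t c) := fun a t c => Submodule.finrank_map_le _ _
  induction t generalizing c with
  | zero =>
    refine le_trans ?_ (h₀ c hc)
    have h4 : Module.finrank k (Submodule.span k {x}) ≤ 1 := by
      simpa using finrank_span_le_card (R := k) ({x} : Set Q)
    exact_mod_cast h4
  | succ t ih =>
    induction c with
    | zero =>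
      rcases h₁ with h₁ | ⟨rfl, h₁⟩
      · refine le_trans ?_ ((ih (Nat.zero_le _)).trans (h₁ t))
        exact_mod_cast hmap _ t 0
      · refine le_trans (le_of_eq ?_) (h₁ t)
        have : cupSpan k U (0 : A) m₀ x (t + 1) 0 = ⊥ := by
          rw [eq_bot_iff]
          rintro _ ⟨z, hz, rfl⟩
          rw [insertCup, if_pos rfl, zero_mul, map_zero]
          exact Submodule.zero_mem _
        rw [this, finrank_bot, Nat.cast_zero]
    | succ c ih' =>
      rcases Nat.lt_or_ge (m₀ + 2 * t) c with h | h
      · obtain rfl : c = m₀ + 2 * t + 1 := by omega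
        refine le_trans ?_ ((ih' (by omega)).trans (h₃ t))
        have := Submodule.finrank_mono (cupSpan_le_cupSpan (k := k) (U := U) (e := e) m₀ x (t + 1)
          (m₀ + 2 * t + 1 + 1))
        exact_mod_cast this
      · refine le_trans ?_ ((add_le_add (ih' (by omega)) (ih h)).trans (h₂ t c h))
        have h5 := Submodule.finrank_add_le_finrank_add_finrank (cupSpan k U e m₀ x (t + 1) c)
          ((cupSpan k U e m₀ x t c).map
            (Algebra.lsmul k k Q (insertCup U e (m₀ + 2 * t + 2) (c + 1))))
        have h6 := hmap (insertCup U e (m₀ + 2 * t + 2) (c + 1)) t c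
        have h7 : Module.finrank k (cupSpan k U e m₀ x (t + 1) (c + 1)) ≤
          Module.finrank k (cupSpan k U e m₀ x (t + 1) c) +
            Module.finrank k (cupSpan k U e m₀ x t c) := h5.trans (Nat.add_le_add_left h6 _)
        exact_mod_cast h7

end CupSpan

end IsBlobLike

/-- The product `d^{-i} U_{m-1} U_{m-3} ⋯` with `i` factors `U`. -/
def capProd (U : ℕ → A) (d : k) : ℕ → ℕ → A
  | _, 0 => 1
  | 0, _ + 1 => 0
  | 1, _ + 1 => 0
  | m + 2, i + 1 => (d⁻¹ • U (m + 1)) * capProd U d m i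

theorem capProd_zero (U : ℕ → A) (d : k) (m : ℕ) : capProd U d m 0 = 1 := by
  rw [capProd.eq_def]

theorem capProd_succ (U : ℕ → A) (d : k) (m i : ℕ) :
    capProd U d (m + 2) (i + 1) = (d⁻¹ • U (m + 1)) * capProd U d m i := by
  rw [capProd]

theorem capProd_eq_zero (U : ℕ → A) (d : k) {m i : ℕ} (h : m < 2 * i) : capProd U d m i = 0 := by
  induction i generalizing m with
  | zero => omega
  | succ i ih =>
    match m with
    | 0 => rw [capProd]
    | 1 => rw [capProd]
    | m + 2 => rw [capProd_succ, ih (by omega), mul_zero]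

/-- The definition splits off the factor of highest index and so changes `m`. Splitting off the
factor of lowest index compares consecutive idempotents of the same algebra. -/
theorem capProd_succ' (U : ℕ → A) (d : k) {m i : ℕ} (h : 2 * i + 2 ≤ m) :
    capProd U d m (i + 1) = capProd U d m i * (d⁻¹ • U (m - 2 * i - 1)) := by
  induction i generalizing m with
  | zero =>
    obtain ⟨m, rfl⟩ := Nat.exists_eq_add_of_le' h
    rw [capProd_succ, capProd_zero, capProd_zero, mul_one, one_mul]
    rfl
  | succ i ih =>
    obtain ⟨m, rfl⟩ : ∃ p, m = p + 2 := ⟨m - 2, by omega⟩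
    rw [capProd_succ, ih (by omega), capProd_succ, mul_assoc]
    congr 4
    omega

namespace IsBlobLike

variable {n : ℕ} {U : ℕ → A} {e : A} {d γ δ : k} (H : IsBlobLike n U e d γ δ)
include H

theorem commute_capProd {l m i : ℕ} (hl : 1 ≤ l) (hlm : l + 2 * i < m) (hm : m ≤ n) :
    Commute (U l) (capProd U d m i) := by
  induction i generalizing m with
  | zero => rw [capProd_zero]; exact Commute.one_right _
  | succ i ih =>
    obtain ⟨m, rfl⟩ : ∃ p, m = p + 2 := ⟨m - 2, by omega⟩
    rw [capProd_succ]
    exact ((H.comm l (m + 1) hl (by omega) (by omega)).smul_right _).mul_right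
      (ih (by omega) (by omega))

theorem commute_e_capProd {m i : ℕ} (him : 2 * i < m) (hm : m ≤ n) :
    Commute e (capProd U d m i) := by
  induction i generalizing m with
  | zero => rw [capProd_zero]; exact Commute.one_right _
  | succ i ih =>
    obtain ⟨m, rfl⟩ : ∃ p, m = p + 2 := ⟨m - 2, by omega⟩
    rw [capProd_succ]
    exact ((H.ecomm (m + 1) (by omega) (by omega)).symm.smul_right _).mul_right
      (ih (by omega) (by omega))

theorem U_mul_capProd {p m i : ℕ} (hm : m ≤ n) (hpm : p < m) (hp : m < p + 2 * i)
    (hpp : p % 2 ≠ m % 2) (him : 2 * i ≤ m) : U p * capProd U d m i = d • capProd U d m i := by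
  induction i generalizing m with
  | zero => omega
  | succ i ih =>
    obtain ⟨m, rfl⟩ : ∃ p, m = p + 2 := ⟨m - 2, by omega⟩
    rw [capProd_succ, ← mul_assoc]
    rcases Nat.lt_or_ge p m with h | h
    · rw [((H.comm p (m + 1) (by omega) (by omega) (by omega)).smul_right d⁻¹).eq, mul_assoc,
        ih (by omega) h (by omega) (by omega) (by omega), mul_smul_comm]
    · obtain rfl : p = m + 1 := by omega
      rw [mul_smul_comm, H.sq _ (by omega) (by omega), smul_comm, smul_mul_assoc]

/-- For `p = n - 2 * i - 1` the product is `d` times the next idempotent. Smaller `p` follow by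
descent: `U p = U p * U (p + 1) * U p`, and `U p` commutes with `capProd U d n i`. -/
theorem U_mul_capProd_mem (hd : d ≠ 0) {p i : ℕ} (hp : 1 ≤ p) (hpn : p + 2 * i < n) :
    U p * capProd U d n i ∈ TwoSidedIdeal.span {capProd U d n (i + 1)} := by
  obtain ⟨s, hs⟩ : ∃ s, n = p + 2 * i + 1 + s := Nat.exists_eq_add_of_le (by omega)
  induction s generalizing p with
  | zero =>
    have h1 : capProd U d n (i + 1) ∈ TwoSidedIdeal.span {capProd U d n (i + 1)} :=
      TwoSidedIdeal.subset_span rfl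
    have h2 : U p * capProd U d n i =
        algebraMap k A d * capProd U d n (i + 1) := by
      rw [capProd_succ' U d (by omega), show n - 2 * i - 1 = p by omega, ← Algebra.smul_def,
        mul_smul_comm, smul_smul, mul_inv_cancel₀ hd, one_smul,
        (H.commute_capProd hp (by omega) le_rfl).eq]
    rw [h2]
    exact TwoSidedIdeal.mul_mem_left _ _ _ h1
  | succ s ih =>
    have h1 := ih (p := p + 1) (by omega) (by omega) (by omega)
    have h2 : U p * capProd U d n i = U p * (U (p + 1) * capProd U d n i) * U p := by
      conv_lhs => rw [← H.up p hp (by omega)]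
      rw [mul_assoc, mul_assoc, mul_assoc, mul_assoc,
        (H.commute_capProd hp (by omega) le_rfl).eq]
    rw [h2]
    exact TwoSidedIdeal.mul_mem_right _ _ _ (TwoSidedIdeal.mul_mem_left _ _ _ h1)

/-- An upper bound for the dimension of a standard module. -/
theorem finrank_standardModule_le (hd : d ≠ 0) {m₀ i : ℕ} (hn : m₀ + 2 * i = n)
    (he0 : n = 0 → e = 0) {f : A} {κ : k} (hf : 1 ≤ m₀ → e * f = κ • f)
    (N : ℕ → ℕ → ℤ) (h₀ : ∀ c ≤ m₀, 1 ≤ N 0 c)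
    (h₁ : (∀ t, N t 0 ≤ N (t + 1) 0) ∨ (e = 0 ∧ ∀ t, 0 ≤ N (t + 1) 0))
    (h₂ : ∀ t c, c ≤ m₀ + 2 * t → N (t + 1) c + N t c ≤ N (t + 1) (c + 1))
    (h₃ : ∀ t, N (t + 1) (m₀ + 2 * t + 1) ≤ N (t + 1) (m₀ + 2 * t + 2)) :
    Module.Finite k (StandardModule A (capProd U d n (i + 1)) (capProd U d n i * f)) ∧
      (Module.finrank k (StandardModule A (capProd U d n (i + 1)) (capProd U d n i * f)) : ℤ) ≤
        N i n := by
  let J := (TwoSidedIdeal.span {capProd U d n (i + 1)}).asIdeal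
  -- The generator is a half diagram with `m₀` through strands on the left and `i` adjacent cups on
  -- the right. In the quotient by `J` nothing with more cups survives, which gives `hU`.
  let x : A ⧸ J := Submodule.Quotient.mk (capProd U d n i * f)
  have hcap : ∀ p, m₀ < p → p < n → p % 2 ≠ m₀ % 2 → U p • x = d • x := by
    intro p hp hpn hpp
    change Submodule.Quotient.mk (U p * (capProd U d n i * f)) = _
    rw [← mul_assoc, H.U_mul_capProd le_rfl hpn (by omega) (by omega) (by omega), smul_mul_assoc]
    rfl
  have hU : ∀ p, 1 ≤ p → p < m₀ → U p • x = 0 := by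
    intro p hp hpm
    refine (Submodule.Quotient.mk_eq_zero J).2 (TwoSidedIdeal.mem_asIdeal.2 ?_)
    change U p * (capProd U d n i * f) ∈ _
    rw [← mul_assoc]
    exact TwoSidedIdeal.mul_mem_right _ _ _ (H.U_mul_capProd_mem hd hp (by omega))
  have he : 1 ≤ m₀ → e • x = κ • x := by
    intro h
    change Submodule.Quotient.mk (e * (capProd U d n i * f)) = _
    rw [← mul_assoc, (H.commute_e_capProd (by omega) le_rfl).eq, mul_assoc, hf h, mul_smul_comm]
    rfl
  have hle := H.span_le_cupSpan hd hcap hU he hn he0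
  let g : StandardModule A (capProd U d n (i + 1)) (capProd U d n i * f) →ₗ[k]
      cupSpan k U e m₀ x i n :=
    ((StandardModule.subtype _ _).restrictScalars k).codRestrict _ fun y => hle (by
      have := LinearMap.mem_range_self (StandardModule.subtype (capProd U d n (i + 1))
        (capProd U d n i * f)) y
      rwa [StandardModule.range_subtype] at this)
  have hg : Function.Injective g := fun y z hyz => by
    have h := congrArg (fun t : cupSpan k U e m₀ x i n => t.1) hyz
    exact StandardModule.subtype_injective _ _ h
  refine ⟨Module.Finite.of_injective g hg, ?_⟩
  have h5 := finrank_cupSpan_le (k := k) (U := U) (e := e) m₀ x N h₀ h₁ h₂ h₃ (t := i) (c := n) hn.ge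
  have h6 := LinearMap.finrank_le_finrank_of_injective hg
  omega

end IsBlobLike

end BlobLike

/-! ### Rank one operators on functions on words, and reduction to words avoiding leading factors -/

section SiteModel

universe u

variable {k : Type u} [Field k] {X : Type} [Fintype X] [DecidableEq X]

/-- The operator on functions on words which acts as the rank one operator `u ⊗ v` on the
letters `i, j`. -/
def pairOp (u v : X → X → k) {m : ℕ} (i j : Fin m) : Module.End k ((Fin m → X) → k) where
  toFun f := fun w => u (w i) (w j) *
    ∑ x, ∑ y, v x y * f (Function.update (Function.update w i x) j y)
  map_add' f g := by
    ext w
    simp only [Pi.add_apply, mul_add, Finset.sum_add_distrib]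
  map_smul' c f := by
    ext w
    simp only [Pi.smul_apply, smul_eq_mul, RingHom.id_apply, Finset.mul_sum]
    exact Finset.sum_congr rfl fun a _ => Finset.sum_congr rfl fun b _ => by ring

/-- The operator on functions on words which acts as the matrix `K` on the letter `i`. -/
def letterOp (K : X → X → k) {m : ℕ} (i : Fin m) : Module.End k ((Fin m → X) → k) where
  toFun f := fun w => ∑ x, K (w i) x * f (Function.update w i x)
  map_add' f g := by
    ext w
    simp only [Pi.add_apply, mul_add, Finset.sum_add_distrib]
  map_smul' c f := by
    ext w
    simp only [Pi.smul_apply, smul_eq_mul, RingHom.id_apply, Finset.mul_sum]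
    exact Finset.sum_congr rfl fun a _ => by ring

omit [DecidableEq X] in
theorem pairOp_apply (u v : X → X → k) {m : ℕ} (i j : Fin m) (f : (Fin m → X) → k)
    (w : Fin m → X) : pairOp u v i j f w = u (w i) (w j) *
      ∑ x, ∑ y, v x y * f (Function.update (Function.update w i x) j y) := rfl

omit [DecidableEq X] in
theorem letterOp_apply (K : X → X → k) {m : ℕ} (i : Fin m) (f : (Fin m → X) → k)
    (w : Fin m → X) : letterOp K i f w = ∑ x, K (w i) x * f (Function.update w i x) := rfl

section AppendPair

variable (u v : X → X → k) {m : ℕ}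

/-- The map `f ↦ f ⊗ u` that inserts `u` in two new letters at the end. -/
def appendPair (m : ℕ) : ((Fin m → X) → k) →ₗ[k] ((Fin (m + 2) → X) → k) where
  toFun f := fun w => f (w ∘ Fin.castAdd 2) * u (w (Fin.natAdd m 0)) (w (Fin.natAdd m 1))
  map_add' f g := by
    ext w
    simp only [Pi.add_apply, add_mul]
  map_smul' c f := by
    ext w
    simp only [Pi.smul_apply, smul_eq_mul, RingHom.id_apply, mul_assoc]

omit [Fintype X] [DecidableEq X] in
theorem appendPair_apply (f : (Fin m → X) → k) (w : Fin (m + 2) → X) :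
    appendPair u m f w =
      f (w ∘ Fin.castAdd 2) * u (w (Fin.natAdd m 0)) (w (Fin.natAdd m 1)) := rfl

omit [Fintype X] [DecidableEq X] in
theorem update_castAdd_comp (w : Fin (m + 2) → X) (i : Fin m) (x : X) :
    Function.update w (Fin.castAdd 2 i) x ∘ Fin.castAdd 2 =
      Function.update (w ∘ Fin.castAdd 2) i x :=
  Function.update_comp_eq_of_injective _ (Fin.castAdd_injective m 2) _ _

omit [Fintype X] [DecidableEq X] in
theorem update_castAdd_natAdd (w : Fin (m + 2) → X) (i : Fin m) (x : X) (s : Fin 2) :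
    Function.update w (Fin.castAdd 2 i) x (Fin.natAdd m s) = w (Fin.natAdd m s) := by
  refine Function.update_of_ne (fun h => ?_) _ _
  have := congrArg Fin.val h
  simp only [Fin.val_natAdd, Fin.val_castAdd] at this
  omega

omit [DecidableEq X] in
theorem pairOp_appendPair (i j : Fin m) (f : (Fin m → X) → k) :
    pairOp u v (Fin.castAdd 2 i) (Fin.castAdd 2 j) (appendPair u m f) =
      appendPair u m (pairOp u v i j f) := by
  ext w
  simp only [pairOp_apply, appendPair_apply, update_castAdd_comp, update_castAdd_natAdd,
    ← mul_assoc, ← Finset.sum_mul, Function.comp_apply]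

omit [DecidableEq X] in
theorem letterOp_appendPair (K : X → X → k) (i : Fin m) (f : (Fin m → X) → k) :
    letterOp K (Fin.castAdd 2 i) (appendPair u m f) = appendPair u m (letterOp K i f) := by
  ext w
  simp only [letterOp_apply, appendPair_apply, update_castAdd_comp, update_castAdd_natAdd,
    ← mul_assoc, ← Finset.sum_mul, Function.comp_apply]

omit [Fintype X] [DecidableEq X] in
theorem update_natAdd_natAdd (w : Fin (m + 2) → X) (x y : X) :
    Function.update (Function.update w (Fin.natAdd m 0) x) (Fin.natAdd m 1) y =
      Fin.append (w ∘ Fin.castAdd 2) ![x, y] := by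
  ext p
  refine Fin.addCases (fun p => ?_) (fun p => ?_) p
  · rw [Fin.append_left, Function.update_of_ne, Function.update_of_ne]
    · rfl
    all_goals
      intro h
      have := congrArg Fin.val h
      simp only [Fin.val_natAdd, Fin.val_castAdd] at this
      omega
  · rw [Fin.append_right]
    match p with
    | 0 =>
      rw [Function.update_of_ne, Function.update_self]
      · rfl
      · intro h
        simpa using congrArg Fin.val h
    | 1 => rw [Function.update_self]; rfl

omit [DecidableEq X] [Fintype X] in
theorem append_comp_castAdd (w : Fin m → X) (z : Fin 2 → X) :
    Fin.append w z ∘ Fin.castAdd 2 = w :=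
  funext fun p => Fin.append_left w z p

omit [DecidableEq X] in
theorem exists_pairOp_eq_appendPair (f : (Fin (m + 2) → X) → k) :
    ∃ g, pairOp u v (Fin.natAdd m 0) (Fin.natAdd m 1) f = appendPair u m g := by
  refine ⟨fun w => ∑ x, ∑ y, v x y * f (Fin.append w ![x, y]), ?_⟩
  ext w
  rw [pairOp_apply, appendPair_apply, mul_comm]
  simp only [update_natAdd_natAdd]

omit [DecidableEq X] in
theorem pairOp_last_appendPair {d : k} (hd : ∑ x, ∑ y, v x y * u x y = d)
    (f : (Fin m → X) → k) :
    pairOp u v (Fin.natAdd m 0) (Fin.natAdd m 1) (appendPair u m f) = d • appendPair u m f := by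
  ext w
  rw [pairOp_apply, Pi.smul_apply, appendPair_apply, ← hd]
  simp only [update_natAdd_natAdd, appendPair_apply, append_comp_castAdd, Fin.append_right,
    smul_eq_mul, Finset.sum_mul, Finset.mul_sum]
  refine Finset.sum_congr rfl fun x _ => Finset.sum_congr rfl fun y _ => ?_
  simp only [Matrix.cons_val_zero, Matrix.cons_val_one]
  ring

end AppendPair

section Reduction

variable (u v K : X → X → k) {m : ℕ}

/-- A word which does not contain the factor `a b` and (if `s` holds) does not begin with `c c`. -/
def IsReduced (a b c : X) (s : Prop) {m : ℕ} (w : Fin m → X) : Prop :=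
  (∀ (p : ℕ) (h : p + 1 < m), ¬(w ⟨p, by omega⟩ = a ∧ w ⟨p + 1, h⟩ = b)) ∧
    (s → ∀ h : 1 < m, ¬(w ⟨0, by omega⟩ = c ∧ w ⟨1, h⟩ = c))

/-- At most the summand for the letters `x₀, y₀` survives. The result is a multiple of `u` in the
places `i, j`, with the letters of `w` elsewhere. -/
theorem pairOp_single {i j : Fin m} (hij : i ≠ j) (w w' : Fin m → X) (x₀ y₀ : X) :
    pairOp u v i j (Pi.single (Function.update (Function.update w i x₀) j y₀) 1) w' =
      u (w' i) (w' j) * (if Function.update (Function.update w' i x₀) j y₀ =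
        Function.update (Function.update w i x₀) j y₀ then v x₀ y₀ else 0) := by
  rw [pairOp_apply]
  congr 1
  have key : ∀ x y, Function.update (Function.update w' i x) j y =
      Function.update (Function.update w i x₀) j y₀ → x = x₀ ∧ y = y₀ := by
    intro x y h
    have h1 := congrFun h i
    have h2 := congrFun h j
    simp only [Function.update_self, Function.update_of_ne hij] at h1 h2
    exact ⟨h1, h2⟩
  rw [Finset.sum_eq_single x₀, Finset.sum_eq_single y₀]
  · rw [Pi.single_apply, mul_ite, mul_one, mul_zero]
  · intro y _ hy
    rw [Pi.single_apply, if_neg fun h => hy (key _ _ h).2, mul_zero]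
  · simp
  · intro x _ hx
    refine Finset.sum_eq_zero fun y _ => ?_
    rw [Pi.single_apply, if_neg fun h => hx (key _ _ h).1, mul_zero]
  · simp

theorem letterOp_pairOp_single {i j : Fin m} (hij : i ≠ j) (w w' : Fin m → X) (x₀ y₀ : X) :
    letterOp K i (pairOp u v i j
      (Pi.single (Function.update (Function.update w i x₀) j y₀) 1)) w' =
      (∑ z, K (w' i) z * u z (w' j)) * (if Function.update (Function.update w' i x₀) j y₀ =
        Function.update (Function.update w i x₀) j y₀ then v x₀ y₀ else 0) := by
  rw [letterOp_apply, Finset.sum_mul]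
  refine Finset.sum_congr rfl fun z _ => ?_
  rw [pairOp_single u v hij, Function.update_self, Function.update_of_ne hij.symm,
    Function.update_idem, mul_assoc]

/-- The weight of a word, with respect to weights `φ` of the letters. -/
def wordWeight (φ : X → ℕ) (w : Fin m → X) : ℕ := ∑ p, (p.val + 1) * φ (w p)

omit [Fintype X] [DecidableEq X] in
theorem wordWeight_lt {φ : X → ℕ} {i j : Fin m} (hij : i ≠ j) {w w' : Fin m → X} {x₀ y₀ : X}
    (h : Function.update (Function.update w' i x₀) j y₀ =
      Function.update (Function.update w i x₀) j y₀)
    (hlt : (i.val + 1) * φ (w' i) + (j.val + 1) * φ (w' j) <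
      (i.val + 1) * φ (w i) + (j.val + 1) * φ (w j)) : wordWeight φ w' < wordWeight φ w := by
  have hj : j ∈ Finset.univ.erase i := Finset.mem_erase.2 ⟨hij.symm, Finset.mem_univ j⟩
  rw [wordWeight, wordWeight, ← Finset.add_sum_erase _ _ (Finset.mem_univ i),
    ← Finset.add_sum_erase _ _ hj, ← Finset.add_sum_erase _ _ (Finset.mem_univ i),
    ← Finset.add_sum_erase _ _ hj]
  have hrest : ∀ p ∈ (Finset.univ.erase i).erase j, (p.val + 1) * φ (w' p) =
      (p.val + 1) * φ (w p) := by
    intro p hp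
    have h1 := congrFun h p
    rw [Function.update_of_ne (Finset.ne_of_mem_erase hp),
      Function.update_of_ne (Finset.ne_of_mem_erase (Finset.mem_of_mem_erase hp)),
      Function.update_of_ne (Finset.ne_of_mem_erase hp),
      Function.update_of_ne (Finset.ne_of_mem_erase (Finset.mem_of_mem_erase hp))] at h1
    rw [h1]
  rw [Finset.sum_congr rfl hrest]
  omega

theorem mem_of_support {S : Submodule k ((Fin m → X) → k)} {f : (Fin m → X) → k}
    (h : ∀ w, f w ≠ 0 → Pi.single w (1 : k) ∈ S) : f ∈ S := by
  have : f = ∑ w, f w • Pi.single w (1 : k) := by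
    ext w
    simp [Finset.sum_apply, Pi.single_apply]
  rw [this]
  refine Submodule.sum_mem _ fun w _ => ?_
  by_cases hw : f w = 0
  · rw [hw, zero_smul]; exact Submodule.zero_mem _
  · exact Submodule.smul_mem _ _ (h w hw)

variable {u v K}

/-- Functions on words are spanned by the reduced words, modulo the images of the operators. -/
theorem eq_top_of_reduced_mem {a b c : X} {s : Prop} {φ : X → ℕ} (hab : u a b ≠ 0)
    (hv : ∃ x y, v x y ≠ 0)
    (hu : ∀ x y, u x y ≠ 0 → (x = a ∧ y = b) ∨ (φ x + φ y = φ a + φ b ∧ φ y < φ b))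
    (hcc : s → ∑ z, K c z * u z c ≠ 0)
    (hK : s → ∀ x y, ∑ z, K x z * u z y ≠ 0 → (x = c ∧ y = c) ∨ φ x + 2 * φ y < 3 * φ c)
    (S : Submodule k ((Fin m → X) → k))
    (hred : ∀ w : Fin m → X, IsReduced a b c s w → Pi.single w (1 : k) ∈ S)
    (hpair : ∀ (p : ℕ) (h : p + 1 < m) f, pairOp u v ⟨p, by omega⟩ ⟨p + 1, h⟩ f ∈ S)
    (hletter : s → ∀ (h : 1 < m) f,
      letterOp K ⟨0, by omega⟩ (pairOp u v ⟨0, by omega⟩ ⟨1, h⟩ f) ∈ S) : S = ⊤ := by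
  obtain ⟨x₀, y₀, hv⟩ := hv
  -- Elimination of a leading term: a vector of `S` with nonzero coefficient at `w`, whose other
  -- words have smaller weight and so lie in `S`, puts `w` itself into `S`.
  have step : ∀ (w : Fin m → X) (c : k) (g : (Fin m → X) → k),
      g ∈ S → g w = c → c ≠ 0 →
      (∀ w', wordWeight φ w' < wordWeight φ w → Pi.single w' (1 : k) ∈ S) →
      (∀ w', g w' ≠ 0 → w' = w ∨ wordWeight φ w' < wordWeight φ w) →
      Pi.single w (1 : k) ∈ S := by
    intro w c g hg hgw hc ih hsupp
    have h1 : g - c • Pi.single w (1 : k) ∈ S := by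
      refine mem_of_support fun w' hw' => ih w' ?_
      rcases eq_or_ne w' w with rfl | hne
      · exact absurd (by simp [hgw]) hw'
      · have : g w' ≠ 0 := by simpa [Pi.single_apply, hne] using hw'
        exact (hsupp w' this).resolve_left hne
    have h2 : Pi.single w (1 : k) = c⁻¹ • (g - (g - c • Pi.single w (1 : k))) := by
      rw [sub_sub_cancel, smul_smul, inv_mul_cancel₀ hc, one_smul]
    rw [h2]
    exact S.smul_mem _ (S.sub_mem hg h1)
  have main : ∀ N, ∀ w : Fin m → X, wordWeight φ w = N → Pi.single w (1 : k) ∈ S := by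
    intro N
    induction N using Nat.strong_induction_on with
    | _ N ih =>
      rintro w rfl
      have ih' : ∀ w', wordWeight φ w' < wordWeight φ w → Pi.single w' (1 : k) ∈ S :=
        fun w' h => ih _ h w' rfl
      by_cases hr : IsReduced a b c s w
      · exact hred w hr
      rw [IsReduced, not_and_or] at hr
      rcases hr with hr | hr
      · push Not at hr
        obtain ⟨p, hp, h1, h2⟩ := hr
        have hij : (⟨p, by omega⟩ : Fin m) ≠ ⟨p + 1, hp⟩ := Fin.ne_of_val_ne (by simp)
        -- The letters `a b` of `w` are first replaced by `x₀ y₀`, on which `v` does not vanish. The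
        -- operator then restores `u`, and with it the leading factor `a b`.
        refine step w _ _ (hpair p hp (Pi.single (Function.update (Function.update w
          ⟨p, by omega⟩ x₀) ⟨p + 1, hp⟩ y₀) 1)) rfl ?_ ih' ?_
        · rw [pairOp_single u v hij, if_pos rfl, h1, h2]
          exact mul_ne_zero hab hv
        · intro w' hw'
          rw [pairOp_single u v hij] at hw'
          have h3 := left_ne_zero_of_mul hw'
          have h4 : Function.update (Function.update w' ⟨p, by omega⟩ x₀) ⟨p + 1, hp⟩ y₀ =
              Function.update (Function.update w ⟨p, by omega⟩ x₀) ⟨p + 1, hp⟩ y₀ := by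
            by_contra h
            rw [if_neg h, mul_zero] at hw'
            exact hw' rfl
          rcases hu _ _ h3 with ⟨h5, h6⟩ | ⟨h5, h6⟩
          · left
            rw [← h1] at h5
            rw [← h2] at h6
            ext q
            by_cases hq : q = ⟨p + 1, hp⟩
            · rw [hq, h6]
            by_cases hq' : q = ⟨p, by omega⟩
            · rw [hq', h5]
            · have := congrFun h4 q
              rwa [Function.update_of_ne hq, Function.update_of_ne hq', Function.update_of_ne hq,
                Function.update_of_ne hq'] at this
          · right
            -- Places `p` and `p + 1` are counted with factors `p + 1` and `p + 2`. With `φ x + φ y`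
            -- fixed, a smaller `φ y` therefore means a smaller weight.
            refine wordWeight_lt hij h4 ?_
            rw [h1, h2]
            dsimp only
            nlinarith
      · push Not at hr
        obtain ⟨hs, hp, h1, h2⟩ := hr
        have hij : (⟨0, by omega⟩ : Fin m) ≠ ⟨1, hp⟩ := Fin.ne_of_val_ne (by simp)
        refine step w _ _ (hletter hs hp (Pi.single (Function.update (Function.update w
          ⟨0, by omega⟩ x₀) ⟨1, hp⟩ y₀) 1)) rfl ?_ ih' ?_
        · rw [letterOp_pairOp_single u v K hij, if_pos rfl, h1, h2]
          exact mul_ne_zero (hcc hs) hv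
        · intro w' hw'
          rw [letterOp_pairOp_single u v K hij] at hw'
          have h3 := left_ne_zero_of_mul hw'
          have h4 : Function.update (Function.update w' ⟨0, by omega⟩ x₀) ⟨1, hp⟩ y₀ =
              Function.update (Function.update w ⟨0, by omega⟩ x₀) ⟨1, hp⟩ y₀ := by
            by_contra h
            rw [if_neg h, mul_zero] at hw'
            exact hw' rfl
          rcases hK hs _ _ h3 with ⟨h5, h6⟩ | h5
          · left
            rw [← h1] at h5
            rw [← h2] at h6
            ext q
            by_cases hq : q = ⟨1, hp⟩
            · rw [hq, h6]
            by_cases hq' : q = ⟨0, by omega⟩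
            · rw [hq', h5]
            · have := congrFun h4 q
              rwa [Function.update_of_ne hq, Function.update_of_ne hq', Function.update_of_ne hq,
                Function.update_of_ne hq'] at this
          · right
            -- The first two places are counted with factors `1` and `2`, and so `hK` compares `φ x
            -- + 2 * φ y` with `3 * φ c`.
            refine wordWeight_lt hij h4 ?_
            rw [h1, h2]
            dsimp only
            omega
  rw [Submodule.eq_top_iff']
  exact fun f => mem_of_support fun w _ => main _ w rfl

end Reduction

end SiteModel

/-! ### Standard filtrations of graded modules of words -/

section WordModules

universe u

variable {k A : Type u} [Field k] [Ring A] [Algebra k A] {X : Type} [Fintype X] [DecidableEq X]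
  {M : Type u} [AddCommGroup M] [Module k M] [Module A M] [IsScalarTower k A M]

/-- The degree of a word, with respect to degrees `dg` of the letters. -/
def wordDegree (dg : X → ℕ) {m : ℕ} (w : Fin m → X) : ℕ := ∑ p, dg (w p)

/-- `Φ` identifies `M` with the functions on words of length `n`, in such a way that `U_p` acts as
`u ⊗ v` on the letters `p, p + 1`, and `e` as `K` on the first letter. -/
structure IsWordModel {n : ℕ} (U : ℕ → A) (e : A) (u v K : X → X → k)
    (Φ : M ≃ₗ[k] ((Fin n → X) → k)) : Prop where
  pair : ∀ (p : ℕ) (h : p + 1 < n) (m : M),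
    Φ (U (p + 1) • m) = pairOp u v ⟨p, by omega⟩ ⟨p + 1, h⟩ (Φ m)
  letter : ∀ (h : 0 < n) (m : M), Φ (e • m) = letterOp K ⟨0, h⟩ (Φ m)

variable {n : ℕ} {U : ℕ → A} {e : A} {u v K : X → X → k} {Φ : M ≃ₗ[k] ((Fin n → X) → k)}
  {d γ δ : k}

omit [DecidableEq X] in
/-- The image of `capProd U d n i` is the space of functions on words of length `n - 2 i`. -/
theorem IsWordModel.exists_capProd_equiv (W : IsWordModel U e u v K Φ)
    (H : IsBlobLike n U e d γ δ) (hd : d ≠ 0) (huv : ∑ x, ∑ y, v x y * u x y = d)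
    {dg : X → ℕ} {κ : ℕ} (hdg : ∀ x y, u x y ≠ 0 → dg x + dg y = κ) (i m : ℕ)
    (hn : m + 2 * i = n) :
    ∃ ι : ((Fin m → X) → k) →ₗ[k] M,
      (∀ (p : ℕ) (h : p + 1 < m) f,
        ι (pairOp u v ⟨p, by omega⟩ ⟨p + 1, h⟩ f) = U (p + 1) • ι f) ∧
      (∀ (h : 0 < m) f, ι (letterOp K ⟨0, h⟩ f) = e • ι f) ∧
      (∀ f, capProd U d n i • ι f = ι f) ∧
      (∀ z : M, ∃ f, capProd U d n i • z = ι f) ∧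
      ∀ r f, (∀ w, wordDegree dg w ≠ r → f w = 0) →
        ∀ w, wordDegree dg w ≠ r + i * κ → Φ (ι f) w = 0 := by
  induction i generalizing m with
  | zero =>
    obtain rfl : m = n := by omega
    refine ⟨Φ.symm, ?_, ?_, ?_, ?_, ?_⟩
    · intro p h f
      rw [LinearEquiv.coe_coe, LinearEquiv.symm_apply_eq, W.pair p h, LinearEquiv.apply_symm_apply]
    · intro h f
      rw [LinearEquiv.coe_coe, LinearEquiv.symm_apply_eq, W.letter h, LinearEquiv.apply_symm_apply]
    · intro f
      rw [capProd_zero, one_smul]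
    · intro z
      exact ⟨Φ z, by rw [capProd_zero, one_smul, LinearEquiv.coe_coe, LinearEquiv.symm_apply_apply]⟩
    · intro r f hf w hw
      rw [LinearEquiv.coe_coe, LinearEquiv.apply_symm_apply]
      exact hf w (by simpa using hw)
  | succ i ih =>
    obtain ⟨ι, h1, h2, h3, h4, h5⟩ := ih (m + 2) (by omega)
    have hcap : capProd U d n (i + 1) = capProd U d n i * (d⁻¹ • U (m + 1)) := by
      rw [capProd_succ' U d (by omega)]
      congr 3
      omega
    have hlast : ∀ f, ι (pairOp u v (Fin.natAdd m 0) (Fin.natAdd m 1) f) = U (m + 1) • ι f :=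
      fun f => h1 m (by omega) f
    refine ⟨ι.comp (appendPair u m), ?_, ?_, ?_, ?_, ?_⟩
    · intro p h f
      rw [LinearMap.comp_apply, ← pairOp_appendPair]
      exact h1 p (by omega) _
    · intro h f
      rw [LinearMap.comp_apply, ← letterOp_appendPair]
      exact h2 (by omega) _
    · intro f
      rw [LinearMap.comp_apply, hcap, mul_smul, smul_assoc, ← hlast,
        pairOp_last_appendPair u v huv, map_smul, smul_smul, inv_mul_cancel₀ hd, one_smul, h3]
    · intro z
      obtain ⟨f, hf⟩ := h4 z
      obtain ⟨g, hg⟩ := exists_pairOp_eq_appendPair u v f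
      refine ⟨d⁻¹ • g, ?_⟩
      -- By commutation `U (m + 1)` may act last, so that the result ends in the cup `u` and lies in
      -- the image of `appendPair`.
      have hcomm : Commute (U (m + 1)) (capProd U d n i) :=
        H.commute_capProd (by omega) (by omega) le_rfl
      rw [hcap, mul_smul_comm, ← hcomm.eq, smul_assoc, mul_smul, hf, ← hlast, hg, map_smul,
        LinearMap.comp_apply]
    · intro r f hf w hw
      rw [LinearMap.comp_apply]
      refine h5 (r + κ) _ ?_ w (by rwa [add_assoc, add_comm κ, ← Nat.succ_mul])
      intro w' hw'
      rw [appendPair_apply]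
      by_contra hne
      refine hw' ?_
      have e1 := left_ne_zero_of_mul hne
      have e2 := hdg _ _ (right_ne_zero_of_mul hne)
      have e3 : wordDegree dg (w' ∘ Fin.castAdd 2) = r := by
        by_contra h
        exact e1 (hf _ h)
      rw [← e3, ← e2, wordDegree, wordDegree, Fin.sum_univ_add, Fin.sum_univ_two]
      rfl

section Grading

variable {D : ℕ} {dg : X → ℕ} {N : Fin D → Submodule A M}
  (hN : ∀ r m, m ∈ N r ↔ ∀ w, wordDegree dg w ≠ r → Φ m w = 0)
  (hdeg : ∀ w : Fin n → X, wordDegree dg w < D)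
include hN hdeg

omit [Algebra k A] [Fintype X] [DecidableEq X] [IsScalarTower k A M] in
/-- The projections to the homogeneous components are homomorphisms. -/
theorem exists_component_map (r : Fin D) :
    ∃ P : M →ₗ[A] N r, (∀ m : N r, P m = m) ∧ ∀ s ≠ r, ∀ m ∈ N s, P m = 0 := by
  let P' : Fin D → M →ₗ[k] M := fun r => Φ.symm.toLinearMap ∘ₗ
    (LinearMap.pi fun w => if wordDegree dg w = r then LinearMap.proj w else 0) ∘ₗ Φ.toLinearMap
  have hP : ∀ r m w, Φ (P' r m) w = if wordDegree dg w = r then Φ m w else 0 := by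
    intro r m w
    change Φ (Φ.symm _) w = _
    rw [LinearEquiv.apply_symm_apply, LinearMap.comp_apply, LinearMap.pi_apply]
    split_ifs <;> rfl
  have hmem : ∀ r m, P' r m ∈ N r := fun r m => (hN _ _).2 fun w hw => by rw [hP, if_neg hw]
  have hid : ∀ r, ∀ m ∈ N r, P' r m = m := fun r m hm => by
    refine Φ.injective (funext fun w => ?_)
    rw [hP]
    split_ifs with h
    · rfl
    · exact ((hN _ _).1 hm w h).symm
  have hzero : ∀ r s, s ≠ r → ∀ m ∈ N s, P' r m = 0 := fun r s hs m hm => by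
    refine Φ.injective (funext fun w => ?_)
    rw [hP, map_zero]
    split_ifs with h
    · exact (hN _ _).1 hm w fun h' => hs (Fin.ext (h'.symm.trans h))
    · rfl
  have hsum : ∀ m, m = ∑ r, P' r m := fun m => by
    refine Φ.injective (funext fun w => ?_)
    rw [map_sum, Finset.sum_apply, Finset.sum_eq_single ⟨wordDegree dg w, hdeg w⟩]
    · rw [hP, if_pos rfl]
    · intro s _ hs
      rw [hP, if_neg fun h => hs (Fin.ext h.symm)]
    · simp
  have hsmul : ∀ (a : A) m, P' r (a • m) = a • P' r m := fun a m => by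
    conv_lhs => rw [hsum m]
    rw [Finset.smul_sum, map_sum, Finset.sum_eq_single r]
    · exact hid r _ ((N r).smul_mem a (hmem r m))
    · intro s _ hs
      exact hzero r s hs _ ((N s).smul_mem a (hmem s m))
    · simp
  refine ⟨{ toFun := fun m => ⟨P' r m, hmem r m⟩, map_add' := fun a b => ?_,
            map_smul' := fun a b => ?_ }, ?_, ?_⟩
  · exact Subtype.ext (map_add _ _ _)
  · exact Subtype.ext (hsmul a b)
  · exact fun m => Subtype.ext (hid r m.1 m.2)
  · exact fun s hs m hm => Subtype.ext (hzero r s hs m hm)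

omit [DecidableEq X] in
-- Every vector is the sum of its homogeneous parts, so the direct sum of the `N r` maps onto `M`.
theorem card_pow_le_sum_finrank [Module.Finite k M] :
    Fintype.card X ^ n ≤ ∑ r, Module.finrank k (N r) := by
  have h1 : Module.finrank k M = Fintype.card X ^ n := by
    rw [Φ.finrank_eq, Module.finrank_fintype_fun_eq_card, Fintype.card_fun, Fintype.card_fin]
  rw [← h1]
  have hfinN : ∀ r, Module.Finite k (N r) := fun r =>
    inferInstanceAs (Module.Finite k ((N r).restrictScalars k))
  have h2 : Module.finrank k (∀ r, N r) = ∑ r, Module.finrank k (N r) :=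
    Module.finrank_pi_fintype k
  rw [← h2]
  let F : (∀ r, N r) →ₗ[k] M := ∑ r, ((N r).subtype.restrictScalars k : N r →ₗ[k] M) ∘ₗ
    LinearMap.proj r
  refine LinearMap.finrank_le_finrank_of_surjective (f := F) fun m => ?_
  have hmem : ∀ r : Fin D, Φ.symm (fun w => if wordDegree dg w = r then Φ m w else 0) ∈ N r :=
    fun r => (hN _ _).2 fun w hw => by rw [LinearEquiv.apply_symm_apply, if_neg hw]
  refine ⟨fun r => ⟨_, hmem r⟩, Φ.injective (funext fun w => ?_)⟩
  rw [LinearMap.sum_apply, map_sum, Finset.sum_apply,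
    Finset.sum_eq_single ⟨wordDegree dg w, hdeg w⟩]
  · change Φ (Φ.symm _) w = _
    rw [LinearEquiv.apply_symm_apply, if_pos rfl]
  · intro s _ hs
    change Φ (Φ.symm _) w = _
    rw [LinearEquiv.apply_symm_apply, if_neg fun h => hs (Fin.ext h.symm)]
  · simp

end Grading

open Classical in
/-- The number of reduced words of length `m`. -/
noncomputable def reducedCount (a b c : X) (s : Prop) (m : ℕ) : ℕ :=
  (Finset.univ.filter fun w : Fin m → X => IsReduced a b c s w).card

/-- If the numbers of reduced words and the bounds for the dimensions of standard modules match,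
then all graded pieces of the space of functions on words have standard filtrations. -/
theorem IsWordModel.hasFiltration (W : IsWordModel U e u v K Φ) (H : IsBlobLike n U e d γ δ)
    (hd : d ≠ 0) (huv : ∑ x, ∑ y, v x y * u x y = d)
    {a b c : X} {s : Prop} {φ : X → ℕ} (hab : u a b ≠ 0)
    (hu : ∀ x y, u x y ≠ 0 → (x = a ∧ y = b) ∨ (φ x + φ y = φ a + φ b ∧ φ y < φ b))
    (hcc : s → ∑ z, K c z * u z c ≠ 0)
    (hK : s → ∀ x y, ∑ z, K x z * u z y ≠ 0 → (x = c ∧ y = c) ∨ φ x + 2 * φ y < 3 * φ c)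
    {ι : Type} {e' g : ι → A} (bound : ℕ → ℕ) (lay : ι → ℕ)
    (hlay : ∀ j, e' j = capProd U d n (lay j + 1))
    (hge : ∀ j, ∃ a, g j = capProd U d n (lay j) * a)
    (hD : ∀ j, Module.Finite k (StandardModule A (e' j) (g j)) ∧
      Module.finrank k (StandardModule A (e' j) (g j)) ≤ bound (lay j))
    (hg : ∀ i ≤ n / 2, ∃ s : Finset ι, (∀ j ∈ s, lay j = i) ∧ ∑ j ∈ s, g j = capProd U d n i)
    (hdim : ∑ i ∈ Finset.range (n / 2 + 1), reducedCount a b c s (n - 2 * i) * bound i ≤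
      Fintype.card X ^ n)
    {D : ℕ} {dg : X → ℕ} {κ : ℕ} (hdg : ∀ x y, u x y ≠ 0 → dg x + dg y = κ)
    {N : Fin D → Submodule A M}
    (hN : ∀ r m, m ∈ N r ↔ ∀ w, wordDegree dg w ≠ r → Φ m w = 0)
    (hdeg : ∀ w : Fin n → X, wordDegree dg w < D) (r : Fin D) :
    HasFiltration A (fun j => StandardModule A (e' j) (g j)) (N r) := by
  classical
  have hfin : ∀ i, Module.Finite k (StandardModule A (e' i) (g i)) := fun j => (hD j).1
  have hfinM : Module.Finite k M := Module.Finite.equiv Φ.symm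
  have hfinN : ∀ r, Module.Finite k (N r) := fun r =>
    inferInstanceAs (Module.Finite k ((N r).restrictScalars k))
  -- In `N r` the layer `i` is generated by reduced words of length `n - 2 * i`. Each of the `i`
  -- cups that complete such a word to length `n` contributes the degree `κ`, whence the condition
  -- on `wordDegree`.
  refine hasFiltration_of_layers (k := k) (fun r => N r) (capProd U d n) (n / 2 + 1)
    (capProd_zero U d n) (capProd_eq_zero U d (by omega)) bound
    (fun i => reducedCount a b c s (n - 2 * i))
    (fun r i => (Finset.univ.filter fun w : Fin (n - 2 * i) → X =>
      IsReduced a b c s w ∧ wordDegree dg w + i * κ = r).card)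
    ?_ lay hlay hge (fun j => (hD j).2) (fun i hi => hg i (by omega)) ?_ ?_
    (hdim.trans (card_pow_le_sum_finrank hN hdeg)) r
  · intro i hi
    by_cases h : 2 * i + 2 ≤ n
    · exact ⟨_, capProd_succ' U d h⟩
    · exact ⟨0, by rw [mul_zero, capProd_eq_zero U d (by omega)]⟩
  · intro r i hi
    obtain ⟨P, hP, hP'⟩ := exists_component_map hN hdeg r
    obtain ⟨ι, h1, h2, h3, h4, h5⟩ :=
      W.exists_capProd_equiv H hd huv hdg i (n - 2 * i) (by omega)
    let B : Finset (N r) := (Finset.univ.filter fun w : Fin (n - 2 * i) → X =>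
      IsReduced a b c s w ∧ wordDegree dg w + i * κ = r).image fun w => P (ι (Pi.single w 1))
    refine ⟨B, Finset.card_image_le, ?_⟩
    set S₁ : Submodule k (N r) := Submodule.span k (B : Set (N r)) ⊔
        (Submodule.span A (Set.range fun v : N r => capProd U d n (i + 1) • v)).restrictScalars k
      with hS₁
    have hJ : ∀ y ∈ Submodule.span A (Set.range fun v : N r => capProd U d n (i + 1) • v),
        y ∈ S₁ := fun y hy => Submodule.mem_sup_right hy
    have hpair : ∀ (p : ℕ) (h : p + 1 < n - 2 * i) f,
        P (ι (pairOp u v ⟨p, by omega⟩ ⟨p + 1, h⟩ f)) ∈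
          Submodule.span A (Set.range fun v : N r => capProd U d n (i + 1) • v) := by
      intro p h f
      rw [h1 p h, ← h3, smul_smul, map_smul]
      exact smul_mem_span_smul _ (H.U_mul_capProd_mem hd (by omega) (by omega)) _
    -- By `U_mul_capProd_mem` the image of each `U (p + 1)` in the space of shorter words goes to `A
    -- e_{i+1} N`, and then so does that of `e * U 1`. Reduction thus leaves only the reduced words,
    -- which are in `B` or of another degree.
    have htop : S₁.comap ((P.restrictScalars k).comp ι) = ⊤ := by
      refine eq_top_of_reduced_mem (u := u) (v := v) (K := K) (φ := φ) hab ?_ hu hcc hK _ ?_ ?_ ?_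
      · by_contra! h
        refine hd (huv.symm.trans (Finset.sum_eq_zero fun x _ => Finset.sum_eq_zero fun y _ => ?_))
        rw [h, zero_mul]
      · intro w hw
        rw [Submodule.mem_comap]
        change P (ι _) ∈ _
        by_cases hr : wordDegree dg w + i * κ = r
        · exact Submodule.mem_sup_left (Submodule.subset_span (Finset.mem_coe.2
            (Finset.mem_image.2 ⟨w, Finset.mem_filter.2 ⟨Finset.mem_univ _, hw, hr⟩, rfl⟩)))
        · have h6 := h5 (wordDegree dg w) (Pi.single w 1) (fun w' hw' =>
            Pi.single_eq_of_ne (fun h => hw' (by rw [h])) _)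
          have h7 : P (ι (Pi.single w 1)) = 0 := by
            -- No word of length `n` has degree `D` or more, so a vector of such a degree is zero.
            by_cases hlt : wordDegree dg w + i * κ < D
            · exact hP' ⟨_, hlt⟩ (fun h => hr (congrArg Fin.val h)) _ ((hN _ _).2 h6)
            · have : ι (Pi.single w 1) = 0 := Φ.injective (funext fun w' => by
                rw [map_zero]
                exact h6 w' (fun h => hlt (h ▸ hdeg w')))
              rw [this, map_zero]
          rw [h7]
          exact Submodule.zero_mem _
      · intro p h f
        exact hJ _ (hpair p h f)
      · intro _ h f
        rw [Submodule.mem_comap]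
        change P (ι _) ∈ _
        rw [h2 (by omega), map_smul]
        exact hJ _ (Submodule.smul_mem _ _ (hpair 0 h f))
    intro m
    obtain ⟨f, hf⟩ := h4 m
    have h8 : capProd U d n i • m = P (ι f) := by
      rw [← hf, map_smul, hP]
    rw [h8]
    exact (Submodule.eq_top_iff'.1 htop f)
  · intro i hi
    rw [reducedCount, Fin.sum_univ_eq_sum_range (fun r => (Finset.univ.filter
      fun w : Fin (n - 2 * i) → X => IsReduced a b c s w ∧ wordDegree dg w + i * κ = r).card) D]
    rw [← Finset.card_biUnion]
    · refine Finset.card_le_card fun w hw => ?_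
      simp only [Finset.mem_biUnion, Finset.mem_filter] at hw ⊢
      obtain ⟨_, _, h⟩ := hw
      exact ⟨Finset.mem_univ _, h.2.1⟩
    · intro r _ r' _ hne
      refine Finset.disjoint_left.2 fun w hw hw' => hne ?_
      rw [← (Finset.mem_filter.1 hw).2.2, ← (Finset.mem_filter.1 hw').2.2]

end WordModules

/-! ### Binomial coefficients and the resulting dimension bounds -/

section Binomial

/-- The binomial coefficients, for all integers in the second argument. -/
def intChoose (c : ℕ) (z : ℤ) : ℤ := if z < 0 then 0 else c.choose z.toNat

theorem intChoose_natCast (c i : ℕ) : intChoose c i = c.choose i := by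
  simp [intChoose]

theorem intChoose_of_neg (c : ℕ) {z : ℤ} (h : z < 0) : intChoose c z = 0 := if_pos h

theorem intChoose_nonneg (c : ℕ) (z : ℤ) : 0 ≤ intChoose c z := by
  unfold intChoose
  split_ifs <;> positivity

theorem intChoose_zero (z : ℤ) : intChoose 0 z = if z = 0 then 1 else 0 := by
  unfold intChoose
  split_ifs with h1 h2 h2
  · omega
  · rfl
  · subst h2; rfl
  · rw [Nat.choose_eq_zero_of_lt (by omega), Nat.cast_zero]

theorem intChoose_succ (c : ℕ) (z : ℤ) :
    intChoose (c + 1) z = intChoose c z + intChoose c (z - 1) := by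
  rcases lt_trichotomy z 0 with h | rfl | h
  · rw [intChoose_of_neg _ h, intChoose_of_neg _ h, intChoose_of_neg _ (by omega), add_zero]
  · simp [intChoose]
  · obtain ⟨i, rfl⟩ : ∃ i : ℕ, z = i + 1 := ⟨(z - 1).toNat, by omega⟩
    rw [add_sub_cancel_right, ← Nat.cast_succ, intChoose_natCast, intChoose_natCast,
      intChoose_natCast, Nat.choose_succ_succ, Nat.cast_add, add_comm]

end Binomial

section DimensionBounds

universe u

variable {k A : Type u} [Field k] [Ring A] [Algebra k A] {n : ℕ} {U : ℕ → A} {e : A} {d γ δ : k}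

/-- The dimension of a standard module of the blob algebra is at most a binomial coefficient. -/
theorem IsBlobLike.finrank_standardModule_le_choose (H : IsBlobLike n U e d γ δ) (hd : d ≠ 0)
    {m₀ i : ℕ} (hn : m₀ + 2 * i = n) (he0 : n = 0 → e = 0) {f : A} {κ : k}
    (hf : 1 ≤ m₀ → e * f = κ • f) :
    Module.Finite k (StandardModule A (capProd U d n (i + 1)) (capProd U d n i * f)) ∧
      Module.finrank k (StandardModule A (capProd U d n (i + 1)) (capProd U d n i * f)) ≤
        n.choose i := by
  have := H.finrank_standardModule_le hd hn he0 hf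
    -- Each summand obeys Pascal's rule in `(t, c)`. The number of summands shrinks as `c` grows,
    -- and for `c = m₀ + 2 * t` only `j = 0` is left, a single binomial coefficient.
    (fun t c => ∑ j ∈ Finset.range (m₀ + 2 * t - c + 1), intChoose c ((t : ℤ) - j)) ?_ (.inl ?_)
    ?_ ?_
  · refine ⟨this.1, ?_⟩
    have h := this.2
    rw [← hn, Nat.sub_self, Finset.sum_range_one, Nat.cast_zero, sub_zero, intChoose_natCast,
      hn] at h
    exact_mod_cast h
  · intro c _
    rw [Finset.sum_range_succ']
    have h1 : intChoose c (((0 : ℕ) : ℤ) - ((0 : ℕ) : ℤ)) = 1 := by simp [intChoose]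
    rw [h1, le_add_iff_nonneg_left]
    exact Finset.sum_nonneg fun j _ => intChoose_nonneg _ _
  · have key : ∀ t : ℕ, ∑ j ∈ Finset.range (m₀ + 2 * t - 0 + 1), intChoose 0 ((t : ℤ) - j) = 1 := by
      intro t
      rw [Finset.sum_eq_single t]
      · simp [intChoose_zero]
      · intro j _ hj
        rw [intChoose_zero, if_neg (by omega)]
      · intro h
        exact absurd (Finset.mem_range.2 (by omega)) h
    intro t
    rw [key, key]
  · intro t c hc
    obtain ⟨a, ha⟩ := Nat.exists_eq_add_of_le hc
    rw [show m₀ + 2 * (t + 1) - c + 1 = a + 1 + 1 + 1 by omega,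
      show m₀ + 2 * t - c + 1 = a + 1 by omega,
      show m₀ + 2 * (t + 1) - (c + 1) + 1 = a + 1 + 1 by omega]
    simp only [intChoose_succ, Finset.sum_add_distrib]
    rw [Finset.sum_range_succ _ (a + 1 + 1),
      Finset.sum_range_succ (fun j => intChoose c (((t + 1 : ℕ) : ℤ) - j - 1)) (a + 1)]
    have h1 : ∀ j : ℕ, ((t + 1 : ℕ) : ℤ) - j - 1 = t - j := fun j => by push_cast; ring
    simp only [h1]
    rw [show ((t + 1 : ℕ) : ℤ) - ((a + 1 + 1 : ℕ) : ℤ) = t - ((a + 1 : ℕ) : ℤ) by push_cast; ring]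
    linarith
  · intro t
    rw [show m₀ + 2 * (t + 1) - (m₀ + 2 * t + 1) + 1 = 2 by omega,
      show m₀ + 2 * (t + 1) - (m₀ + 2 * t + 2) + 1 = 1 by omega, Finset.sum_range_succ,
      Finset.sum_range_one, Finset.sum_range_one, Nat.cast_zero, sub_zero, Nat.cast_one,
      ← intChoose_succ]

/-- The number of standard tableaux with rows of lengths `n - i` and `i`. -/
def ballot (n : ℕ) (i : ℕ) : ℤ := intChoose n i - intChoose n (i - 1)

theorem ballot_zero (n : ℕ) : ballot n 0 = 1 := by
  simp [ballot, intChoose]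

theorem ballot_succ_succ (n i : ℕ) : ballot (n + 1) (i + 1) = ballot n (i + 1) + ballot n i := by
  rw [ballot, ballot, ballot, intChoose_succ, intChoose_succ, Nat.cast_succ, add_sub_cancel_right]
  ring

theorem ballot_succ (n i : ℕ) : ballot n (i + 1) = n.choose (i + 1) - n.choose i := by
  rw [ballot, Nat.cast_succ, add_sub_cancel_right, ← Nat.cast_succ, intChoose_natCast,
    intChoose_natCast]

theorem ballot_nonneg {n i : ℕ} (h : 2 * i ≤ n) : 0 ≤ ballot n i := by
  cases i with
  | zero => rw [ballot_zero]; exact zero_le_one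
  | succ i =>
    rw [ballot_succ, sub_nonneg, Nat.cast_le]
    exact Nat.choose_le_succ_of_lt_half_left (by omega)

/-- The dimension bound for standard modules of the Temperley–Lieb algebra. -/
theorem IsBlobLike.finrank_standardModule_le_ballot (H : IsBlobLike n U 0 d γ δ) (hd : d ≠ 0)
    {m₀ i : ℕ} (hn : m₀ + 2 * i = n) (f : A) :
    Module.Finite k (StandardModule A (capProd U d n (i + 1)) (capProd U d n i * f)) ∧
      Module.finrank k (StandardModule A (capProd U d n (i + 1)) (capProd U d n i * f)) ≤
        ballot n i := by
  have hstep : ∀ t c : ℕ,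
      intChoose (c + 1) (t + 1 : ℕ) - intChoose (c + 1) ((c + 1 : ℕ) - m₀ - (t + 1 : ℕ) - 1) =
        intChoose c (t + 1 : ℕ) - intChoose c (c - m₀ - (t + 1 : ℕ) - 1) +
          (intChoose c t - intChoose c (c - m₀ - t - 1)) := by
    intro t c
    rw [intChoose_succ, intChoose_succ]
    push_cast
    rw [show (t : ℤ) + 1 - 1 = t by ring, show (c : ℤ) + 1 - m₀ - (t + 1) - 1 = c - m₀ - t - 1 by ring,
      show (c : ℤ) - m₀ - (t + 1) - 1 = c - m₀ - t - 1 - 1 by ring]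
    ring
  have := H.finrank_standardModule_le hd hn (fun _ => rfl) (f := f) (κ := 0)
    (fun _ => by rw [zero_mul, zero_smul])
    -- This is a reflection formula: both terms obey Pascal's rule. The difference vanishes at `c =
    -- m₀ + 2 * t + 1`, which gives `h₃`, and equals the ballot number at `c = n`, `t = i`.
    (fun t c => intChoose c t - intChoose c ((c : ℤ) - m₀ - t - 1)) ?_ (.inr ⟨rfl, ?_⟩) ?_ ?_
  · refine ⟨this.1, this.2.trans (le_of_eq ?_)⟩
    rw [ballot]
    congr 2
    omega
  · intro c hc
    rw [intChoose_natCast, Nat.choose_zero_right, intChoose_of_neg _ (by omega)]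
    simp
  · intro t
    rw [intChoose_of_neg _ (show ((0 : ℕ) : ℤ) - m₀ - (t + 1 : ℕ) - 1 < 0 by omega), sub_zero]
    exact intChoose_nonneg _ _
  · intro t c _
    exact (hstep t c).ge
  · intro t
    refine le_trans (le_of_eq ?_) (hstep t (m₀ + 2 * t + 1)).ge
    rw [show ((m₀ + 2 * t + 1 : ℕ) : ℤ) - m₀ - t - 1 = t by push_cast; ring, sub_self, add_zero]

end DimensionBounds

/-! ### Summation identities for ballot numbers and binomial coefficients -/

section Counting

/-- The identity behind the decomposition of the `n`-th tensor power of a vector space of dimension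
`d` by the blocks of the ballot numbers. -/
theorem sum_ballot {d : ℤ} {t : ℕ → ℤ} (h0 : t 0 = 0) (h1 : t 1 = 1)
    (ht : ∀ j, t (j + 2) + t j = d * t (j + 1)) (n : ℕ) :
    ∑ i ∈ Finset.range (n / 2 + 1), ballot n i * t (n + 1 - 2 * i) = d ^ n := by
  -- The recursions of `t` and of `ballot` turn `d` times a partial sum for `n` into the partial sum
  -- for `n + 1`, up to one boundary term.
  have key : ∀ n L, 2 * L ≤ n → d * ∑ i ∈ Finset.range (L + 1), ballot n i * t (n + 1 - 2 * i) =
      ∑ i ∈ Finset.range (L + 1), ballot (n + 1) i * t (n + 2 - 2 * i) +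
        ballot n L * t (n - 2 * L) := by
    intro n L hL
    induction L with
    | zero =>
      simp only [zero_add, Finset.sum_range_one, ballot_zero, one_mul, mul_zero, Nat.sub_zero]
      exact (ht n).symm
    | succ L ih =>
      rw [Finset.sum_range_succ, mul_add, ih (by omega), Finset.sum_range_succ _ (L + 1),
        ballot_succ_succ, show n + 1 - 2 * (L + 1) = n - 2 * (L + 1) + 1 by omega,
        show n + 2 - 2 * (L + 1) = n - 2 * (L + 1) + 2 by omega,
        show n - 2 * L = n - 2 * (L + 1) + 2 by omega]
      linear_combination - ballot n (L + 1) * ht (n - 2 * (L + 1))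
  induction n with
  | zero => simp [ballot_zero, h1]
  | succ n ih =>
    rw [pow_succ', ← ih, key n (n / 2) (by omega)]
    rcases Nat.even_or_odd' n with ⟨m, rfl | rfl⟩
    · rw [show (2 * m + 1) / 2 = m by omega, show 2 * m / 2 = m by omega, Nat.sub_self, h0, mul_zero,
        add_zero]
    -- For odd `n` the boundary term is the additional summand `i = m + 1`, because `ballot (2 * m +
    -- 1) (m + 1) = 0`. For even `n` it was killed by `t 0 = 0`.
    · rw [show (2 * m + 1 + 1) / 2 = m + 1 by omega, show (2 * m + 1) / 2 = m by omega,
        Finset.sum_range_succ _ (m + 1), ballot_succ_succ, ballot_succ,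
        show 2 * m + 1 - 2 * m = 1 by omega,
        show 2 * m + 1 + 1 + 1 - 2 * (m + 1) = 1 by omega,
        Nat.choose_symm_half]
      ring

/-- Summation by parts: `w` is a difference of values of `t` and `ballot` a difference of binomial
coefficients, so the sum becomes that of `sum_ballot`. The value `w 0 = 1` takes care of the middle
term for even `n`. -/
theorem sum_choose {d : ℤ} {t : ℕ → ℤ} (h0 : t 0 = 0) (h1 : t 1 = 1)
    (ht : ∀ j, t (j + 2) + t j = d * t (j + 1)) {w : ℕ → ℤ} (hw0 : w 0 = 1)
    (hw : ∀ m, w (m + 1) = t (m + 2) - t m) (n : ℕ) :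
    ∑ i ∈ Finset.range (n / 2 + 1), (n.choose i : ℤ) * w (n - 2 * i) = d ^ n := by
  have key : ∀ L, 2 * L + 1 ≤ n →
      ∑ i ∈ Finset.range (L + 1), (n.choose i : ℤ) * w (n - 2 * i) =
        ∑ i ∈ Finset.range (L + 1), ballot n i * t (n + 1 - 2 * i) -
          n.choose L * t (n - 1 - 2 * L) := by
    intro L hL
    induction L with
    | zero =>
      simp only [zero_add, Finset.sum_range_one, ballot_zero, mul_zero, Nat.sub_zero]
      obtain ⟨n, rfl⟩ := Nat.exists_eq_add_of_le' hL
      rw [show n + (2 * 0 + 1) = n + 1 by omega, hw, Nat.choose_zero_right]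
      simp
    | succ L ih =>
      rw [Finset.sum_range_succ, ih (by omega), Finset.sum_range_succ _ (L + 1), ballot_succ,
        show n - 2 * (L + 1) = n - 1 - 2 * (L + 1) + 1 by omega, hw,
        show n - 1 - 2 * L = n - 1 - 2 * (L + 1) + 2 by omega,
        show n + 1 - 2 * (L + 1) = n - 1 - 2 * (L + 1) + 2 by omega]
      ring
  rw [← sum_ballot h0 h1 ht n]
  rcases Nat.even_or_odd' n with ⟨m, rfl | rfl⟩
  · rw [show 2 * m / 2 = m by omega]
    cases m with
    | zero => simp [hw0, h1, ballot_zero]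
    | succ m =>
      rw [Finset.sum_range_succ, key m (by omega), Finset.sum_range_succ _ (m + 1), ballot_succ,
        show 2 * (m + 1) - 1 - 2 * m = 1 by omega, Nat.sub_self,
        show 2 * (m + 1) + 1 - 2 * (m + 1) = 1 by omega, hw0, h1]
      ring
  · rw [show (2 * m + 1) / 2 = m by omega, key m le_rfl,
      show 2 * m + 1 - 1 - 2 * m = 0 by omega, h0, mul_zero, sub_zero]

end Counting

/-! ### Counting reduced words -/

section ReducedWords

variable {X : Type} [Fintype X] [DecidableEq X] {a b c : X}

omit [Fintype X] [DecidableEq X] in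
theorem isReduced_cons_iff {m : ℕ} (x : X) (w : Fin m → X) :
    IsReduced a b c False (Fin.cons x w : Fin (m + 1) → X) ↔
      (∀ h : 0 < m, ¬(x = a ∧ w ⟨0, h⟩ = b)) ∧ IsReduced a b c False w := by
  constructor
  · rintro ⟨h, -⟩
    refine ⟨fun hm => ?_, fun p hp => ?_, fun h => h.elim⟩
    · exact h 0 (by omega)
    · exact h (p + 1) (by omega)
  · rintro ⟨h0, h, -⟩
    refine ⟨fun p hp => ?_, fun h => h.elim⟩
    cases p with
    | zero => exact h0 (by omega)
    | succ p => exact h p (by omega)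

theorem card_filter_cons_cons {m : ℕ} (P : (Fin (m + 2) → X) → Prop) [DecidablePred P] (x y : X) :
    (Finset.univ.filter fun w : Fin (m + 2) → X => P w ∧ w 0 = x ∧ w 1 = y).card =
      (Finset.univ.filter fun w : Fin m → X => P (Fin.cons x (Fin.cons y w : Fin (m + 1) → X))).card := by
  symm
  refine Finset.card_bij (fun w _ => Fin.cons x (Fin.cons y w : Fin (m + 1) → X)) ?_ ?_ ?_
  · intro w hw
    exact Finset.mem_filter.2 ⟨Finset.mem_univ _, (Finset.mem_filter.1 hw).2, rfl, rfl⟩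
  · intro w _ w' _ h
    exact Fin.cons_right_injective _ (Fin.cons_right_injective _ h)
  · intro w hw
    obtain ⟨h1, h2, h3⟩ := (Finset.mem_filter.1 hw).2
    have h4 : (Fin.cons x (Fin.cons y (Fin.tail (Fin.tail w)) : Fin (m + 1) → X)) = w := by
      rw [← h2, ← h3, show w 1 = Fin.tail w 0 from rfl, Fin.cons_self_tail, Fin.cons_self_tail]
    exact ⟨_, Finset.mem_filter.2 ⟨Finset.mem_univ _, h4.symm ▸ h1⟩, h4⟩

omit [DecidableEq X] in
theorem reducedCount_zero (a b c : X) (s : Prop) : reducedCount a b c s 0 = 1 := by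
  classical
  rw [reducedCount, Finset.filter_true_of_mem]
  · simp
  · exact fun w _ => ⟨fun p h => absurd h (by omega), fun _ h => absurd h (by omega)⟩

omit [DecidableEq X] in
theorem reducedCount_one (a b c : X) (s : Prop) : reducedCount a b c s 1 = Fintype.card X := by
  classical
  rw [reducedCount, Finset.filter_true_of_mem]
  · simp
  · exact fun w _ => ⟨fun p h => absurd h (by omega), fun _ h => absurd h (by omega)⟩

/-- A letter put in front of a reduced word of length `m + 1` gives a reduced word or a word
beginning with `a b`. Since `a ≠ b`, the words of the second kind are `a b` followed by an arbitrary
reduced word of length `m`. -/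
theorem reducedCount_add_two (hab : a ≠ b) (m : ℕ) :
    reducedCount a b c False (m + 2) + reducedCount a b c False m =
      Fintype.card X * reducedCount a b c False (m + 1) := by
  classical
  have h1 : Fintype.card X * reducedCount a b c False (m + 1) = (Finset.univ.filter
      fun w : Fin (m + 2) → X => IsReduced a b c False (Fin.tail w)).card := by
    rw [reducedCount, ← Finset.card_univ, ← Finset.card_product]
    refine Finset.card_bij (fun p _ => Fin.cons p.1 p.2) ?_ ?_ ?_
    · intro p hp
      refine Finset.mem_filter.2 ⟨Finset.mem_univ _, ?_⟩
      rw [Fin.tail_cons]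
      exact (Finset.mem_filter.1 (Finset.mem_product.1 hp).2).2
    · intro p _ p' _ h
      obtain ⟨h1, h2⟩ := Fin.cons_inj.1 h
      exact Prod.ext h1 h2
    · intro w hw
      exact ⟨(w 0, Fin.tail w), Finset.mem_product.2 ⟨Finset.mem_univ _, Finset.mem_filter.2
        ⟨Finset.mem_univ _, (Finset.mem_filter.1 hw).2⟩⟩, Fin.cons_self_tail w⟩
  have h2 : reducedCount a b c False m = (Finset.univ.filter fun w : Fin (m + 2) → X =>
      IsReduced a b c False (Fin.tail w) ∧ w 0 = a ∧ w 1 = b).card := by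
    rw [card_filter_cons_cons, reducedCount]
    congr 1
    ext w
    simp only [Finset.mem_filter, Finset.mem_univ, true_and]
    rw [Fin.tail_cons, isReduced_cons_iff]
    exact ⟨fun h => ⟨fun _ h' => hab h'.1.symm, h⟩, fun h => h.2⟩
  rw [h1, h2, reducedCount, ← Finset.card_union_of_disjoint]
  · congr 1
    ext w
    simp only [Finset.mem_union, Finset.mem_filter, Finset.mem_univ, true_and]
    obtain ⟨x, w, rfl⟩ : ∃ x w', w = Fin.cons x w' := ⟨w 0, Fin.tail w, (Fin.cons_self_tail w).symm⟩
    rw [isReduced_cons_iff, Fin.tail_cons]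
    have h3 : (Fin.cons x w : Fin (m + 2) → X) 0 = x := rfl
    have h4 : (Fin.cons x w : Fin (m + 2) → X) 1 = w ⟨0, by omega⟩ := rfl
    rw [h3, h4]
    constructor
    · rintro (h | h)
      · exact h.2
      · exact h.1
    · intro h
      by_cases h' : x = a ∧ w ⟨0, by omega⟩ = b
      · exact .inr ⟨h, h'⟩
      · exact .inl ⟨fun _ => h', h⟩
  · refine Finset.disjoint_left.2 fun w hw hw' => ?_
    exact (Finset.mem_filter.1 hw).2.1 0 (by omega) (Finset.mem_filter.1 hw').2.2

/-- The words to be discarded begin with `c c`. As `c ≠ a`, this prefix creates no factor `a b`, so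
what follows is an arbitrary word of length `m` avoiding `a b`. -/
theorem reducedCount_true_add_two (hca : c ≠ a) (m : ℕ) :
    reducedCount a b c True (m + 2) + reducedCount a b c False m =
      reducedCount a b c False (m + 2) := by
  classical
  have h2 : reducedCount a b c False m = (Finset.univ.filter fun w : Fin (m + 2) → X =>
      IsReduced a b c False w ∧ w 0 = c ∧ w 1 = c).card := by
    rw [card_filter_cons_cons, reducedCount]
    congr 1
    ext w
    simp only [Finset.mem_filter, Finset.mem_univ, true_and]
    rw [isReduced_cons_iff, isReduced_cons_iff]
    exact ⟨fun h => ⟨fun _ h' => hca h'.1, fun _ h' => hca h'.1, h⟩, fun h => h.2.2⟩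
  rw [h2, reducedCount, reducedCount, ← Finset.card_union_of_disjoint]
  · congr 1
    ext w
    simp only [Finset.mem_union, Finset.mem_filter, Finset.mem_univ, true_and]
    constructor
    · rintro (h | h)
      · exact ⟨h.1, fun h => h.elim⟩
      · exact h.1
    · intro h
      by_cases h' : w 0 = c ∧ w 1 = c
      · exact .inr ⟨h, h'⟩
      · exact .inl ⟨h.1, fun _ _ => h'⟩
  · refine Finset.disjoint_left.2 fun w hw hw' => ?_
    exact (Finset.mem_filter.1 hw).2.2 trivial (by omega) (Finset.mem_filter.1 hw').2.2

/-- The number of words of length `j - 1` which avoid a factor `a b`, with value `0` at `j = 0`. -/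
noncomputable def shiftedCount (a b c : X) : ℕ → ℤ
  | 0 => 0
  | j + 1 => reducedCount a b c False j

theorem shiftedCount_add_two (hab : a ≠ b) (j : ℕ) :
    shiftedCount a b c (j + 2) + shiftedCount a b c j =
      (Fintype.card X : ℤ) * shiftedCount a b c (j + 1) := by
  cases j with
  | zero =>
    simp [shiftedCount, reducedCount_zero, reducedCount_one]
  | succ j =>
    simp only [shiftedCount]
    exact_mod_cast reducedCount_add_two hab j

theorem sum_reducedCount_ballot (hab : a ≠ b) (n : ℕ) :
    ∑ i ∈ Finset.range (n / 2 + 1), reducedCount a b c False (n - 2 * i) * (ballot n i).toNat =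
      Fintype.card X ^ n := by
  have h := sum_ballot (t := shiftedCount a b c) rfl
    (by simp [shiftedCount, reducedCount_zero]) (shiftedCount_add_two hab) n
  rw [← Nat.cast_inj (R := ℤ), Nat.cast_pow, ← h, Nat.cast_sum]
  refine Finset.sum_congr rfl fun i hi => ?_
  rw [Finset.mem_range] at hi
  rw [Nat.cast_mul, Int.toNat_of_nonneg (ballot_nonneg (by omega)), mul_comm,
    show n + 1 - 2 * i = n - 2 * i + 1 by omega]
  rfl

theorem sum_reducedCount_choose (hab : a ≠ b) (hca : c ≠ a) (n : ℕ) :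
    ∑ i ∈ Finset.range (n / 2 + 1), reducedCount a b c True (n - 2 * i) * n.choose i =
      Fintype.card X ^ n := by
  have h := sum_choose (t := shiftedCount a b c) rfl
    (by simp [shiftedCount, reducedCount_zero]) (shiftedCount_add_two hab)
    (w := fun m => reducedCount a b c True m) (by simp [reducedCount_zero]) ?_ n
  · rw [← Nat.cast_inj (R := ℤ), Nat.cast_pow, ← h, Nat.cast_sum]
    refine Finset.sum_congr rfl fun i hi => ?_
    rw [Nat.cast_mul, mul_comm]
  · intro m
    cases m with
    | zero => simp [shiftedCount, reducedCount_one]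
    | succ m =>
      simp only [shiftedCount]
      rw [eq_sub_iff_add_eq]
      exact_mod_cast reducedCount_true_add_two hca m

end ReducedWords

/-! ### Symmetry of the operators for the dot product of words -/

section SelfAdjoint

universe u

variable {k : Type u} [Field k] {X : Type} [Fintype X] [DecidableEq X]

omit [DecidableEq X] in
-- Exchanging the letters at `i, j` with the two summation letters is an involution `σ`. It
-- interchanges the two sides because the matrix `u ⊗ v` is symmetric, which is `huv`.
theorem sum_pairOp_mul {u v : X → X → k} (huv : ∀ x y x' y', u x y * v x' y' = u x' y' * v x y)
    {m : ℕ} {i j : Fin m} (hij : i ≠ j) (f g : (Fin m → X) → k) :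
    ∑ w, pairOp u v i j f w * g w = ∑ w, f w * pairOp u v i j g w := by
  let σ : (Fin m → X) × X × X → (Fin m → X) × X × X := fun t =>
    (Function.update (Function.update t.1 i t.2.1) j t.2.2, t.1 i, t.1 j)
  have hσ : Function.Involutive σ := by
    rintro ⟨w, x, y⟩
    refine Prod.ext ?_ (Prod.ext ?_ ?_)
    · change Function.update (Function.update (Function.update (Function.update w i x) j y) i (w i))
        j (w j) = w
      rw [Function.update_comm hij.symm, Function.update_idem, Function.update_idem,
        Function.update_eq_self, Function.update_eq_self]
    · change Function.update (Function.update w i x) j y i = x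
      rw [Function.update_of_ne hij, Function.update_self]
    · exact Function.update_self _ _ _
  have h1 : ∀ f g : (Fin m → X) → k, ∑ w, pairOp u v i j f w * g w =
      ∑ t : (Fin m → X) × X × X, u (t.1 i) (t.1 j) * v t.2.1 t.2.2 * f (σ t).1 * g t.1 := by
    intro f g
    rw [Fintype.sum_prod_type]
    refine Finset.sum_congr rfl fun w _ => ?_
    rw [pairOp_apply, Fintype.sum_prod_type, Finset.mul_sum, Finset.sum_mul]
    refine Finset.sum_congr rfl fun x _ => ?_
    rw [Finset.mul_sum, Finset.sum_mul]
    exact Finset.sum_congr rfl fun y _ => by simp only [σ]; ring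
  have h2 : ∑ w, f w * pairOp u v i j g w = ∑ w, pairOp u v i j g w * f w :=
    Finset.sum_congr rfl fun w _ => mul_comm _ _
  rw [h2, h1, h1, ← Equiv.sum_comp (Function.Involutive.toPerm σ hσ)]
  refine Finset.sum_congr rfl fun t _ => ?_
  have h3 : Function.Involutive.toPerm σ hσ t = σ t := rfl
  have h4 : (σ t).1 i = t.2.1 := by
    change Function.update (Function.update t.1 i t.2.1) j t.2.2 i = _
    rw [Function.update_of_ne hij, Function.update_self]
  have h5 : (σ t).1 j = t.2.2 := Function.update_self _ _ _
  rw [h3, hσ t, h4, h5, huv]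
  change u (t.1 i) (t.1 j) * _ * _ * _ = _
  ring

omit [DecidableEq X] in
theorem sum_letterOp_mul {K : X → X → k} (hK : ∀ x y, K x y = K y x)
    {m : ℕ} (i : Fin m) (f g : (Fin m → X) → k) :
    ∑ w, letterOp K i f w * g w = ∑ w, f w * letterOp K i g w := by
  let σ : (Fin m → X) × X → (Fin m → X) × X := fun t => (Function.update t.1 i t.2, t.1 i)
  have hσ : Function.Involutive σ := by
    rintro ⟨w, x⟩
    refine Prod.ext ?_ ?_
    · change Function.update (Function.update w i x) i (w i) = w
      rw [Function.update_idem, Function.update_eq_self]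
    · exact Function.update_self _ _ _
  have h1 : ∀ f g : (Fin m → X) → k, ∑ w, letterOp K i f w * g w =
      ∑ t : (Fin m → X) × X, K (t.1 i) t.2 * f (σ t).1 * g t.1 := by
    intro f g
    rw [Fintype.sum_prod_type]
    refine Finset.sum_congr rfl fun w _ => ?_
    rw [letterOp_apply, Finset.sum_mul]
  have h2 : ∑ w, f w * letterOp K i g w = ∑ w, letterOp K i g w * f w :=
    Finset.sum_congr rfl fun w _ => mul_comm _ _
  rw [h2, h1, h1, ← Equiv.sum_comp (Function.Involutive.toPerm σ hσ)]
  refine Finset.sum_congr rfl fun t _ => ?_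
  have h3 : Function.Involutive.toPerm σ hσ t = σ t := rfl
  have h4 : (σ t).1 i = t.2 := Function.update_self _ _ _
  rw [h3, hσ t, h4, hK]
  change K (t.1 i) _ * _ * _ = _
  ring

end SelfAdjoint

/-! ### Anti-involutions and costandard filtrations -/

section AntiInvolution

universe u

open MulOpposite

variable {k A : Type u} [Field k] [Ring A] [Algebra k A]

/-- An antiautomorphism that fixes generators is an involution. -/
theorem op_eq_of_adjoin {S : Set A} (hS : Algebra.adjoin k S = ⊤) {τ : A →ₐ[k] Aᵐᵒᵖ}
    (hτ : ∀ x ∈ S, τ x = op x) (a : A) : τ (τ a).unop = op a := by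
  have ha : a ∈ Algebra.adjoin k S := hS ▸ Algebra.mem_top
  induction ha using Algebra.adjoin_induction with
  | mem x hx => rw [hτ x hx, unop_op, hτ x hx]
  | algebraMap r =>
    rw [AlgHom.commutes, MulOpposite.algebraMap_apply, unop_op, AlgHom.commutes, MulOpposite.algebraMap_apply]
  | add x y _ _ hx hy => rw [map_add, unop_add, map_add, hx, hy, op_add]
  | mul x y _ _ hx hy => rw [map_mul, unop_mul, map_mul, hx, hy, op_mul]

theorem exists_algEquiv_op {S : Set A} (hS : Algebra.adjoin k S = ⊤) {τ : A →ₐ[k] Aᵐᵒᵖ}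
    (hτ : ∀ x ∈ S, τ x = op x) : ∃ σ : A ≃ₐ[k] Aᵐᵒᵖ, ∀ a, σ a = τ a := by
  have h := op_eq_of_adjoin hS hτ
  refine ⟨AlgEquiv.ofBijective τ ⟨fun a b hab => op_injective ?_, fun b => ⟨(τ b.unop).unop, ?_⟩⟩,
    fun a => rfl⟩
  · rw [← h a, ← h b, hab]
  · rw [h, op_unop]

/-- The contravariance of a form only has to be checked on generators. -/
theorem contravariant_of_adjoin {M : Type u} [AddCommGroup M] [Module k M] [Module A M]
    [IsScalarTower k A M] {S : Set A} (hS : Algebra.adjoin k S = ⊤) {τ : A →ₐ[k] Aᵐᵒᵖ}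
    (hτ : ∀ x ∈ S, τ x = op x) (β : M →ₗ[k] M →ₗ[k] k)
    (hβ : ∀ a ∈ S, ∀ x y, β (a • x) y = β x (a • y)) (a : A) (x y : M) :
    β (a • x) y = β x ((τ a).unop • y) := by
  have ha : a ∈ Algebra.adjoin k S := hS ▸ Algebra.mem_top
  induction ha using Algebra.adjoin_induction generalizing x y with
  | mem a ha => rw [hβ a ha, hτ a ha, unop_op]
  | algebraMap r =>
    rw [AlgHom.commutes, MulOpposite.algebraMap_apply, unop_op, algebraMap_smul, algebraMap_smul, map_smul,
      map_smul, LinearMap.smul_apply]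
  | add a b _ _ ha hb =>
    rw [add_smul, map_add, LinearMap.add_apply, ha, hb, map_add, unop_add, add_smul, map_add]
  | mul a b _ _ ha hb => rw [mul_smul, ha, hb, map_mul, unop_mul, mul_smul]

/-- The factors of `capProd` commute with each other, so reversing their order has no effect. -/
theorem IsBlobLike.map_capProd_op {n : ℕ} {U : ℕ → A} {e : A} {d γ δ : k}
    (H : IsBlobLike n U e d γ δ) {τ : A →ₐ[k] Aᵐᵒᵖ} (hτ : ∀ p, 1 ≤ p → p < n → τ (U p) = op (U p))
    (i : ℕ) : τ (capProd U d n i) = op (capProd U d n i) := by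
  induction i with
  | zero => rw [capProd_zero, map_one, op_one]
  | succ i ih =>
    by_cases h : 2 * i + 2 ≤ n
    · have hc : Commute (U (n - 2 * i - 1)) (capProd U d n i) :=
        H.commute_capProd (by omega) (by omega) le_rfl
      rw [capProd_succ' U d h, map_mul, ih, map_smul, hτ _ (by omega) (by omega), ← op_smul,
        ← op_mul, smul_mul_assoc, mul_smul_comm, hc.eq]
    · rw [capProd_eq_zero U d (by omega), map_zero, op_zero]

theorem map_capProd {B : Type u} [Ring B] [Algebra k B] (f : A →ₐ[k] B) {U : ℕ → A} {U' : ℕ → B}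
    (d : k) {m : ℕ} (h : ∀ p, 1 ≤ p → p < m → f (U p) = U' p) (i : ℕ) :
    f (capProd U d m i) = capProd U' d m i := by
  induction i generalizing m with
  | zero => rw [capProd_zero, capProd_zero, map_one]
  | succ i ih =>
    by_cases hm : 2 ≤ m
    · obtain ⟨m, rfl⟩ := Nat.exists_eq_add_of_le' hm
      rw [capProd_succ, capProd_succ, map_mul, map_smul, h _ (by omega) (by omega),
        ih fun p h1 h2 => h p h1 (by omega)]
    · rw [capProd_eq_zero _ _ (by omega), capProd_eq_zero _ _ (by omega), map_zero]

variable {X : Type} [Fintype X] [DecidableEq X]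
  {M : Type u} [AddCommGroup M] [Module k M] [Module A M] [IsScalarTower k A M]
  {n : ℕ} {U : ℕ → A} {e : A} {u v K : X → X → k} {Φ : M ≃ₗ[k] ((Fin n → X) → k)}
  {d γ δ : k}

/-- If the operators are symmetric, then a homogeneous component with a standard filtration also
has a costandard filtration. -/
theorem IsWordModel.hasFiltration_costandardModule (W : IsWordModel U e u v K Φ)
    (H : IsBlobLike n U e d γ δ) (he0 : n = 0 → e = 0)
    (huv : ∀ x y x' y', u x y * v x' y' = u x' y' * v x y) (hK : ∀ x y, K x y = K y x)
    {τ : A →ₐ[k] Aᵐᵒᵖ} (hτU : ∀ p, 1 ≤ p → p < n → τ (U p) = op (U p)) (hτe : τ e = op e)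
    {ι : Type} {e' g : ι → A} (he' : ∀ j, τ (e' j) = op (e' j)) (hg : ∀ j, τ (g j) = op (g j))
    {dg : X → ℕ} {r : ℕ} {N : Submodule A M}
    (hN : ∀ m, m ∈ N ↔ ∀ w, wordDegree dg w ≠ r → Φ m w = 0)
    (h : HasFiltration A (fun j => StandardModule A (e' j) (g j)) N) :
    HasFiltration A (fun j => CostandardModule k A (e' j) (g j)) N := by
  have hfinM : Module.Finite k M := Module.Finite.equiv Φ.symm
  have hfinN : Module.Finite k N := inferInstanceAs (Module.Finite k (N.restrictScalars k))
  have hτ : ∀ x ∈ insert e (U '' {i | 1 ≤ i ∧ i < n}), τ x = op x := by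
    rintro x (rfl | ⟨p, hp, rfl⟩)
    · exact hτe
    · exact hτU p hp.1 hp.2
  obtain ⟨σ, hσ⟩ := exists_algEquiv_op H.gen hτ
  have hp : ∀ j, ∃ p : CostandardModule k A (e' j) (g j) ≃+
      Module.Dual k (StandardModule A (e' j) (g j)),
      ∀ a y x, p (a • y) x = p y ((σ a).unop • x) := fun j =>
    exists_costandardModule_equiv σ (fun a => by rw [hσ, hσ]; exact op_eq_of_adjoin H.gen hτ a)
      _ _ (by rw [hσ]; exact he' j) (by rw [hσ]; exact hg j)
  choose p hp using hp
  let Ψ : N →ₗ[k] ((Fin n → X) → k) := Φ.toLinearMap ∘ₗ (N.subtype.restrictScalars k)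
  -- The words are orthonormal for this form. It stays nondegenerate on `N`, which is spanned by the
  -- words of degree `r`.
  let β : N →ₗ[k] N →ₗ[k] k := (dotProductBilin k k).compl₁₂ Ψ Ψ
  have hβ : ∀ x y : N, β x y = ∑ w, Φ x w * Φ y w := fun x y => rfl
  refine HasFiltration.dual (k := k) (fun a => (σ a).unop) β ?_ ?_ p hp h
  · rw [← LinearMap.ker_eq_bot, LinearMap.ker_eq_bot']
    intro x hx
    refine Subtype.ext (Φ.injective (funext fun w => ?_))
    rw [ZeroMemClass.coe_zero, map_zero]
    by_cases hw : wordDegree dg w = r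
    · have hmem : Φ.symm (Pi.single w 1) ∈ N := (hN _).2 fun w' hw' => by
        rw [LinearEquiv.apply_symm_apply]
        exact Pi.single_eq_of_ne (fun h => hw' (by rw [h, hw])) _
      have h1 := LinearMap.congr_fun hx ⟨_, hmem⟩
      rw [hβ] at h1
      simpa [Pi.single_apply] using h1
    · exact (hN _).1 x.2 w hw
  · intro a x y
    rw [hσ]
    refine contravariant_of_adjoin H.gen hτ β ?_ a x y
    rintro b (rfl | ⟨p, ⟨hp1, hp2⟩, rfl⟩) x y
    · rw [hβ, hβ]
      rcases Nat.eq_zero_or_pos n with h0 | h0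
      · rw [he0 h0, zero_smul, zero_smul]
        simp
      · rw [N.coe_smul, N.coe_smul, W.letter h0, W.letter h0]
        exact sum_letterOp_mul hK _ _ _
    · obtain ⟨p, rfl⟩ := Nat.exists_eq_add_of_le' hp1
      rw [hβ, hβ, N.coe_smul, N.coe_smul, W.pair p hp2, W.pair p hp2]
      exact sum_pairOp_mul huv (Fin.ne_of_val_ne (by simp)) _ _

end AntiInvolution

/-! ### The matrix of a Temperley–Lieb generator as a rank one operator -/

section RankOne

universe u

variable {k : Type u} [Field k]

/-- The image of the rank one matrix `matU q`. -/
def cupVec (q : kˣ) (x y : Fin 2) : k := if x = y then 0 else if x = 0 then (q : k) else 1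

/-- The linear form that defines the rank one matrix `matU q`. -/
def capVec (q : kˣ) (x y : Fin 2) : k := if x = y then 0 else if x = 0 then 1 else ((q⁻¹ : kˣ) : k)

theorem matU_eq_mul (q : kˣ) (x y x' y' : Fin 2) :
    matU q (x, y) (x', y') = cupVec q x y * capVec q x' y' := by
  rw [matU_apply]
  fin_cases x <;> fin_cases y <;> fin_cases x' <;> fin_cases y' <;> simp [cupVec, capVec]

/-- `cupVec q` is `q` times `capVec q`, so the rank one matrix they form is symmetric. -/
theorem cupVec_mul_capVec (q : kˣ) (x y x' y' : Fin 2) :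
    cupVec q x y * capVec q x' y' = cupVec q x' y' * capVec q x y := by
  fin_cases x <;> fin_cases y <;> fin_cases x' <;> fin_cases y' <;> simp [cupVec, capVec]

theorem sum_capVec_mul_cupVec (q : kˣ) :
    ∑ x, ∑ y, capVec q x y * cupVec q x y = (q : k) + ((q⁻¹ : kˣ) : k) := by
  simp [cupVec, capVec]

theorem twoSite_matU (q : kˣ) {N : ℕ} (i j : Fin N) (f : TensorSpace k N) :
    twoSite (matU q) i j f = pairOp (cupVec q) (capVec q) i j f := by
  ext w
  rw [twoSite_apply, pairOp_apply, Finset.mul_sum]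
  refine Finset.sum_congr rfl fun x _ => ?_
  rw [Finset.mul_sum]
  refine Finset.sum_congr rfl fun y _ => ?_
  rw [matU_eq_mul, mul_assoc]

theorem letterOp_zero_apply {X : Type} [Fintype X] [DecidableEq X] {m : ℕ} (i : Fin m)
    (f : (Fin m → X) → k) : letterOp (fun _ _ => (0 : k)) i f = 0 := by
  ext w
  rw [letterOp_apply]
  simp

theorem wordDegree_eq_numOnes {N : ℕ} (w : Fin N → Fin 2) :
    wordDegree (fun x => if x = 0 then 1 else 0) w = numOnes w := by
  rw [wordDegree, numOnes, Finset.card_filter]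

theorem numOnes_le {N : ℕ} (w : Fin N → Fin 2) : numOnes w ≤ N :=
  (Finset.card_filter_le _ _).trans (by simp)

theorem wordDegree_const_zero {X : Type} {N : ℕ} (w : Fin N → X) :
    wordDegree (fun _ : X => 0) w = 0 := by
  simp [wordDegree]

end RankOne

/-! ### The Temperley–Lieb algebra -/

namespace TLAlg

universe u

variable {k : Type u} [Field k] (q : kˣ) (n : ℕ)

open MulOpposite

/-- The generators of `T_n`, continued by `0`. -/
noncomputable def gen (i : ℕ) : TLAlg q n := if h : 1 ≤ i ∧ i < n then U q i h.1 h.2 else 0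

variable {n} in
theorem gen_eq {i : ℕ} (h₁ : 1 ≤ i) (h₂ : i < n) : gen q n i = U q i h₁ h₂ := dif_pos ⟨h₁, h₂⟩

/-- For `e = 0` the relations involving `e` hold with `γ = 0` and with any `δ`; the value `1` is
arbitrary. -/
theorem isBlobLike : IsBlobLike n (gen q n) 0 ((q : k) + ((q⁻¹ : kˣ) : k)) 0 1 where
  sq i h₁ h₂ := by
    simpa [gen_eq q h₁ h₂, U] using mk_eq (TLRel.sq (q := q) (n := n) i h₁ h₂)
  up i h₁ h₂ := by
    rw [gen_eq q h₁ (by omega), gen_eq q (by omega) h₂]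
    simpa [U] using mk_eq (TLRel.up (q := q) (n := n) i h₁ (by omega) (by omega) h₂)
  down i h₁ h₂ := by
    rw [gen_eq q h₁ (by omega), gen_eq q (by omega) h₂]
    simpa [U] using mk_eq (TLRel.down (q := q) (n := n) i h₁ (by omega) (by omega) h₂)
  comm i j h₁ hij h₂ := by
    rw [gen_eq q h₁ (by omega), gen_eq q (by omega) h₂, commute_iff_eq]
    simpa [U] using mk_eq (TLRel.comm (q := q) (n := n) i j h₁ (by omega) (by omega) h₂ (by omega)
      (by omega))
  blob _ := by simp
  esq := by simp
  ecomm _ _ _ := Commute.zero_right _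
  gen := by
    rw [Algebra.eq_top_iff]
    intro x
    obtain ⟨x, rfl⟩ := mk_surjective q n x
    induction x using FreeAlgebra.induction with
    | grade0 r => rw [AlgHom.commutes]; exact Subalgebra.algebraMap_mem _ r
    | grade1 x =>
      obtain ⟨i, h₁, h₂⟩ := x
      exact Algebra.subset_adjoin (.inr ⟨i, ⟨h₁, h₂⟩, gen_eq q h₁ h₂⟩)
    | mul x y hx hy => rw [map_mul]; exact mul_mem hx hy
    | add x y hx hy => rw [map_add]; exact add_mem hx hy

theorem chain_eq_capProd (i : ℕ) :
    chain q n i = capProd (gen q n) ((q : k) + ((q⁻¹ : kˣ) : k)) n i := by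
  induction n, i using chain.induct with
  | case1 n => rw [chain, capProd_zero]
  | case2 i => rw [chain, capProd_eq_zero _ _ (by omega)]
  | case3 i => rw [chain, capProd_eq_zero _ _ (by omega)]
  | case4 n i ih =>
    rw [chain, ih, capProd_succ, eps, gen_eq q (by omega) (by omega)]
    congr 1
    refine map_capProd _ _ (fun p h₁ h₂ => ?_) i
    rw [gen_eq q h₁ h₂, gen_eq q h₁ (by omega), incl, U, lift_mk, FreeAlgebra.lift_ι_apply]

/-- The antiautomorphism of `T_n` that fixes the generators. -/
noncomputable def anti : TLAlg q n →ₐ[k] (TLAlg q n)ᵐᵒᵖ :=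
  lift (fun | .U i h₁ h₂ => op (U q i h₁ h₂)) (by
    intro x y h
    refine unop_injective ?_
    induction h with
    | sq i h₁ h₂ => simpa [U] using mk_eq (TLRel.sq (q := q) (n := n) i h₁ h₂)
    | up i h₁ h₂ h₃ h₄ =>
      simpa [U, mul_assoc] using mk_eq (TLRel.up (q := q) (n := n) i h₁ h₂ h₃ h₄)
    | down i h₁ h₂ h₃ h₄ =>
      simpa [U, mul_assoc] using mk_eq (TLRel.down (q := q) (n := n) i h₁ h₂ h₃ h₄)
    | comm i j h₁ h₂ h₃ h₄ hij hji =>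
      simpa [U] using mk_eq (TLRel.comm (q := q) (n := n) j i h₃ h₄ h₁ h₂ hji hij))

theorem anti_gen (p : ℕ) (h₁ : 1 ≤ p) (h₂ : p < n) : anti q n (gen q n p) = op (gen q n p) := by
  rw [gen_eq q h₁ h₂, anti, U, lift_mk, FreeAlgebra.lift_ι_apply]
  rfl

/-- The coordinates of a vector of tensor space. -/
def coords : Tensor q n ≃ₗ[k] ((Fin n → Fin 2) → k) where
  toFun f := f
  invFun f := f
  map_add' _ _ := rfl
  map_smul' _ _ := rfl
  left_inv _ := rfl
  right_inv _ := rfl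

theorem isWordModel : IsWordModel (gen q n) 0 (cupVec q) (capVec q)
    (fun _ _ => 0) (coords q n) where
  pair p h m := by
    rw [gen_eq q (by omega) h]
    change tensorRep q n (U q (p + 1) _ h) m = _
    rw [tensorRep, U, lift_mk, FreeAlgebra.lift_ι_apply]
    exact twoSite_matU q _ _ _
  letter h m := by
    rw [zero_smul, map_zero, letterOp_zero_apply]

theorem hasFiltration (h2 : (q : k) + ((q⁻¹ : kˣ) : k) ≠ 0) {D : ℕ} {dg : Fin 2 → ℕ} {κ : ℕ}
    (hdg : ∀ x y, cupVec q x y ≠ 0 → dg x + dg y = κ)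
    {N : Fin D → Submodule (TLAlg q n) (Tensor q n)}
    (hN : ∀ (r : Fin D) (m : Tensor q n),
      m ∈ N r ↔ ∀ w, wordDegree dg w ≠ r → coords q n m w = 0)
    (hdeg : ∀ w : Fin n → Fin 2, wordDegree dg w < D) (r : Fin D) :
    IsTilting q n (N r) := by
  have hlay : ∀ l : Weight n, l.1 + 2 * ((n - l.1) / 2) = n := fun l => by
    have := l.2
    omega
  have H := isBlobLike q n
  have h01 : ∀ x y, cupVec q x y ≠ 0 → (x = 0 ∧ y = 1) ∨ (x = 1 ∧ y = 0) := by
    intro x y h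
    fin_cases x <;> fin_cases y <;> simp_all [cupVec]
  have hD : HasFiltration (TLAlg q n) (Delta q n) (N r) := by
    -- The vector `cupVec` is supported on `01` and `10`, of which `01` has the larger weight and is
    -- leading. As `e = 0`, there is no condition at the beginning of words: `s` is `False` and `c`
    -- plays no part.
    refine (isWordModel q n).hasFiltration H h2 (sum_capVec_mul_cupVec q) (a := 0) (b := 1)
      (c := 0) (s := False) (φ := fun x => x.val) ?_ ?_ (fun h => h.elim) (fun h => h.elim)
      (fun i => (ballot n i).toNat) (fun l : Weight n => (n - l.1) / 2) ?_ ?_ ?_ ?_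
      (sum_reducedCount_ballot zero_ne_one n).le hdg hN hdeg r
    · simp [cupVec]
    · intro x y h
      rcases h01 x y h with ⟨rfl, rfl⟩ | ⟨rfl, rfl⟩
      · exact .inl ⟨rfl, rfl⟩
      · exact .inr ⟨rfl, by simp⟩
    · exact fun l => chain_eq_capProd q n _
    · exact fun l => ⟨1, by rw [mul_one, chain_eq_capProd]⟩
    · intro l
      have := H.finrank_standardModule_le_ballot h2 (hlay l) 1
      rw [mul_one] at this
      rw [chain_eq_capProd, chain_eq_capProd]
      exact ⟨this.1, by have := this.2; omega⟩
    · intro i hi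
      refine ⟨{⟨n - 2 * i, by omega, by omega⟩}, fun l hl => ?_, ?_⟩
      · rw [Finset.mem_singleton.1 hl]
        dsimp only
        omega
      · rw [Finset.sum_singleton, chain_eq_capProd]
        congr 1
        dsimp only
        omega
  have hop : ∀ i, anti q n (chain q n i) = op (chain q n i) := fun i => by
    rw [chain_eq_capProd]
    exact H.map_capProd_op (anti_gen q n) i
  exact ⟨hD, (isWordModel q n).hasFiltration_costandardModule H (fun _ => rfl)
    (cupVec_mul_capVec q) (fun _ _ => rfl) (anti_gen q n) (by rw [map_zero, op_zero])
    (fun l => hop _) (fun l => hop _) (hN r) hD⟩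

theorem isTilting_permModule (h2 : (q : k) + ((q⁻¹ : kˣ) : k) ≠ 0) {r : ℕ} (hr : r ≤ n) :
    IsTilting q n (permModule q n r) := by
  refine hasFiltration q n h2 (D := n + 1) (dg := fun x => if x = 0 then 1 else 0) (κ := 1) ?_
    (N := fun r => permModule q n r) ?_ ?_ ⟨r, by omega⟩
  · intro x y h
    fin_cases x <;> fin_cases y <;> simp_all [cupVec]
  · intro r m
    simp only [wordDegree_eq_numOnes]
    rfl
  · intro w
    rw [wordDegree_eq_numOnes]
    have := numOnes_le w
    omega

theorem IsTilting.congr {M N : Type u} [AddCommGroup M] [Module (TLAlg q n) M] [AddCommGroup N]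
    [Module (TLAlg q n) N] (e : M ≃ₗ[TLAlg q n] N) (h : IsTilting q n M) : IsTilting q n N :=
  ⟨h.1.congr e, h.2.congr e⟩

/-- For the trivial grading, with all letters of degree `0`, the only component is tensor space
itself. -/
theorem isTilting_tensor (h2 : (q : k) + ((q⁻¹ : kˣ) : k) ≠ 0) :
    IsTilting q n (Tensor q n) := by
  refine IsTilting.congr q n Submodule.topEquiv (hasFiltration q n h2 (D := 1) (dg := fun _ => 0)
    (κ := 0) (fun _ _ _ => rfl) (N := fun _ => ⊤) ?_ ?_ 0)
  · intro r m
    simp [wordDegree_const_zero]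
  · intro w
    rw [wordDegree_const_zero]
    exact one_pos

end TLAlg

/-! ### The blob algebra -/

namespace BlobAlg

universe u

open MulOpposite

section General

variable {k : Type u} [Field k] (q : kˣ) (γ δ : k) (n : ℕ)

/-- The generators `U_i` of `b_n`, continued by `0`. -/
noncomputable def gen (i : ℕ) : BlobAlg q γ δ n :=
  if h : 1 ≤ i ∧ i < n then U q γ δ i h.1 h.2 else 0

variable {n} in
theorem gen_eq {i : ℕ} (h₁ : 1 ≤ i) (h₂ : i < n) : gen q γ δ n i = U q γ δ i h₁ h₂ :=
  dif_pos ⟨h₁, h₂⟩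

variable {n} in
theorem e_eq (h : 1 ≤ n) : e q γ δ n = mk q γ δ n (FreeAlgebra.ι k (.e h)) := dif_pos h

theorem e_eq_zero (h : n = 0) : e q γ δ n = 0 := dif_neg (by omega)

theorem isBlobLike : IsBlobLike n (gen q γ δ n) (e q γ δ n) ((q : k) + ((q⁻¹ : kˣ) : k)) γ δ where
  sq i h₁ h₂ := by
    simpa [gen_eq q γ δ h₁ h₂, U] using
      mk_eq (BlobRel.sq (q := q) (γ := γ) (δ := δ) (n := n) i h₁ h₂)
  up i h₁ h₂ := by
    rw [gen_eq q γ δ h₁ (by omega), gen_eq q γ δ (by omega) h₂]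
    simpa [U] using
      mk_eq (BlobRel.up (q := q) (γ := γ) (δ := δ) (n := n) i h₁ (by omega) (by omega) h₂)
  down i h₁ h₂ := by
    rw [gen_eq q γ δ h₁ (by omega), gen_eq q γ δ (by omega) h₂]
    simpa [U] using
      mk_eq (BlobRel.down (q := q) (γ := γ) (δ := δ) (n := n) i h₁ (by omega) (by omega) h₂)
  comm i j h₁ hij h₂ := by
    rw [gen_eq q γ δ h₁ (by omega), gen_eq q γ δ (by omega) h₂, commute_iff_eq]
    simpa [U] using mk_eq (BlobRel.comm (q := q) (γ := γ) (δ := δ) (n := n) i j h₁ (by omega)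
      (by omega) h₂ (by omega) (by omega))
  blob h := by
    rw [gen_eq q γ δ le_rfl h, e_eq q γ δ h.le]
    simpa [U] using
      mk_eq (BlobRel.blob (q := q) (γ := γ) (δ := δ) (n := n) (by omega) le_rfl h)
  esq := by
    rcases Nat.eq_zero_or_pos n with h | h
    · rw [e_eq_zero q γ δ n h, mul_zero, smul_zero]
    · rw [e_eq q γ δ h]
      simpa using mk_eq (BlobRel.esq (q := q) (γ := γ) (δ := δ) (n := n) h)
  ecomm i h₁ h₂ := by
    rw [gen_eq q γ δ (by omega) h₂, e_eq q γ δ (by omega), commute_iff_eq]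
    simpa [U] using mk_eq (BlobRel.ecomm (q := q) (γ := γ) (δ := δ) (n := n) (by omega) i
      (by omega) h₂ (by omega))
  gen := by
    rw [Algebra.eq_top_iff]
    intro x
    obtain ⟨x, rfl⟩ := mk_surjective q γ δ n x
    induction x using FreeAlgebra.induction with
    | grade0 r => rw [AlgHom.commutes]; exact Subalgebra.algebraMap_mem _ r
    | grade1 x =>
      obtain h | ⟨i, h₁, h₂⟩ := x
      · exact Algebra.subset_adjoin (.inl (e_eq q γ δ h).symm)
      · exact Algebra.subset_adjoin (.inr ⟨i, ⟨h₁, h₂⟩, gen_eq q γ δ h₁ h₂⟩)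
    | mul x y hx hy => rw [map_mul]; exact mul_mem hx hy
    | add x y hx hy => rw [map_add]; exact add_mem hx hy

theorem chain_eq_capProd (i : ℕ) :
    chain q γ δ n i = capProd (gen q γ δ n) ((q : k) + ((q⁻¹ : kˣ) : k)) n i := by
  induction n, i using chain.induct with
  | case1 n => rw [chain, capProd_zero]
  | case2 i => rw [chain, capProd_eq_zero _ _ (by omega)]
  | case3 i => rw [chain, capProd_eq_zero _ _ (by omega)]
  | case4 n i ih =>
    rw [chain, ih, capProd_succ, eps, gen_eq q γ δ (by omega) (by omega)]
    congr 1
    refine map_capProd _ _ (fun p h₁ h₂ => ?_) i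
    rw [gen_eq q γ δ h₁ h₂, gen_eq q γ δ h₁ (by omega), incl, U, lift_mk,
      FreeAlgebra.lift_ι_apply]

/-- The antiautomorphism of `b_n` that fixes the generators. -/
noncomputable def anti : BlobAlg q γ δ n →ₐ[k] (BlobAlg q γ δ n)ᵐᵒᵖ :=
  lift (fun
      | .e h => op (mk q γ δ n (FreeAlgebra.ι k (.e h)))
      | .U i h₁ h₂ => op (U q γ δ i h₁ h₂)) (by
    intro x y h
    refine unop_injective ?_
    induction h with
    | sq i h₁ h₂ =>
      simpa [U] using mk_eq (BlobRel.sq (q := q) (γ := γ) (δ := δ) (n := n) i h₁ h₂)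
    | up i h₁ h₂ h₃ h₄ =>
      simpa [U, mul_assoc] using
        mk_eq (BlobRel.up (q := q) (γ := γ) (δ := δ) (n := n) i h₁ h₂ h₃ h₄)
    | down i h₁ h₂ h₃ h₄ =>
      simpa [U, mul_assoc] using
        mk_eq (BlobRel.down (q := q) (γ := γ) (δ := δ) (n := n) i h₁ h₂ h₃ h₄)
    | comm i j h₁ h₂ h₃ h₄ hij hji =>
      simpa [U] using
        mk_eq (BlobRel.comm (q := q) (γ := γ) (δ := δ) (n := n) j i h₃ h₄ h₁ h₂ hji hij)
    | blob h₀ h₁ h₂ =>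
      simpa [U, mul_assoc] using
        mk_eq (BlobRel.blob (q := q) (γ := γ) (δ := δ) (n := n) h₀ h₁ h₂)
    | esq h₀ => simpa using mk_eq (BlobRel.esq (q := q) (γ := γ) (δ := δ) (n := n) h₀)
    | ecomm h₀ i h₁ h₂ hi =>
      simpa [U] using
        (mk_eq (BlobRel.ecomm (q := q) (γ := γ) (δ := δ) (n := n) h₀ i h₁ h₂ hi)).symm)

theorem anti_gen (p : ℕ) (h₁ : 1 ≤ p) (h₂ : p < n) :
    anti q γ δ n (gen q γ δ n p) = op (gen q γ δ n p) := by
  rw [gen_eq q γ δ h₁ h₂, anti, U, lift_mk, FreeAlgebra.lift_ι_apply]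
  rfl

theorem anti_e : anti q γ δ n (e q γ δ n) = op (e q γ δ n) := by
  rcases Nat.eq_zero_or_pos n with h | h
  · rw [e_eq_zero q γ δ n h, map_zero, op_zero]
  · rw [e_eq q γ δ h, anti, lift_mk, FreeAlgebra.lift_ι_apply]

theorem anti_chain (i : ℕ) : anti q γ δ n (chain q γ δ n i) = op (chain q γ δ n i) := by
  rw [chain_eq_capProd]
  exact (isBlobLike q γ δ n).map_capProd_op (anti_gen q γ δ n) i

theorem anti_signIdem (l : ℤ) : anti q γ δ n (signIdem q γ δ n l) = op (signIdem q γ δ n l) := by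
  unfold signIdem
  split_ifs
  · rw [map_smul, anti_e, op_smul]
  · rw [map_sub, map_one, map_smul, anti_e, op_sub, op_one, op_smul]
  · rw [map_one, op_one]

/-- If `l ≠ 0`, the first strand is not among the `2 * i` strands of the caps, so `e` commutes with
them; for `l = 0` the idempotent is `1`. The antiautomorphism therefore fixes the product of the
two. -/
theorem commute_chain_signIdem (i : ℕ) {l : ℤ} (h : l ≠ 0 → 2 * i < n) :
    Commute (chain q γ δ n i) (signIdem q γ δ n l) := by
  have he : l ≠ 0 → Commute (chain q γ δ n i) (e q γ δ n) := fun hl => by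
    rw [chain_eq_capProd]
    exact ((isBlobLike q γ δ n).commute_e_capProd (h hl) le_rfl).symm
  unfold signIdem
  split_ifs with h1 h2
  · exact (he h1.ne').smul_right _
  · exact (Commute.one_right _).sub_right ((he h2.ne).smul_right _)
  · exact Commute.one_right _

variable {δ} in
-- This is the scalar by which `e` acts on the generator of a standard module: `δ` for positive
-- weights and `0` for negative ones.
theorem e_mul_signIdem (hδ : δ ≠ 0) {l : ℤ} (hl : l ≠ 0) :
    ∃ κ : k, e q γ δ n * signIdem q γ δ n l = κ • signIdem q γ δ n l := by
  have hsq := (isBlobLike q γ δ n).esq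
  unfold signIdem
  split_ifs with h1 h2
  · exact ⟨δ, by rw [mul_smul_comm, hsq, smul_comm]⟩
  · exact ⟨0, by rw [mul_sub, mul_one, mul_smul_comm, hsq, smul_smul, inv_mul_cancel₀ hδ, one_smul,
      sub_self, zero_smul]⟩
  · omega

end General

/-! ### Folding tensor space in the middle -/

section Folding

variable {n : ℕ}

/-- The two tensor factors which are put together when tensor space is folded: the factors
`n - 1 - p` and `n + p` belong to the site `p`. -/
def sitePos (n : ℕ) : Fin n ⊕ Fin n ≃ Fin (2 * n) where
  toFun := Sum.elim (fun p => ⟨n - 1 - p, by omega⟩) (fun p => ⟨n + p, by omega⟩)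
  invFun j := if h : j.val < n then .inl ⟨n - 1 - j, by omega⟩ else .inr ⟨j - n, by omega⟩
  left_inv := by
    rintro (p | p)
    · rw [Sum.elim_inl]
      dsimp only
      rw [dif_pos (by omega)]
      congr 1
      ext
      dsimp only
      omega
    · rw [Sum.elim_inr]
      dsimp only
      rw [dif_neg (by omega)]
      congr 1
      ext
      dsimp only
      omega
  right_inv j := by
    dsimp only
    split_ifs with h
    · ext
      dsimp only [Sum.elim_inl]
      omega
    · ext
      dsimp only [Sum.elim_inr]
      omega

/-- The correspondence between words in pairs of letters and words of twice the length. -/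
def unfoldWord (n : ℕ) : (Fin n → Fin 2 × Fin 2) ≃ (Fin (2 * n) → Fin 2) where
  toFun w := Sum.elim (fun p => (w p).1) (fun p => (w p).2) ∘ (sitePos n).symm
  invFun w p := (w (sitePos n (.inl p)), w (sitePos n (.inr p)))
  left_inv w := by
    ext p <;> simp
  right_inv w := by
    ext j
    obtain ⟨p | p, rfl⟩ := (sitePos n).surjective j <;> simp

theorem unfoldWord_inl (w : Fin n → Fin 2 × Fin 2) (p : Fin n) :
    unfoldWord n w (sitePos n (.inl p)) = (w p).1 := by
  simp [unfoldWord]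

theorem unfoldWord_inr (w : Fin n → Fin 2 × Fin 2) (p : Fin n) :
    unfoldWord n w (sitePos n (.inr p)) = (w p).2 := by
  simp [unfoldWord]

theorem unfoldWord_update (w : Fin n → Fin 2 × Fin 2) (p : Fin n) (x y : Fin 2) :
    unfoldWord n (Function.update w p (x, y)) =
      Function.update (Function.update (unfoldWord n w) (sitePos n (.inl p)) x)
        (sitePos n (.inr p)) y := by
  funext j
  obtain ⟨s | s, rfl⟩ := (sitePos n).surjective j
  · have hne : sitePos n (.inl s) ≠ sitePos n (.inr p) := by simp
    rw [unfoldWord_inl, Function.update_of_ne hne]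
    by_cases h : s = p
    · subst h
      rw [Function.update_self, Function.update_self]
    · rw [Function.update_of_ne h, Function.update_of_ne (fun h' => h (by simpa using h')),
        unfoldWord_inl]
  · rw [unfoldWord_inr]
    by_cases h : s = p
    · subst h
      rw [Function.update_self, Function.update_self]
    · rw [Function.update_of_ne h, Function.update_of_ne (fun h' => h (by simpa using h')),
        Function.update_of_ne (show sitePos n (.inr s) ≠ sitePos n (.inl p) by simp),
        unfoldWord_inr]

/-- The number of letters `1` in a pair of letters. -/
def pairDegree (x : Fin 2 × Fin 2) : ℕ := (if x.1 = 0 then 1 else 0) + if x.2 = 0 then 1 else 0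

theorem numOnes_unfoldWord (w : Fin n → Fin 2 × Fin 2) :
    numOnes (unfoldWord n w) = wordDegree pairDegree w := by
  rw [numOnes, Finset.card_filter, ← Equiv.sum_comp (sitePos n), Fintype.sum_sum_type, wordDegree]
  simp only [unfoldWord_inl, unfoldWord_inr, pairDegree, Finset.sum_add_distrib]

universe v

variable {k : Type v} [Field k] (s t : kˣ)

/-- The image of the rank one operator `μ^s(U_{n-i}) μ^t(U_{n+i})`, on two pairs of letters. -/
def pairCup (x y : Fin 2 × Fin 2) : k := cupVec s y.1 x.1 * cupVec t x.2 y.2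

/-- The linear form that defines the rank one operator `μ^s(U_{n-i}) μ^t(U_{n+i})`. -/
def pairCap (x y : Fin 2 × Fin 2) : k := capVec s y.1 x.1 * capVec t x.2 y.2

theorem sum_pairCap_mul_pairCup :
    ∑ x, ∑ y, pairCap s t x y * pairCup s t x y =
      ((s : k) + ((s⁻¹ : kˣ) : k)) * ((t : k) + ((t⁻¹ : kˣ) : k)) := by
  simp [Fintype.sum_prod_type, pairCap, pairCup, cupVec, capVec]
  ring

theorem pairCup_mul_pairCap (x y x' y' : Fin 2 × Fin 2) :
    pairCup s t x y * pairCap s t x' y' = pairCup s t x' y' * pairCap s t x y := by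
  rw [pairCup, pairCap, mul_mul_mul_comm, cupVec_mul_capVec s, cupVec_mul_capVec t,
    ← mul_mul_mul_comm]
  rfl

theorem pairCup_ne_zero {x y : Fin 2 × Fin 2} (h : pairCup s t x y ≠ 0) :
    y = (1 - x.1, 1 - x.2) := by
  obtain ⟨x₁, x₂⟩ := x
  obtain ⟨y₁, y₂⟩ := y
  fin_cases x₁ <;> fin_cases x₂ <;> fin_cases y₁ <;> fin_cases y₂ <;> simp_all [pairCup, cupVec]

/-- Folding reverses the left half of a word. So the left operator meets the sites `p, p'` in the
opposite order to the right one, and accordingly the first components in `pairCup` and `pairCap` are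
interchanged. -/
theorem twoSite_mul_twoSite_unfoldWord {p p' : Fin n} (hp : p ≠ p') (f : TensorSpace k (2 * n))
    (w : Fin n → Fin 2 × Fin 2) :
    twoSite (matU s) (sitePos n (.inl p')) (sitePos n (.inl p))
      (twoSite (matU t) (sitePos n (.inr p)) (sitePos n (.inr p')) f) (unfoldWord n w) =
      pairOp (pairCup s t) (pairCap s t) p p' (fun w => f (unfoldWord n w)) w := by
  have h1 : ∀ x y x' y' : Fin 2, unfoldWord n (Function.update (Function.update w p (x, y)) p'
      (x', y')) = Function.update (Function.update (Function.update (Function.update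
        (unfoldWord n w) (sitePos n (.inl p')) x') (sitePos n (.inl p)) x) (sitePos n (.inr p)) y)
        (sitePos n (.inr p')) y' := by
    intro x y x' y'
    rw [unfoldWord_update, unfoldWord_update,
      Function.update_comm (a := sitePos n (.inr p)) (by simp),
      Function.update_comm (a := sitePos n (.inl p)) (by simpa using hp)]
  rw [twoSite_matU, twoSite_matU, pairOp_apply, pairOp_apply]
  simp only [pairOp_apply, Fintype.sum_prod_type, h1, unfoldWord_inl]
  have h2 : ∀ (x x' : Fin 2) (r : Fin n), Function.update (Function.update (unfoldWord n w)
      (sitePos n (.inl p')) x') (sitePos n (.inl p)) x (sitePos n (.inr r)) = (w r).2 := by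
    intro x x' r
    rw [Function.update_of_ne (by simp), Function.update_of_ne (by simp), unfoldWord_inr]
  simp only [h2, Fin.sum_univ_two, pairCup, pairCap]
  ring

/-- The operator `e` on a pair of letters. -/
def pairBlob (c : k) (r : kˣ) (x y : Fin 2 × Fin 2) : k := c * matU r x y

theorem twoSite_unfoldWord (c : k) (r : kˣ) (p : Fin n) (f : TensorSpace k (2 * n))
    (w : Fin n → Fin 2 × Fin 2) :
    c * twoSite (matU r) (sitePos n (.inl p)) (sitePos n (.inr p)) f (unfoldWord n w) =
      letterOp (pairBlob c r) p (fun w => f (unfoldWord n w)) w := by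
  rw [twoSite_apply, letterOp_apply, Fintype.sum_prod_type, Finset.mul_sum]
  refine Finset.sum_congr rfl fun x _ => ?_
  rw [Finset.mul_sum]
  refine Finset.sum_congr rfl fun y _ => ?_
  rw [unfoldWord_update, unfoldWord_inl, unfoldWord_inr, pairBlob, mul_assoc]

theorem pairBlob_comm (c : k) (r : kˣ) (x y : Fin 2 × Fin 2) :
    pairBlob c r x y = pairBlob c r y x := by
  rw [pairBlob, pairBlob, matU_eq_mul, matU_eq_mul, cupVec_mul_capVec]

/-- The cup couples each pair of letters only with the complementary pair, which leaves one term. -/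
theorem sum_pairBlob_mul_pairCup (c : k) (r : kˣ) (x y : Fin 2 × Fin 2) :
    ∑ z, pairBlob c r x z * pairCup s t z y =
      pairBlob c r x (1 - y.1, 1 - y.2) * pairCup s t (1 - y.1, 1 - y.2) y := by
  refine Finset.sum_eq_single _ (fun z _ hz => ?_) (by simp)
  by_contra h
  refine hz ?_
  rw [pairCup_ne_zero s t (right_ne_zero_of_mul h)]
  simp

end Folding

/-! ### The blob algebra acting on `V^{⊗ 2n}` -/

section Crypto

variable {k : Type u} [Field k] (a x Q : kˣ) (ha : (a : k) ^ 4 = -1) (n : ℕ)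

/-- The coordinates of a vector of tensor space, with respect to words in pairs of letters. -/
def coords : Tensor a x Q ha n ≃ₗ[k] ((Fin n → Fin 2 × Fin 2) → k) where
  toFun f := fun w => (f : TensorSpace k (2 * n)) (unfoldWord n w)
  invFun f := (fun w => f ((unfoldWord n).symm w) : TensorSpace k (2 * n))
  map_add' _ _ := rfl
  map_smul' _ _ := rfl
  left_inv f := by
    refine funext fun w => ?_
    exact congrArg (f : TensorSpace k (2 * n)) ((unfoldWord n).apply_symm_apply w)
  right_inv f := by
    refine funext fun w => ?_
    exact congrArg f ((unfoldWord n).symm_apply_apply w)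

theorem isWordModel : IsWordModel (A := Alg x Q n) (gen _ _ _ n) (e _ _ _ n)
    (pairCup (a ^ 5 * x) (a ^ 3 * x)) (pairCap (a ^ 5 * x) (a ^ 3 * x))
    (pairBlob (((a⁻¹ : kˣ) : k) ^ 2) (a ^ 2 * Q)) (coords a x Q ha n) where
  pair p h m := by
    rw [gen_eq _ _ _ (by omega) h]
    refine funext fun w => ?_
    change cryptoRep a x Q ha n (U _ _ _ (p + 1) _ h) m (unfoldWord n w) = _
    rw [cryptoRep, U, lift_mk, FreeAlgebra.lift_ι_apply]
    refine Eq.trans ?_ (twoSite_mul_twoSite_unfoldWord (a ^ 5 * x) (a ^ 3 * x)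
      (p := ⟨p, by omega⟩) (p' := ⟨p + 1, h⟩) (Fin.ne_of_val_ne (by simp)) m w)
    have h1 : (⟨n - (p + 1) - 1, by omega⟩ : Fin (2 * n)) = sitePos n (.inl ⟨p + 1, h⟩) :=
      Fin.ext (by dsimp [sitePos]; omega)
    have h2 : (⟨n - (p + 1), by omega⟩ : Fin (2 * n)) = sitePos n (.inl ⟨p, by omega⟩) :=
      Fin.ext (by dsimp [sitePos]; omega)
    have h3 : (⟨n + (p + 1) - 1, by omega⟩ : Fin (2 * n)) = sitePos n (.inr ⟨p, by omega⟩) :=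
      Fin.ext (by dsimp [sitePos])
    have h4 : (⟨n + (p + 1), by omega⟩ : Fin (2 * n)) = sitePos n (.inr ⟨p + 1, h⟩) := rfl
    rw [← h1, ← h2, ← h3, ← h4]
    rfl
  letter h m := by
    rw [e_eq _ _ _ h]
    refine funext fun w => ?_
    change cryptoRep a x Q ha n (mk _ _ _ n _) m (unfoldWord n w) = _
    rw [cryptoRep, lift_mk, FreeAlgebra.lift_ι_apply]
    refine Eq.trans ?_ (twoSite_unfoldWord (((a⁻¹ : kˣ) : k) ^ 2) (a ^ 2 * Q) ⟨0, h⟩ m w)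
    rfl

theorem isTilting_of_grading
    (h2 : ((x ^ 2 : kˣ) : k) + (((x ^ 2)⁻¹ : kˣ) : k) ≠ 0) (hδ : (Q : k) - ((Q⁻¹ : kˣ) : k) ≠ 0)
    {D : ℕ} {dg : Fin 2 × Fin 2 → ℕ} {κ : ℕ}
    (hdg : ∀ y z, pairCup (a ^ 5 * x) (a ^ 3 * x) y z ≠ 0 → dg y + dg z = κ)
    {N : Fin D → Submodule (Alg x Q n) (Tensor a x Q ha n)}
    (hN : ∀ (r : Fin D) (m : Tensor a x Q ha n),
      m ∈ N r ↔ ∀ w, wordDegree dg w ≠ r → coords a x Q ha n m w = 0)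
    (hdeg : ∀ w : Fin n → Fin 2 × Fin 2, wordDegree dg w < D) (r : Fin D) :
    IsTilting (x ^ 2) (((Q * (x ^ 2)⁻¹ : kˣ) : k) - ((Q⁻¹ * x ^ 2 : kˣ) : k))
      ((Q : k) - ((Q⁻¹ : kˣ) : k)) n (N r) := by
  set γ := ((Q * (x ^ 2)⁻¹ : kˣ) : k) - ((Q⁻¹ * x ^ 2 : kˣ) : k) with hγ
  set δ := (Q : k) - ((Q⁻¹ : kˣ) : k) with hδ'
  have hlay : ∀ l : Weight n, l.1.natAbs + 2 * ((n - l.1.natAbs) / 2) = n := fun l => by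
    have := l.2
    omega
  have H := isBlobLike (x ^ 2) γ δ n
  -- The four pairs have weights `0, 1, 2, 3`, and complementary pairs add up to `3`; so `(0, 0) (1,
  -- 1)` is leading in the cup. The image of `e * U 1` involves only `(0, 1)` and `(1, 0)`, of
  -- weights `2` and `1`, in the first two places, and there `(0, 1) (0, 1)` is leading.
  let φ : Fin 2 × Fin 2 → ℕ := fun y => y.1.val + 2 * y.2.val
  have hD : HasFiltration (Alg x Q n) (Delta (x ^ 2) γ δ n) (N r) := by
    refine (isWordModel a x Q ha n).hasFiltration H h2
      ((sum_pairCap_mul_pairCup _ _).trans (two_mul_two a x ha)) (a := (0, 0)) (b := (1, 1))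
      (c := (0, 1)) (s := True) (φ := φ) ?_ ?_ ?_ ?_
      (fun i => n.choose i) (fun l : Weight n => (n - l.1.natAbs) / 2) ?_ ?_ ?_ ?_
      ?_ hdg hN hdeg r
    · simp [pairCup, cupVec]
    · intro y z h
      rw [pairCup_ne_zero _ _ h]
      obtain ⟨y₁, y₂⟩ := y
      fin_cases y₁ <;> fin_cases y₂ <;> simp [φ]
    · intro _
      rw [sum_pairBlob_mul_pairCup]
      simp [pairBlob, pairCup, matU_eq_mul, cupVec, capVec]
    · intro _ y z h
      rw [sum_pairBlob_mul_pairCup] at h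
      obtain ⟨y₁, y₂⟩ := y
      obtain ⟨z₁, z₂⟩ := z
      fin_cases y₁ <;> fin_cases y₂ <;> fin_cases z₁ <;> fin_cases z₂ <;>
        simp [φ, pairBlob, matU_eq_mul, cupVec, capVec] at h ⊢
    · exact fun l => chain_eq_capProd _ _ _ n _
    · exact fun l => ⟨_, by rw [chain_eq_capProd]⟩
    · intro l
      rw [chain_eq_capProd, chain_eq_capProd]
      -- For weight `0` no through strand is left, and the condition on the action of `e` is void.
      by_cases hl : l.1 = 0
      · exact H.finrank_standardModule_le_choose h2 (hlay l) (e_eq_zero _ _ _ n) (κ := 0)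
          (fun h => absurd h (by omega))
      · obtain ⟨κ, hκ⟩ := e_mul_signIdem (x ^ 2) γ n hδ hl
        exact H.finrank_standardModule_le_choose h2 (hlay l) (e_eq_zero _ _ _ n) (fun _ => hκ)
    · intro i hi
      -- If `n = 2 * i`, the layer has the single weight `0`. Otherwise it has the weights `n - 2 *
      -- i` and its negative, whose sign idempotents add up to `1`.
      rcases Nat.eq_zero_or_pos (n - 2 * i) with h0 | h0
      · refine ⟨{⟨0, by simp, by simp; omega⟩}, fun l hl => ?_, ?_⟩
        · rw [Finset.mem_singleton.1 hl]
          dsimp only [Int.natAbs_zero]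
          omega
        · rw [Finset.sum_singleton, signIdem, if_neg (lt_irrefl _), if_neg (lt_irrefl _), mul_one,
            chain_eq_capProd]
          congr 1
          dsimp only [Int.natAbs_zero]
          omega
      · have hne : (⟨((n - 2 * i : ℕ) : ℤ), by omega, by omega⟩ : Weight n) ≠
            ⟨-((n - 2 * i : ℕ) : ℤ), by omega, by omega⟩ := fun h => by
          have := congrArg Subtype.val h
          dsimp only at this
          omega
        have hi1 : (n - ((n - 2 * i : ℕ) : ℤ).natAbs) / 2 = i := by omega
        have hi2 : (n - (-((n - 2 * i : ℕ) : ℤ)).natAbs) / 2 = i := by omega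
        refine ⟨{⟨((n - 2 * i : ℕ) : ℤ), by omega, by omega⟩,
          ⟨-((n - 2 * i : ℕ) : ℤ), by omega, by omega⟩}, fun l hl => ?_, ?_⟩
        · rcases Finset.mem_insert.1 hl with rfl | hl
          · exact hi1
          · rw [Finset.mem_singleton.1 hl]
            exact hi2
        · rw [Finset.sum_pair hne]
          dsimp only
          rw [hi1, hi2, ← mul_add, signIdem, signIdem, if_pos (by omega), if_neg (by omega),
            if_pos (by omega), add_sub_cancel, mul_one, chain_eq_capProd]
    · exact (sum_reducedCount_choose (by simp) (by simp) n).le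
  refine ⟨hD, (isWordModel a x Q ha n).hasFiltration_costandardModule H (e_eq_zero _ _ _ n)
    (pairCup_mul_pairCap _ _) (pairBlob_comm _ _) (anti_gen _ _ _ n) (anti_e _ _ _ n)
    (fun l => anti_chain _ _ _ n _) (fun l => ?_) (hN r) hD⟩
  -- The antiautomorphism reverses the product of the two idempotents, and commutation restores the
  -- order.
  have hc := commute_chain_signIdem (x ^ 2) γ δ n ((n - l.1.natAbs) / 2) (l := l.1) (fun h => by
    have := hlay l
    omega)
  rw [map_mul, anti_chain, anti_signIdem, ← op_mul, hc.eq]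

variable {a x Q} in
theorem isTilting_permModule
    (h2 : ((x ^ 2 : kˣ) : k) + (((x ^ 2)⁻¹ : kˣ) : k) ≠ 0) (hδ : (Q : k) - ((Q⁻¹ : kˣ) : k) ≠ 0)
    {r : ℕ} (hr : r ≤ 2 * n) :
    IsTilting (x ^ 2) (((Q * (x ^ 2)⁻¹ : kˣ) : k) - ((Q⁻¹ * x ^ 2 : kˣ) : k))
      ((Q : k) - ((Q⁻¹ : kˣ) : k)) n (permModule a x Q ha n r) := by
  -- Two complementary pairs contain together two letters `1`, hence `κ := 2`.
  refine isTilting_of_grading a x Q ha n h2 hδ (D := 2 * n + 1) (dg := pairDegree) (κ := 2) ?_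
    (N := fun r => permModule a x Q ha n r) ?_ ?_ ⟨r, by omega⟩
  · intro y z h
    rw [pairCup_ne_zero _ _ h]
    obtain ⟨y₁, y₂⟩ := y
    fin_cases y₁ <;> fin_cases y₂ <;> simp [pairDegree]
  · intro r m
    simp only [← numOnes_unfoldWord]
    exact ((unfoldWord n).forall_congr_right
      (q := fun w => numOnes w ≠ r → (m : TensorSpace k (2 * n)) w = 0)).symm
  · intro w
    rw [← numOnes_unfoldWord]
    have := numOnes_le (unfoldWord n w)
    omega

variable {a x Q} in
theorem isTilting_tensor
    (h2 : ((x ^ 2 : kˣ) : k) + (((x ^ 2)⁻¹ : kˣ) : k) ≠ 0) (hδ : (Q : k) - ((Q⁻¹ : kˣ) : k) ≠ 0) :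
    IsTilting (x ^ 2) (((Q * (x ^ 2)⁻¹ : kˣ) : k) - ((Q⁻¹ * x ^ 2 : kˣ) : k))
      ((Q : k) - ((Q⁻¹ : kˣ) : k)) n (Tensor a x Q ha n) := by
  have h := isTilting_of_grading a x Q ha n h2 hδ (D := 1) (dg := fun _ => 0) (κ := 0)
    (fun _ _ _ => rfl) (N := fun _ => ⊤) (by
      intro r m
      simp [wordDegree_const_zero]) (by
      intro w
      rw [wordDegree_const_zero]
      exact one_pos) 0
  exact ⟨h.1.congr Submodule.topEquiv, h.2.congr Submodule.topEquiv⟩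

end Crypto

end BlobAlg

end BlobTilting

/-- Tensor space and its permutation modules are tilting modules. The dimensions of the layers of the
filtration by the submodules `A e_i M` are bounded by counting words, and the bounds add up to the
dimension of tensor space; so the filtrations exist whether or not the adjunction maps are injective,
and the proof does not use that hypothesis. -/
theorem mainTheorem8 {k : Type*} [Field k] :
    (∀ (q : kˣ) (h2 : (q : k) + ((q⁻¹ : kˣ) : k) ≠ 0),
      (∀ n : ℕ, Function.Injective (BlobTilting.TLAlg.phi q h2 n)) →
      ∀ n : ℕ,
        BlobTilting.TLAlg.IsTilting q n (BlobTilting.TLAlg.Tensor q n) ∧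
        ∀ r ≤ n, BlobTilting.TLAlg.IsTilting q n (BlobTilting.TLAlg.permModule q n r)) ∧
    (∀ (a x Q : kˣ) (ha : (a : k) ^ 4 = -1)
      (h2 : ((x ^ 2 : kˣ) : k) + (((x ^ 2)⁻¹ : kˣ) : k) ≠ 0)
      (_ : (Q : k) - ((Q⁻¹ : kˣ) : k) ≠ 0),
      (∀ n : ℕ, Function.Injective (BlobTilting.BlobAlg.phi a x Q ha h2 n)) →
      ∀ n : ℕ,
        BlobTilting.BlobAlg.IsTilting (x ^ 2)
          (((Q * (x ^ 2)⁻¹ : kˣ) : k) - ((Q⁻¹ * x ^ 2 : kˣ) : k)) ((Q : k) - ((Q⁻¹ : kˣ) : k)) n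
          (BlobTilting.BlobAlg.Tensor a x Q ha n) ∧
        ∀ r ≤ 2 * n, BlobTilting.BlobAlg.IsTilting (x ^ 2)
          (((Q * (x ^ 2)⁻¹ : kˣ) : k) - ((Q⁻¹ * x ^ 2 : kˣ) : k)) ((Q : k) - ((Q⁻¹ : kˣ) : k)) n
          (BlobTilting.BlobAlg.permModule a x Q ha n r)) := by
  refine ⟨fun q h2 _ n => ⟨BlobTilting.TLAlg.isTilting_tensor q n h2,
    fun r hr => BlobTilting.TLAlg.isTilting_permModule q n h2 hr⟩, fun a x Q ha h2 hδ _ n =>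
    ⟨BlobTilting.BlobAlg.isTilting_tensor ha n h2 hδ,
      fun r hr => BlobTilting.BlobAlg.isTilting_permModule ha n h2 hδ hr⟩⟩
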